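/- Consider a parallel service system with servers $s_1,\dots,s_J$ ($J\ge 1$), customer types $c_1,\dots,c_I$ and a bipartite compatibility graph $\mathcal G$, where $(s_j,c_i)\in\mathcal G$ means that $s_j$ can serve type $c_i$; $\mathcal C(s)$ denotes the types compatible with $s$, $\mathcal S(c)$ the servers compatible with $c$, and $\mathcal C(S)=\bigcup_{s\in S}\mathcal C(s)$. Customers arrive in a renewal stream of rate $\lambda>0$; customer types are i.i.d. with probabilities $\alpha_{c_i}>0$; the processing times of type $c_i$ by server $s_j$ are i.i.d. with mean $1/\mu_{s_j,c_i}\in(0,\infty)$; all these sequences are independent. The policy is first come first served, with assignment of an arriving customer to the longest idle compatible server (FCFS-ALIS). Customers are numbered in order of arrival, those present at time $0$ having non-positive numbers. $P_s(t)$, the position of server $s$, is the number of the customer it is serving; idle servers have the positions following that of the last arrival, in increasing order of idleness. $T_{s,c}(t)$ is the time spent by $s$ on type $c$ in $(0,t)$ and $D_{s,c}(t)$ the number of services of type $c$ completed by $s$ in $(0,t]$. At time $0$ each server is busy with a compatible customer, different servers with different ones. A fluid limit $(\bar P,\bar T,\bar D)$ from $\bar P(0)=p_0\le 0$ is a limit,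 for a fixed realisation of the primitives, along a subsequence of $n\to\infty$ of $\frac1n\bigl(P^n,T^n,D^n\bigr)(nt)$, uniformly on compacts (of $(0,\infty)$ for the positions, which may jump at $0$), for systems with the same primitives and with initial states for which $P^n(0)/n\to p_0$, and the residual arrival and processing times at time $0$, divided by $n$, tend to $0$. Let $\bar Y_1(t)\le\dots\le\bar Y_J(t)$ be the ordered values of $\bar P_{s_1}(t),\dots,\bar P_{s_J}(t)$ and $|\bar P(0)|=-\sum_j\bar P_{s_j}(0)$. Complete resource pooling (respectively complete weak resource pooling) means: for every $\lambda>0$ and every value of $|\bar P(0)|$ there is $t_0$ such that almost surely every fluid limit with this value of $|\bar P(0)|$ satisfies $\bar Y_J(t)-\bar Y_1(t)=0$ (respectively $\dot{\bar Y}_1(t)=\dots=\dot{\bar Y}_J(t)$) for all $t>t_0$. For an ordered partition $(S_1,\dots,S_L)$ of the servers into non-empty sets put $C_\ell=\mathcal C(S_\ell)\setminus\mathcal C(S_{\ell+1}\cup\dots\cup S_L)$. It is valid for a fluid limit on $(t_1,t_2)$, $0\le t_1<t_2$, if every subgraph $(S_\ell,C_\ell)$ is connected and, for all $\tau\in(t_1,t_2)$,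 the servers of a block have the same position $\bar Y_{S_\ell}(\tau)$, while for $\ell<\ell'$ either $\bar Y_{S_\ell}(\tau)<\bar Y_{S_{\ell'}}(\tau)$, or $\bar Y_{S_\ell}(\tau)=\bar Y_{S_{\ell'}}(\tau)$ and there is no edge between the subgraphs $(S_\ell,C_\ell)$ and $(S_{\ell'},C_{\ell'})$. **Theorem.** Assume that $\mathcal G$ is a tree. (i) Let $\lambda>0$. Almost surely, for every fluid limit, every partition valid for it on some $(t_1,t_2)$ and every block $S_\ell$, the equations $$\sum_{c\in\mathcal C(s)\cap C_\ell}\eta_{s,c}=1\quad(s\in S_\ell),\qquad y=\frac1{\alpha_c}\sum_{s\in S_\ell\cap\mathcal S(c)}\mu_{s,c}\,\eta_{s,c}\quad(c\in C_\ell)$$ in the unknowns $y$ and $\eta_{s,c}$, $(s,c)$ an edge of $(S_\ell,C_\ell)$, have a unique solution; and if $\bar Y_{S_\ell}(\tau)<\lambda\tau$ on $(t_1,t_2)$, then on $(t_1,t_2)$ the derivatives are constant: $\dot{\bar P}_s=y$ and $\dot{\bar T}_{s,c}=\eta_{s,c}$ for $s\in S_\ell$ (with $\eta_{s,c}=0$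 off the edges of $(S_\ell,C_\ell)$). For every $p_0\le0$ there are continuous piecewise linear trajectories $p_s$ on $(0,\infty)$ (with finitely many breakpoints) such that almost surely fluid limits from $p_0$ exist and all of them satisfy $\bar P_s(t)=p_s(t)$ for all $s$ and $t>0$. (ii) The linear system $$\sum_{c\in\mathcal C(s)}\eta_{s,c}=1\ \text{ for all servers } s,\qquad \sum_{s\in\mathcal S(c)}\frac{\mu_{s,c}}{\alpha_c}\,\eta_{s,c}=\mu\ \text{ for all types } c,$$ in the unknowns $\eta_{s,c}$, $(s,c)\in\mathcal G$, and $\mu$, has a unique solution. Complete resource pooling holds if and only if the solution is positive; if it is non-negative, then complete weak resource pooling holds. (iii) If complete resource pooling holds, then $\mu$ is the pooled service rate and the matching rates (the fractions of services of type $c$ by server $s$ among all services) are $$r_{s,c}=\frac{\mu_{s,c}\,\eta_{s,c}}{\mu}.$$ That is: for every $\lambda>0$ and every value of $|\bar P(0)|$ there is $t_0$ such that almost surely, for every fluid limit with this value of $|\bar P(0)|$ and every $t>t_0$ with $\bar Y_J(t)<\lambda t$, one has $\dot{\bar Y}_j(t)=\mu$ for all $j$, $\sum_{s,c}\dot{\bar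 D}_{s,c}(t)=\mu$ and $\dot{\bar D}_{s,c}(t)/\sum_{s',c'}\dot{\bar D}_{s',c'}(t)=r_{s,c}$; and for every $\lambda>\mu$, almost surely, from every initial state, $\frac1t\sum_{s',c'}D_{s',c'}(t)\to\mu$ and $D_{s,c}(t)/\sum_{s',c'}D_{s',c'}(t)\to r_{s,c}$ as $t\to\infty$. -/

import Mathlib

open MeasureTheory ProbabilityTheory Filter Topology Set

noncomputable section

namespace SkillBased

/-! ### The compatibility graph

`J` servers are indexed by `Fin J`, `I` customer types by `Fin I`; `E s c` says that server `s` can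
serve customers of type `c`. -/

/-- The bipartite compatibility graph, on the disjoint union of the servers and the types. -/
def compatGraph {J I : ℕ} (E : Fin J → Fin I → Prop) : SimpleGraph (Fin J ⊕ Fin I) :=
  SimpleGraph.fromRel fun x y => ∃ s c, E s c ∧ x = Sum.inl s ∧ y = Sum.inr c

/-! ### The stochastic primitives -/

/-- One realisation of the primitives: `u ℓ` is the time between the arrivals of customers `ℓ - 1`
and `ℓ`, `ξ ℓ` is the type of customer `ℓ`, and `v s c k` is the processing time of the `(k+1)`-st
customer of type `c` whose service by server `s` starts after time zero. -/
structure Sample (J I : ℕ) where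
  u : ℤ → ℝ
  ξ : ℤ → Fin I
  v : Fin J → Fin I → ℕ → ℝ

/-- The standing assumptions on the random primitives.  For every arrival rate `lam > 0` there is
a sequence `u lam` of interarrival times (with an arbitrary distribution of mean `1 / lam`); the
types have probabilities `α`, the processing times of link `(s, c)` have an arbitrary distribution
of mean `1 / rate s c`; each sequence is i.i.d. and all the sequences are independent. -/
structure IsPrimitives {J I : ℕ} {Ω : Type*} [MeasurableSpace Ω] (Pr : Measure Ω)
    (E : Fin J → Fin I → Prop) (α : Fin I → ℝ) (rate : Fin J → Fin I → ℝ)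
    (u : ℝ → ℤ → Ω → ℝ) (ξ : ℤ → Ω → Fin I) (v : Fin J → Fin I → ℕ → Ω → ℝ) : Prop where
  measurable_u : ∀ lam, 0 < lam → ∀ ℓ, Measurable (u lam ℓ)
  measurable_ξ : ∀ ℓ, Measurable (ξ ℓ)
  measurable_v : ∀ s c, E s c → ∀ k, Measurable (v s c k)
  indep : ∀ lam, 0 < lam →
    iIndep
      (Sum.elim (fun ℓ : ℤ => MeasurableSpace.comap (u lam ℓ) inferInstance)
        (Sum.elim (fun ℓ : ℤ => MeasurableSpace.comap (ξ ℓ) inferInstance)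
          (fun e : {e : Fin J × Fin I // E e.1 e.2} × ℕ =>
            MeasurableSpace.comap (v e.1.1.1 e.1.1.2 e.2) inferInstance))) Pr
  u_ident : ∀ lam, 0 < lam → ∀ ℓ, IdentDistrib (u lam ℓ) (u lam 0) Pr Pr
  u_nonneg : ∀ lam, 0 < lam → ∀ ℓ, 0 ≤ᵐ[Pr] u lam ℓ
  u_integrable : ∀ lam, 0 < lam → Integrable (u lam 0) Pr
  u_mean : ∀ lam, 0 < lam → ∫ ω, u lam 0 ω ∂Pr = 1 / lam
  α_pos : ∀ c, 0 < α c
  ξ_law : ∀ ℓ c, Pr.real {ω | ξ ℓ ω = c} = α c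
  rate_pos : ∀ s c, E s c → 0 < rate s c
  v_ident : ∀ s c, E s c → ∀ k, IdentDistrib (v s c k) (v s c 0) Pr Pr
  v_nonneg : ∀ s c, E s c → ∀ k, 0 ≤ᵐ[Pr] v s c k
  v_integrable : ∀ s c, E s c → Integrable (v s c 0) Pr
  v_mean : ∀ s c, E s c → ∫ ω, v s c 0 ω ∂Pr = 1 / rate s c

/-- The realisation at `ω` of the primitives of the system with arrival rate `lam`. -/
def sample {J I : ℕ} {Ω : Type*} (u : ℝ → ℤ → Ω → ℝ) (ξ : ℤ → Ω → Fin I)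
    (v : Fin J → Fin I → ℕ → Ω → ℝ) (lam : ℝ) (ω : Ω) : Sample J I where
  u := fun ℓ => u lam ℓ ω
  ξ := fun ℓ => ξ ℓ ω
  v := fun s c k => v s c k ω

/-! ### The system under FCFS-ALIS -/

/-- The state of the system together with cumulative counters.  Customers are numbered in order of
arrival, customers `1, 2, …` arriving after time zero.  A server `s` with `pos s ≤ arrived` is busy
with customer number `pos s`; the idle servers have the positions `arrived + 1, …, arrived + k`, in
increasing order of the duration of idleness. -/
structure State (J I : ℕ) where
  /-- current time -/
  time : ℝ
  /-- the number `A(t)` of the last customer that has arrived -/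
  arrived : ℤ
  /-- positions of the servers -/
  pos : Fin J → ℤ
  /-- remaining processing time (of a busy server) -/
  residual : Fin J → ℝ
  /-- remaining time until the next arrival -/
  nextArrival : ℝ
  /-- number of services of type `c` started by server `s` after time zero -/
  started : Fin J → Fin I → ℕ
  /-- cumulative time that server `s` has spent on type `c` since time zero -/
  work : Fin J → Fin I → ℝ
  /-- number of services of type `c` completed by server `s` since time zero -/
  done : Fin J → Fin I → ℕ

namespace State

variable {J I : ℕ}

/-- Server `s` is busy. -/
def Busy (x : State J I) (s : Fin J) : Prop := x.pos s ≤ x.arrived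

open Classical in
/-- Let time `δ` elapse, without any arrival or service completion. -/
def advance (w : Sample J I) (x : State J I) (δ : ℝ) : State J I :=
  { x with
    time := x.time + δ
    residual := fun s => if x.Busy s then x.residual s - δ else x.residual s
    nextArrival := x.nextArrival - δ
    work := fun s c =>
      if x.Busy s ∧ w.ξ (x.pos s) = c then x.work s c + δ else x.work s c }

/-- Customer `ℓ` has arrived and is waiting: no server compatible with it has reached it. -/
def Waiting (E : Fin J → Fin I → Prop) (w : Sample J I) (x : State J I) (ℓ : ℤ) : Prop :=
  ℓ ≤ x.arrived ∧ ∀ s, E s (w.ξ ℓ) → x.pos s < ℓ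

open Classical in
/-- Server `s` starts to process customer `ℓ`. -/
def start (w : Sample J I) (x : State J I) (s : Fin J) (ℓ : ℤ) : State J I :=
  { x with
    pos := Function.update x.pos s ℓ
    residual := Function.update x.residual s (w.v s (w.ξ ℓ) (x.started s (w.ξ ℓ)))
    started := fun s' c =>
      if s' = s ∧ c = w.ξ ℓ then x.started s' c + 1 else x.started s' c }

/-- A new customer enters the list of arrived customers. -/
def arrive (w : Sample J I) (x : State J I) : State J I :=
  { x with
    arrived := x.arrived + 1
    nextArrival := w.u (x.arrived + 2) }

open Classical in
/-- The positions of the idle servers whose position is less than `q` move up by one. -/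
def shiftIdleBelow (x : State J I) (q : ℤ) : State J I :=
  { x with
    pos := fun s => if ¬ x.Busy s ∧ x.pos s < q then x.pos s + 1 else x.pos s }

open Classical in
/-- The positions of all the idle servers move up by one. -/
def shiftIdle (x : State J I) : State J I :=
  { x with pos := fun s => if x.Busy s then x.pos s else x.pos s + 1 }

/-- Server `s` becomes idle, as the server that has been idle for the shortest time. -/
def becomeIdle (x : State J I) (s : Fin J) : State J I :=
  { x.shiftIdle with pos := Function.update x.shiftIdle.pos s (x.arrived + 1) }

open Classical in
/-- Record the completion by server `s` of its current service. -/
def complete (w : Sample J I) (x : State J I) (s : Fin J) : State J I :=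
  { x with
    done := fun s' c =>
      if s' = s ∧ c = w.ξ (x.pos s) then x.done s' c + 1 else x.done s' c }

/-- No arrival and no service completion is due before `δ` time units from now. -/
def CanWait (x : State J I) (δ : ℝ) : Prop :=
  δ ≤ x.nextArrival ∧ ∀ s, x.Busy s → δ ≤ x.residual s

/-- One event of the system under FCFS-ALIS.  Simultaneous events are processed one after the other,
in an arbitrary order. -/
inductive Step (E : Fin J → Fin I → Prop) (w : Sample J I) : State J I → State J I → Prop
  /-- A customer arrives, finds idle compatible servers, and is assigned to the one that has been
  idle for the longest time. -/
  | arrivalServed (x : State J I) (s : Fin J) (hδ : x.CanWait x.nextArrival)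
      (hidle : ¬ x.Busy s) (hcompat : E s (w.ξ (x.arrived + 1)))
      (hlongest : ∀ s', ¬ x.Busy s' → E s' (w.ξ (x.arrived + 1)) → x.pos s' ≤ x.pos s) :
      Step E w x
        ((((x.advance w x.nextArrival).shiftIdleBelow (x.pos s)).arrive w).start w s
          (x.arrived + 1))
  /-- A customer arrives, finds no idle compatible server, and waits. -/
  | arrivalWaits (x : State J I) (hδ : x.CanWait x.nextArrival)
      (hnone : ∀ s, E s (w.ξ (x.arrived + 1)) → x.Busy s) :
      Step E w x ((x.advance w x.nextArrival).shiftIdle.arrive w)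
  /-- A server completes a service and takes the first waiting compatible customer. -/
  | completionNext (x : State J I) (s : Fin J) (ℓ : ℤ) (hbusy : x.Busy s)
      (hδ : x.CanWait (x.residual s))
      (hfirst : IsLeast {ℓ' | x.Waiting E w ℓ' ∧ E s (w.ξ ℓ')} ℓ) :
      Step E w x (((x.advance w (x.residual s)).complete w s).start w s ℓ)
  /-- A server completes a service, finds no waiting compatible customer, and becomes idle. -/
  | completionIdle (x : State J I) (s : Fin J) (hbusy : x.Busy s)
      (hδ : x.CanWait (x.residual s))
      (hnone : ∀ ℓ', x.Waiting E w ℓ' → ¬ E s (w.ξ ℓ')) :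
      Step E w x (((x.advance w (x.residual s)).complete w s).becomeIdle s)

/-- An initial state: time is zero, customers `…, -1, 0` have arrived, every server is busy with a
customer compatible with it, different servers with different customers. -/
structure IsInitial (E : Fin J → Fin I → Prop) (w : Sample J I) (x : State J I) : Prop where
  time_eq : x.time = 0
  arrived_eq : x.arrived = 0
  pos_nonpos : ∀ s, x.pos s ≤ 0
  pos_injective : Function.Injective x.pos
  compat : ∀ s, E s (w.ξ (x.pos s))
  residual_nonneg : ∀ s, 0 ≤ x.residual s
  nextArrival_nonneg : 0 ≤ x.nextArrival
  started_eq : ∀ s c, x.started s c = 0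
  work_eq : ∀ s c, x.work s c = 0
  done_eq : ∀ s c, x.done s c = 0

end State

/-- `x 0, x 1, …` are the states of the system after its successive events. -/
structure IsRun {J I : ℕ} (E : Fin J → Fin I → Prop) (w : Sample J I) (x : ℕ → State J I) :
    Prop where
  initial : (x 0).IsInitial E w
  step : ∀ k, State.Step E w (x k) (x (k + 1))

/-- The state at time `t` of a run: all the events up to and including time `t` have taken place. -/
def stateAt {J I : ℕ} (w : Sample J I) (x : ℕ → State J I) (t : ℝ) : State J I :=
  (x (sSup {k | (x k).time ≤ t})).advance w (t - (x (sSup {k | (x k).time ≤ t})).time)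

/-! ### Fluid limits -/

/-- Uniform convergence on the compact subsets of `A`. -/
def UnifOnCompacts (f : ℕ → ℝ → ℝ) (g : ℝ → ℝ) (A : Set ℝ) : Prop :=
  ∀ K ⊆ A, IsCompact K → TendstoUniformlyOn f g atTop K

/-- `P` (positions), `T` (cumulative processing times) and `D` (service completions) form a fluid
limit with initial positions `p₀`: the limit, along a subsequence `r`, of the fluid scalings
`z^r(r t) / r` of a sequence of systems that share the primitives `w` and whose initial states
satisfy `P^n(0)/n → p₀`, `U^n(0)/n → 0`, `V^n(0)/n → 0`.  As positions may jump at time zero in the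
limit, their convergence is uniform on the compact subsets of `(0, ∞)`. -/
def IsFluidLimit {J I : ℕ} (E : Fin J → Fin I → Prop) (w : Sample J I) (p₀ : Fin J → ℝ)
    (P : Fin J → ℝ → ℝ) (T D : Fin J → Fin I → ℝ → ℝ) : Prop :=
  (∀ s, P s 0 = p₀ s) ∧
  ∃ X : ℕ → ℕ → State J I,
    (∀ n, IsRun E w (X n)) ∧
    (∀ s, Tendsto (fun n : ℕ => ((X n 0).pos s : ℝ) / n) atTop (𝓝 (p₀ s))) ∧
    Tendsto (fun n : ℕ => (X n 0).nextArrival / n) atTop (𝓝 0) ∧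
    (∀ s, Tendsto (fun n : ℕ => (X n 0).residual s / n) atTop (𝓝 0)) ∧
    ∃ r : ℕ → ℕ, StrictMono r ∧
      (∀ s, UnifOnCompacts
        (fun k t => ((stateAt w (X (r k)) (r k * t)).pos s : ℝ) / r k) (P s) (Ioi 0)) ∧
      (∀ s c, UnifOnCompacts
        (fun k t => (stateAt w (X (r k)) (r k * t)).work s c / r k) (T s c) (Ici 0)) ∧
      (∀ s c, UnifOnCompacts
        (fun k t => ((stateAt w (X (r k)) (r k * t)).done s c : ℝ) / r k) (D s c) (Ici 0))

/-- The level `Y_j(t)`: the `j`-th smallest of the positions at time `t` (with `j` counted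
from `0`). -/
def level {J : ℕ} (P : Fin J → ℝ → ℝ) (j : Fin J) (t : ℝ) : ℝ :=
  P (Tuple.sort (fun s => P s t) j) t

/-- The highest level `Y_J(t)`. -/
def topLevel {J : ℕ} [NeZero J] (P : Fin J → ℝ → ℝ) (t : ℝ) : ℝ := level P (Fin.rev 0) t

/-- The lowest level `Y_1(t)`. -/
def bottomLevel {J : ℕ} [NeZero J] (P : Fin J → ℝ → ℝ) (t : ℝ) : ℝ := level P 0 t

/-- `f` is piecewise linear on `(0, ∞)`, with finitely many breakpoints. -/
def PiecewiseLinear (f : ℝ → ℝ) : Prop :=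
  ∃ F : Finset ℝ, ∀ a b, 0 < a → a < b → (∀ x ∈ F, x ∉ Ioo a b) →
    ∃ m k : ℝ, ∀ t ∈ Icc a b, f t = m * t + k

/-- Initial fluid positions: non-positive, with `|p₀| = -∑ p₀ s = d`. -/
def InitialPositions {J : ℕ} (d : ℝ) (p₀ : Fin J → ℝ) : Prop :=
  (∀ s, p₀ s ≤ 0) ∧ -∑ s, p₀ s = d

/-- Complete resource pooling: for all arrival rates and every `d` there is `t₀` such that almost
surely, for every fluid limit with `|P(0)| = d`, all levels coincide after `t₀`. -/
def CompleteResourcePooling {J I : ℕ} [NeZero J] {Ω : Type*} [MeasurableSpace Ω] (Pr : Measure Ω)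
    (E : Fin J → Fin I → Prop) (u : ℝ → ℤ → Ω → ℝ) (ξ : ℤ → Ω → Fin I)
    (v : Fin J → Fin I → ℕ → Ω → ℝ) : Prop :=
  ∀ lam : ℝ, 0 < lam → ∀ d : ℝ, ∃ t₀ : ℝ, ∀ᵐ ω ∂Pr, ∀ p₀, InitialPositions d p₀ →
    ∀ P T D, IsFluidLimit E (sample u ξ v lam ω) p₀ P T D →
      ∀ t, t₀ < t → topLevel P t - bottomLevel P t = 0

/-- Complete weak resource pooling: as above, but after `t₀` all levels have the same derivative. -/
def CompleteWeakResourcePooling {J I : ℕ} {Ω : Type*} [MeasurableSpace Ω]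
    (Pr : Measure Ω) (E : Fin J → Fin I → Prop) (u : ℝ → ℤ → Ω → ℝ) (ξ : ℤ → Ω → Fin I)
    (v : Fin J → Fin I → ℕ → Ω → ℝ) : Prop :=
  ∀ lam : ℝ, 0 < lam → ∀ d : ℝ, ∃ t₀ : ℝ, ∀ᵐ ω ∂Pr, ∀ p₀, InitialPositions d p₀ →
    ∀ P T D, IsFluidLimit E (sample u ξ v lam ω) p₀ P T D →
      ∀ t, t₀ < t → ∃ y : ℝ, ∀ j, HasDerivAt (level P j) y t

/-! ### Ordered partitions and the fluid equations

An ordered partition `(S_1, …, S_L)` of the servers is given by the surjective function `b` that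
maps a server to the index of its block. -/

/-- `C_ℓ`: the types served by block `ℓ` and by no later block. -/
def blockTypes {J I L : ℕ} (E : Fin J → Fin I → Prop) (b : Fin J → Fin L) (ℓ : Fin L) :
    Set (Fin I) :=
  {c | (∃ s, b s = ℓ ∧ E s c) ∧ ∀ s, ℓ < b s → ¬ E s c}

/-- The nodes of the subgraph `(S_ℓ, C_ℓ)`. -/
def blockNodes {J I L : ℕ} (E : Fin J → Fin I → Prop) (b : Fin J → Fin L) (ℓ : Fin L) :
    Set (Fin J ⊕ Fin I) :=
  Sum.inl '' {s | b s = ℓ} ∪ Sum.inr '' blockTypes E b ℓ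

/-- The partition `b` is valid for the positions `P` on the time interval `(t₁, t₂)`: the servers of
a block move together, every `(S_ℓ, C_ℓ)` is connected, and an earlier block is behind a later one,
or at the same level and not linked to it by any edge. -/
structure ValidPartition {J I L : ℕ} (E : Fin J → Fin I → Prop) (P : Fin J → ℝ → ℝ)
    (t₁ t₂ : ℝ) (b : Fin J → Fin L) : Prop where
  surjective : Function.Surjective b
  connected : ∀ ℓ, ((compatGraph E).induce (blockNodes E b ℓ)).Connected
  together : ∀ τ ∈ Ioo t₁ t₂, ∀ s s', b s = b s' → P s τ = P s' τ
  ordered : ∀ τ ∈ Ioo t₁ t₂, ∀ s s', b s < b s' → P s τ < P s' τ ∨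
    (P s τ = P s' τ ∧ ∀ x ∈ blockNodes E b (b s), ∀ y ∈ blockNodes E b (b s'),
      ¬ (compatGraph E).Adj x y)

open Classical in
/-- The fluid equations of block `ℓ`, with an unknown `η s c` (the derivative of the cumulative
processing time) for each edge of `(S_ℓ, C_ℓ)`, extended by zero, and the unknown common speed `y`:
`∑_{c ∈ C(s) ∩ C_ℓ} η s c = 1` for `s ∈ S_ℓ` and `y = (1/α c) ∑_{s ∈ S_ℓ} rate s c * η s c` for
`c ∈ C_ℓ`. -/
structure BlockEquations {J I L : ℕ} (E : Fin J → Fin I → Prop) (α : Fin I → ℝ)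
    (rate : Fin J → Fin I → ℝ) (b : Fin J → Fin L) (ℓ : Fin L)
    (η : Fin J → Fin I → ℝ) (y : ℝ) : Prop where
  support : ∀ s c, ¬ (E s c ∧ b s = ℓ ∧ c ∈ blockTypes E b ℓ) → η s c = 0
  busy : ∀ s, b s = ℓ → ∑ c with E s c ∧ c ∈ blockTypes E b ℓ, η s c = 1
  speed : ∀ c ∈ blockTypes E b ℓ,
    y = 1 / α c * ∑ s with E s c ∧ b s = ℓ, rate s c * η s c

open Classical in
/-- The pooling equations `∑_{c ∈ C(s)} η s c = 1` for all servers `s` and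
`∑_{s ∈ S(c)} (rate s c / α c) * η s c = m` for all types `c`, with an unknown `η s c` for each edge
(extended by zero) and the unknown `m`. -/
structure PoolingEquations {J I : ℕ} (E : Fin J → Fin I → Prop) (α : Fin I → ℝ)
    (rate : Fin J → Fin I → ℝ) (η : Fin J → Fin I → ℝ) (m : ℝ) : Prop where
  support : ∀ s c, ¬ E s c → η s c = 0
  server : ∀ s, ∑ c with E s c, η s c = 1
  customer : ∀ c, ∑ s with E s c, rate s c / α c * η s c = m

/-- The total number of services completed. -/
def State.totalDone {J I : ℕ} (x : State J I) : ℕ := ∑ s, ∑ c, x.done s c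

end SkillBased

end

open SkillBased

namespace SkillBased

/-! ### Linear equations on trees -/

section Tree

variable {J I : ℕ} {E : Fin J → Fin I → Prop}

/-! Randomness enters only through laws of large numbers, collected in `Regular`. The front of a
type is the largest position, cut off at the last arrival, of the servers that can serve it. Under
first come, first served, the services of type `c` started so far are exactly the customers of type
`c` between the initial and the present front (`Ledger.front`). On the fluid scale, therefore, `α c`
times the displacement of front `c` equals `∑ s, rate s c * T s c`; a server sits at the lowest
front among its types and works only there, and it idles only if that front has reached the last
arrival (`FluidScaling.fluidPath`).

The tree enters through `exists_weights`: on an acyclic graph the logarithms of the rates are sums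
of a server term and a type term, so `rate s c / α c = a s / w c` on every edge. For the lag `R c`
of front `c` relative to the last arrival this gives `w c * R' c = ∑ s, a s * x s c - lam * w c`,
where each row of `x` minimises `∑ c, x s c * R c` over the divisions of a unit of time, idleness
included. So the fluid model is the gradient ascent, in the inner product with weights `w`, of the
concave piecewise linear function `∑ s, a s * lowest E s R - lam * ∑ c, w c * R c`. Monotonicity of
supergradients gives contraction and hence uniqueness (`Flow.contraction`). The right velocity is
the supergradient of least norm; it takes finitely many values, and its norm drops strictly whenever
it changes, so trajectories have finitely many linear pieces (`Flow.exists_segment`,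
`Flow.exists_finite_affine`).

For a valid partition, the difference quotients of the processing times over any short interval
solve the block equations exactly. These have at most one solution on an acyclic graph, so the
quotients are constant (`FluidPath.hasDerivAt_block`).

For pooling, let `η, m` solve the pooling equations with `η` non-negative. Subtracting a suitable
linear term from the concave function gives `potential`, which is at most zero and grows along the
flow at least at the squared distance of the velocity from the terminal velocity `min (m - lam) 0`.
As there are finitely many velocities, the terminal one is attained within a bounded time
(`exists_settling_time`), and it is never left because no allocation has smaller energy. In that
regime the potential vanishes; if `η` is positive this forces compatible fronts to coincide, and
connectedness forces all of them to (`Flow.pooled_of_terminal`).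

Conversely, take `lam > m`. Pooled motion from an empty queue has `η` as derivative of the
nondecreasing processing times, so `η` is non-negative. If an edge carries no flow, its removal
splits the tree into two sides that both move at speed `m` and never meet when started apart
(`exists_never_pooled`).

The matching rates are the derivatives `rate s c * η s c`. For the system itself, a single run
observed at the scale of its own time has every fluid limit starting from zero positions, and the
explicit pooled solution identifies the limit at time one (`Regular.tendsto_done`). -/

lemma compatGraph_adj_iff {x y : Fin J ⊕ Fin I} :
    (compatGraph E).Adj x y ↔ ∃ s c, E s c ∧
      (x = Sum.inl s ∧ y = Sum.inr c ∨ x = Sum.inr c ∧ y = Sum.inl s) := by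
  simp only [compatGraph, SimpleGraph.fromRel_adj]
  constructor
  · rintro ⟨-, ⟨s, c, h, rfl, rfl⟩ | ⟨s, c, h, rfl, rfl⟩⟩
    · exact ⟨s, c, h, Or.inl ⟨rfl, rfl⟩⟩
    · exact ⟨s, c, h, Or.inr ⟨rfl, rfl⟩⟩
  · rintro ⟨s, c, h, ⟨rfl, rfl⟩ | ⟨rfl, rfl⟩⟩
    · exact ⟨by simp, Or.inl ⟨s, c, h, rfl, rfl⟩⟩
    · exact ⟨by simp, Or.inr ⟨s, c, h, rfl, rfl⟩⟩

lemma compatGraph_adj {s : Fin J} {c : Fin I} :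
    (compatGraph E).Adj (Sum.inl s) (Sum.inr c) ↔ E s c := by
  rw [compatGraph_adj_iff]
  constructor
  · rintro ⟨s', c', h, ⟨h1, h2⟩ | ⟨h1, h2⟩⟩
    · cases h1; cases h2; exact h
    · cases h1
  · exact fun h => ⟨s, c, h, Or.inl ⟨rfl, rfl⟩⟩

/-- Every server has a compatible type, and conversely, in a connected graph with a server and
a type. -/
lemma exists_compat_type (hG : (compatGraph E).Connected) (c₀ : Fin I) (s : Fin J) :
    ∃ c, E s c := by
  obtain ⟨y, hy⟩ := (hG.preconnected (Sum.inl s) (Sum.inr c₀)).exists_isPath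
  have hne : (Sum.inl s : Fin J ⊕ Fin I) ≠ Sum.inr c₀ := by simp
  cases y with
  | cons h p =>
    obtain ⟨s', c', h', ⟨h1, h2⟩ | ⟨h1, h2⟩⟩ := compatGraph_adj_iff.1 h
    · cases h1; exact ⟨c', h'⟩
    · cases h1

lemma exists_compat_server (hG : (compatGraph E).Connected) (s₀ : Fin J) (c : Fin I) :
    ∃ s, E s c := by
  obtain ⟨y, hy⟩ := (hG.preconnected (Sum.inr c) (Sum.inl s₀)).exists_isPath
  have hne : (Sum.inr c : Fin J ⊕ Fin I) ≠ Sum.inl s₀ := by simp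
  cases y with
  | cons h p =>
    obtain ⟨s', c', h', ⟨h1, h2⟩ | ⟨h1, h2⟩⟩ := compatGraph_adj_iff.1 h
    · cases h1
    · cases h1; exact ⟨s', h'⟩

/-- Removing an edge of an acyclic compatibility graph separates its end points. -/
lemma exists_cut (hG : (compatGraph E).IsAcyclic) {s₀ : Fin J} {c₀ : Fin I} (h₀ : E s₀ c₀) :
    ∃ (KS : Set (Fin J)) (KC : Set (Fin I)), s₀ ∈ KS ∧ c₀ ∉ KC ∧
      ∀ s c, E s c → ¬ (s = s₀ ∧ c = c₀) → (s ∈ KS ↔ c ∈ KC) := by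
  have hb := SimpleGraph.isAcyclic_iff_forall_adj_isBridge.1 hG (compatGraph_adj.2 h₀)
  rw [SimpleGraph.isBridge_iff] at hb
  set H := compatGraph E \ SimpleGraph.fromEdgeSet {s(Sum.inl s₀, Sum.inr c₀)} with hH
  refine ⟨{s | H.Reachable (Sum.inl s₀) (Sum.inl s)}, {c | H.Reachable (Sum.inl s₀) (Sum.inr c)},
    SimpleGraph.Reachable.refl _, by first | exact hb.2 | exact hb, ?_⟩
  intro s c hsc hne
  have hadj : H.Adj (Sum.inl s) (Sum.inr c) := by
    rw [hH, SimpleGraph.sdiff_adj]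
    refine ⟨compatGraph_adj.2 hsc, ?_⟩
    rw [SimpleGraph.fromEdgeSet_adj]
    simpa using hne
  exact ⟨fun h => h.trans hadj.reachable, fun h => h.trans hadj.symm.reachable⟩

/-- On an acyclic graph an edge function is determined by its sums over the vertices. -/
lemma edgeFlow_eq_zero (hG : (compatGraph E).IsAcyclic) {x : Fin J → Fin I → ℝ}
    (supp : ∀ s c, ¬ E s c → x s c = 0) (row : ∀ s, ∑ c, x s c = 0)
    (col : ∀ c, ∑ s, x s c = 0) : x = 0 := by
  classical
  funext s₀ c₀
  by_cases h₀ : E s₀ c₀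
  swap
  · exact supp _ _ h₀
  obtain ⟨KS, KC, hs, hc, hK⟩ := exists_cut hG h₀
  -- The difference of the two indicators vanishes on every edge except the cut edge, where it is
  -- one, so the double sum isolates `x s₀ c₀`. Summation along rows and columns gives zero instead.
  have key : ∑ s, ∑ c, ((if s ∈ KS then (1 : ℝ) else 0) - if c ∈ KC then 1 else 0) * x s c
      = x s₀ c₀ := by
    rw [Finset.sum_eq_single s₀, Finset.sum_eq_single c₀]
    · simp [hs, hc]
    · intro c _ hcne
      by_cases h : E s₀ c
      · have := hK s₀ c h (fun h => hcne h.2)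
        simp [hs, this.1 hs]
      · simp [supp _ _ h]
    · simp
    · intro s _ hsne
      refine Finset.sum_eq_zero fun c _ => ?_
      by_cases h : E s c
      · have := hK s c h (fun h => hsne h.1)
        by_cases h1 : s ∈ KS
        · simp [h1, this.1 h1]
        · have h2 : c ∉ KC := fun h2 => h1 (this.2 h2)
          simp [h1, h2]
      · simp [supp _ _ h]
    · simp
  have h2 : ∑ s, ∑ c, ((if s ∈ KS then (1 : ℝ) else 0) - if c ∈ KC then 1 else 0) * x s c = 0 := by
    simp only [sub_mul, Finset.sum_sub_distrib]
    rw [Finset.sum_comm (f := fun s c => (if c ∈ KC then (1 : ℝ) else 0) * x s c)]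
    simp only [← Finset.mul_sum, row, col]
    simp
  rw [← key, h2]; rfl

/-- On a connected block, every balanced demand is realised by an edge function. -/
lemma exists_edgeFlow {SB : Set (Fin J)} {CB : Set (Fin I)}
    (hconn : ((compatGraph E).induce (Sum.inl '' SB ∪ Sum.inr '' CB)).Connected)
    (d : Fin J → ℝ) (e : Fin I → ℝ) (hd : ∀ s, s ∉ SB → d s = 0) (he : ∀ c, c ∉ CB → e c = 0)
    (hsum : ∑ s, d s = ∑ c, e c) :
    ∃ x : Fin J → Fin I → ℝ, (∀ s c, ¬ (E s c ∧ s ∈ SB ∧ c ∈ CB) → x s c = 0) ∧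
      (∀ s, ∑ c, x s c = d s) ∧ ∀ c, ∑ s, x s c = e c := by
  classical
  set B : Set (Fin J ⊕ Fin I) := Sum.inl '' SB ∪ Sum.inr '' CB with hB
  -- `D` is the space of realisable demands, with the sign of the type coordinates reversed. A
  -- single edge realises the difference of the unit vectors of its ends; along paths, differences
  -- of the unit vectors of any two nodes of the block then lie in `D`.
  let D : Submodule ℝ ((Fin J → ℝ) × (Fin I → ℝ)) :=
    { carrier := {f | ∃ x : Fin J → Fin I → ℝ, (∀ s c, ¬ (E s c ∧ s ∈ SB ∧ c ∈ CB) → x s c = 0) ∧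
        (∀ s, ∑ c, x s c = f.1 s) ∧ ∀ c, ∑ s, x s c = - f.2 c}
      zero_mem' := ⟨0, by simp, by simp, by simp⟩
      add_mem' := by
        rintro f g ⟨x, hx1, hx2, hx3⟩ ⟨y, hy1, hy2, hy3⟩
        refine ⟨x + y, fun s c h => by simp [hx1 s c h, hy1 s c h], fun s => ?_, fun c => ?_⟩
        · simp [Finset.sum_add_distrib, hx2, hy2]
        · simp [Finset.sum_add_distrib, hx3, hy3]; ring
      smul_mem' := by
        rintro k f ⟨x, hx1, hx2, hx3⟩
        refine ⟨k • x, fun s c h => by simp [hx1 s c h], fun s => ?_, fun c => ?_⟩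
        · simp [← Finset.mul_sum, hx2]
        · simp [← Finset.mul_sum, hx3] }
  let δ : Fin J ⊕ Fin I → (Fin J → ℝ) × (Fin I → ℝ) :=
    Sum.elim (fun s => (Pi.single s 1, 0)) (fun c => (0, Pi.single c 1))
  have hedge : ∀ s c, E s c → s ∈ SB → c ∈ CB → δ (Sum.inl s) - δ (Sum.inr c) ∈ D := by
    intro s c h hs hc
    refine ⟨fun s' c' => if s' = s ∧ c' = c then 1 else 0, ?_, ?_, ?_⟩
    · intro s' c' h'
      refine if_neg ?_
      rintro ⟨rfl, rfl⟩
      exact h' ⟨h, hs, hc⟩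
    · intro s'
      by_cases h' : s' = s
      · subst h'; simp [δ]
      · simp [δ, h']
    · intro c'
      by_cases h' : c' = c
      · subst h'; simp [δ]
      · simp [δ, h']
  have hadj : ∀ u v : B, ((compatGraph E).induce B).Adj u v → δ u - δ v ∈ D := by
    rintro ⟨u, hu⟩ ⟨v, hv⟩ h
    rw [SimpleGraph.comap_adj] at h
    obtain ⟨s, c, h', ⟨h1, h2⟩ | ⟨h1, h2⟩⟩ := compatGraph_adj_iff.1 h
    · simp only [Function.Embedding.subtype_apply] at h1 h2
      subst h1 h2
      exact hedge s c h' (by simpa [hB] using hu) (by simpa [hB] using hv)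
    · simp only [Function.Embedding.subtype_apply] at h1 h2
      subst h1 h2
      have := D.neg_mem (hedge s c h' (by simpa [hB] using hv) (by simpa [hB] using hu))
      simpa using this
  obtain ⟨r⟩ := hconn.nonempty
  have hreach : ∀ u : B, δ u - δ r ∈ D := by
    intro u
    obtain ⟨p⟩ := hconn.preconnected u r
    induction p with
    | nil => simp
    | cons h p ih =>
      have := D.add_mem (hadj _ _ h) ih
      simpa using this
  let f : Fin J ⊕ Fin I → ℝ := Sum.elim d (fun c => - e c)
  have hf : ∀ u, f u • (δ u - δ r) ∈ D := by
    intro u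
    by_cases hu : u ∈ B
    · exact D.smul_mem _ (hreach ⟨u, hu⟩)
    · have : f u = 0 := by
        cases u with
        | inl s => exact hd s (by simpa [hB] using hu)
        | inr c => simpa [f] using he c (by simpa [hB] using hu)
      simp [this]
  have hmem : ∑ u, f u • (δ u - δ r) ∈ D := D.sum_mem fun u _ => hf u
  -- Balance of demand and supply means that the coefficients `f` sum to zero, so the reference node
  -- `r` drops out.
  have heq : ∑ u, f u • (δ u - δ r) = (d, fun c => - e c) := by
    have hf0 : ∑ u, f u = 0 := by
      simp [f, Fintype.sum_sum_type, hsum]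
    simp only [smul_sub, Finset.sum_sub_distrib, ← Finset.sum_smul, hf0, zero_smul, sub_zero]
    rw [Fintype.sum_sum_type]
    ext i
    · simp [δ, f, Prod.fst_sum, Finset.sum_apply, Pi.single_apply]
    · simp [δ, f, Prod.snd_sum, Finset.sum_apply, Pi.single_apply]
  rw [heq] at hmem
  obtain ⟨x, hx1, hx2, hx3⟩ := hmem
  exact ⟨x, hx1, hx2, fun c => by simpa using hx3 c⟩

/-- Weights that factor the service rates along the edges. -/
structure Weights {J I : ℕ} (E : Fin J → Fin I → Prop) (α : Fin I → ℝ) (rate : Fin J → Fin I → ℝ)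
    (a : Fin J → ℝ) (w : Fin I → ℝ) : Prop where
  α_pos : ∀ c, 0 < α c
  a_pos : ∀ s, 0 < a s
  w_pos : ∀ c, 0 < w c
  factor : ∀ s c, E s c → rate s c * w c = a s * α c

/-- The cut at an edge yields functions of the servers and of the types whose sum is the indicator
of that edge on the edge set. Hence every edge function, in particular the logarithm of the rates,
is a sum of a server term and a type term; exponentiation gives the weights. -/
lemma exists_weights (hG : (compatGraph E).IsAcyclic) {α : Fin I → ℝ} {rate : Fin J → Fin I → ℝ}
    (hα : ∀ c, 0 < α c) (hrate : ∀ s c, E s c → 0 < rate s c) :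
    ∃ a w, Weights E α rate a w := by
  classical
  have hcut : ∀ e : {e : Fin J × Fin I // E e.1 e.2}, ∃ (φ : Fin J → ℝ) (ψ : Fin I → ℝ),
      ∀ s c, E s c → φ s + ψ c = if (s, c) = e.1 then 1 else 0 := by
    rintro ⟨⟨s₀, c₀⟩, h₀⟩
    obtain ⟨KS, KC, hs, hc, hK⟩ := exists_cut hG h₀
    refine ⟨fun s => if s ∈ KS then 1 else 0, fun c => if c ∈ KC then -1 else 0, ?_⟩
    intro s c h
    by_cases he : s = s₀ ∧ c = c₀
    · obtain ⟨rfl, rfl⟩ := he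
      simp [hs, hc]
    · have := hK s c h he
      have he' : ¬ (s, c) = (s₀, c₀) := by simpa using he
      rw [if_neg he']
      by_cases h1 : s ∈ KS
      · simp [h1, this.1 h1]
      · have h2 : c ∉ KC := fun h2 => h1 (this.2 h2)
        simp [h1, h2]
  choose φ ψ hφ using hcut
  let A : Fin J → ℝ := fun s => ∑ e, Real.log (rate e.1.1 e.1.2) * φ e s
  let B : Fin I → ℝ := fun c => ∑ e, Real.log (rate e.1.1 e.1.2) * ψ e c
  have hAB : ∀ s c, E s c → A s + B c = Real.log (rate s c) := by
    intro s c h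
    simp only [A, B, ← Finset.sum_add_distrib, ← mul_add]
    rw [Finset.sum_eq_single ⟨(s, c), h⟩]
    · rw [hφ _ s c h]; simp
    · intro e _ hne
      rw [hφ _ s c h, if_neg, mul_zero]
      intro h'
      exact hne (Subtype.ext h'.symm)
    · simp
  refine ⟨fun s => Real.exp (A s), fun c => α c / Real.exp (B c), hα,
    fun s => Real.exp_pos _, fun c => div_pos (hα c) (Real.exp_pos _), fun s c h => ?_⟩
  have : rate s c = Real.exp (A s) * Real.exp (B c) := by
    rw [← Real.exp_add, hAB s c h, Real.exp_log (hrate s c h)]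
  rw [this]
  field_simp

variable {α : Fin I → ℝ} {rate : Fin J → Fin I → ℝ} {a : Fin J → ℝ} {w : Fin I → ℝ}

lemma Weights.rate_div (hw : Weights E α rate a w) {s : Fin J} {c : Fin I} (h : E s c) :
    rate s c / α c = a s / w c := by
  rw [div_eq_div_iff (hw.α_pos c).ne' (hw.w_pos c).ne', hw.factor s c h]

/-- The block equations in weighted form. -/
lemma blockEquations_iff (hw : Weights E α rate a w) {L : ℕ} {b : Fin J → Fin L} {ℓ : Fin L}
    {η : Fin J → Fin I → ℝ} {y : ℝ} :
    BlockEquations E α rate b ℓ η y ↔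
      (∀ s c, ¬ (E s c ∧ b s = ℓ ∧ c ∈ blockTypes E b ℓ) → η s c = 0) ∧
      (∀ s, b s = ℓ → ∑ c, η s c = 1) ∧
      ∀ c ∈ blockTypes E b ℓ, ∑ s, a s * η s c = w c * y := by
  classical
  have h1 : (∀ s c, ¬ (E s c ∧ b s = ℓ ∧ c ∈ blockTypes E b ℓ) → η s c = 0) →
      ∀ s, b s = ℓ → ∑ c with E s c ∧ c ∈ blockTypes E b ℓ, η s c = ∑ c, η s c := by
    intro supp s hs
    rw [Finset.sum_filter_of_ne]
    intro c _ hne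
    by_contra hcon
    exact hne (supp s c fun h => hcon ⟨h.1, h.2.2⟩)
  have h2 : (∀ s c, ¬ (E s c ∧ b s = ℓ ∧ c ∈ blockTypes E b ℓ) → η s c = 0) →
      ∀ c ∈ blockTypes E b ℓ, w c * (1 / α c * ∑ s with E s c ∧ b s = ℓ, rate s c * η s c)
        = ∑ s, a s * η s c := by
    intro supp c hc
    rw [Finset.sum_filter_of_ne, Finset.mul_sum, Finset.mul_sum]
    · refine Finset.sum_congr rfl fun s _ => ?_
      by_cases h : E s c
      · have := hw.factor s c h
        have h0 := (hw.α_pos c).ne'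
        field_simp
        linear_combination η s c * this
      · rw [supp s c fun h' => h h'.1]; simp
    · intro s _ hne
      by_contra hcon
      exact hne (by rw [supp s c fun h => hcon ⟨h.1, h.2.1⟩, mul_zero])
  constructor
  · rintro ⟨supp, busy, speed⟩
    refine ⟨supp, fun s hs => ?_, fun c hc => ?_⟩
    · rw [← h1 supp s hs]; convert busy s hs
    · rw [← h2 supp c hc]
      have := speed c hc
      rw [this]
  · rintro ⟨supp, busy, speed⟩
    refine ⟨supp, fun s hs => ?_, fun c hc => ?_⟩
    · rw [← busy s hs, ← h1 supp s hs]
    · have := (h2 supp c hc).trans (speed c hc)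
      have := mul_left_cancel₀ (hw.w_pos c).ne' this
      rw [← this]

/-- Weighted by `a`, the difference of two solutions has zero row sums and column sums `w c * (y' -
y)` on the block. Comparing the two totals gives `y' = y`, after which `edgeFlow_eq_zero` applies.
-/
lemma blockEquations_unique (hG : (compatGraph E).IsAcyclic) (hw : Weights E α rate a w) {L : ℕ}
    {b : Fin J → Fin L} {ℓ : Fin L} (hne : (blockTypes E b ℓ).Nonempty)
    {η η' : Fin J → Fin I → ℝ} {y y' : ℝ}
    (h : BlockEquations E α rate b ℓ η y) (h' : BlockEquations E α rate b ℓ η' y') :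
    η' = η ∧ y' = y := by
  classical
  rw [blockEquations_iff hw] at h h'
  obtain ⟨supp, busy, speed⟩ := h
  obtain ⟨supp', busy', speed'⟩ := h'
  have row : ∀ s, ∑ c, a s * (η' s c - η s c) = 0 := by
    intro s
    by_cases hs : b s = ℓ
    · rw [← Finset.mul_sum, Finset.sum_sub_distrib, busy s hs, busy' s hs]; simp
    · refine Finset.sum_eq_zero fun c _ => ?_
      rw [supp s c fun h => hs h.2.1, supp' s c fun h => hs h.2.1]; simp
  have colB : ∀ c ∈ blockTypes E b ℓ, ∑ s, a s * (η' s c - η s c) = w c * (y' - y) := by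
    intro c hc
    simp only [mul_sub, Finset.sum_sub_distrib, speed c hc, speed' c hc]
  have colN : ∀ c, c ∉ blockTypes E b ℓ → ∑ s, a s * (η' s c - η s c) = 0 := by
    intro c hc
    refine Finset.sum_eq_zero fun s _ => ?_
    rw [supp s c fun h => hc h.2.2, supp' s c fun h => hc h.2.2]; simp
  have hy : y' - y = 0 := by
    have h1 : ∑ c, ∑ s, a s * (η' s c - η s c) = 0 := by
      rw [Finset.sum_comm]; exact Finset.sum_eq_zero fun s _ => row s
    have h2 : ∑ c, ∑ s, a s * (η' s c - η s c)
        = (∑ c with c ∈ blockTypes E b ℓ, w c) * (y' - y) := by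
      rw [Finset.sum_mul, Finset.sum_filter]
      refine Finset.sum_congr rfl fun c _ => ?_
      split_ifs with hc
      · exact colB c hc
      · exact colN c hc
    have h3 : 0 < ∑ c with c ∈ blockTypes E b ℓ, w c := by
      obtain ⟨c, hc⟩ := hne
      exact Finset.sum_pos (fun c _ => hw.w_pos c) ⟨c, by simpa using hc⟩
    rw [h1] at h2
    rcases mul_eq_zero.1 h2.symm with h4 | h4
    · exact absurd h4 h3.ne'
    · exact h4
  have hz : (fun s c => a s * (η' s c - η s c)) = 0 := by
    refine edgeFlow_eq_zero hG (fun s c h => ?_) row fun c => ?_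
    · rw [supp s c fun h' => h h'.1, supp' s c fun h' => h h'.1]; simp
    · by_cases hc : c ∈ blockTypes E b ℓ
      · rw [colB c hc, hy, mul_zero]
      · exact colN c hc
  refine ⟨?_, by linarith⟩
  funext s c
  have := congrFun (congrFun hz s) c
  simp only [Pi.zero_apply, mul_eq_zero, (hw.a_pos s).ne', false_or] at this
  linarith

/-- Equality of total supply and demand dictates `y` as the total weight of the servers over that of
the types; with this `y` the demands are balanced, and connectedness yields the flow. -/
lemma exists_blockEquations (hw : Weights E α rate a w) {L : ℕ}
    {b : Fin J → Fin L} {ℓ : Fin L} (hne : (blockTypes E b ℓ).Nonempty)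
    (hconn : ((compatGraph E).induce (blockNodes E b ℓ)).Connected) :
    ∃ η y, BlockEquations E α rate b ℓ η y := by
  classical
  have h3 : 0 < ∑ c with c ∈ blockTypes E b ℓ, w c := by
    obtain ⟨c, hc⟩ := hne
    exact Finset.sum_pos (fun c _ => hw.w_pos c) ⟨c, by simpa using hc⟩
  set y := (∑ s with b s = ℓ, a s) / ∑ c with c ∈ blockTypes E b ℓ, w c with hy
  obtain ⟨x, hx1, hx2, hx3⟩ := exists_edgeFlow hconn (fun s => if b s = ℓ then a s else 0)
    (fun c => if c ∈ blockTypes E b ℓ then w c * y else 0)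
    (fun s hs => if_neg hs) (fun c hc => if_neg hc) (by
      rw [← Finset.sum_filter, ← Finset.sum_filter, ← Finset.sum_mul, hy]
      field_simp)
  refine ⟨fun s c => x s c / a s, y, (blockEquations_iff hw).2 ⟨?_, ?_, ?_⟩⟩
  · intro s c h
    rw [hx1 s c h, zero_div]
  · intro s hs
    rw [← Finset.sum_div, hx2, if_pos hs, div_self (hw.a_pos s).ne']
  · intro c hc
    have := hx3 c
    rw [if_pos hc] at this
    rw [← this]
    refine Finset.sum_congr rfl fun s _ => ?_
    have := (hw.a_pos s).ne'
    field_simp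

/-- The pooling equations in weighted form. -/
lemma poolingEquations_iff (hw : Weights E α rate a w) {η : Fin J → Fin I → ℝ} {m : ℝ} :
    PoolingEquations E α rate η m ↔
      (∀ s c, ¬ E s c → η s c = 0) ∧ (∀ s, ∑ c, η s c = 1) ∧
      ∀ c, ∑ s, a s * η s c = w c * m := by
  classical
  have h1 : (∀ s c, ¬ E s c → η s c = 0) → ∀ s, ∑ c with E s c, η s c = ∑ c, η s c := by
    intro supp s
    rw [Finset.sum_filter_of_ne]
    intro c _ hne
    by_contra hcon
    exact hne (supp s c hcon)
  have h2 : (∀ s c, ¬ E s c → η s c = 0) →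
      ∀ c, w c * ∑ s with E s c, rate s c / α c * η s c = ∑ s, a s * η s c := by
    intro supp c
    rw [Finset.sum_filter_of_ne, Finset.mul_sum]
    · refine Finset.sum_congr rfl fun s _ => ?_
      by_cases h : E s c
      · rw [hw.rate_div h]
        have := (hw.w_pos c).ne'
        field_simp
      · rw [supp s c h]; simp
    · intro s _ hne
      by_contra hcon
      exact hne (by rw [supp s c hcon, mul_zero])
  constructor
  · rintro ⟨supp, server, customer⟩
    refine ⟨supp, fun s => ?_, fun c => ?_⟩
    · rw [← h1 supp s]; convert server s
    · rw [← h2 supp c, ← customer c]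
  · rintro ⟨supp, server, customer⟩
    refine ⟨supp, fun s => ?_, fun c => ?_⟩
    · rw [← server s, ← h1 supp s]
    · have := mul_left_cancel₀ (hw.w_pos c).ne' ((h2 supp c).trans (customer c))
      rw [← this]

lemma poolingEquations_iff_blockEquations (hw : Weights E α rate a w)
    (hS : ∀ c, ∃ s, E s c) {η : Fin J → Fin I → ℝ} {m : ℝ} :
    PoolingEquations E α rate η m ↔
      BlockEquations E α rate (fun _ : Fin J => (0 : Fin 1)) 0 η m := by
  have hT : ∀ c, c ∈ blockTypes E (fun _ : Fin J => (0 : Fin 1)) 0 := fun c => by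
    simpa [blockTypes] using hS c
  rw [poolingEquations_iff hw, blockEquations_iff hw]
  simp [hT]

lemma mem_blockTypes_trivial (hS : ∀ c, ∃ s, E s c) (c : Fin I) :
    c ∈ blockTypes E (fun _ : Fin J => (0 : Fin 1)) 0 := by
  simpa [blockTypes] using hS c

lemma blockNodes_trivial (hS : ∀ c, ∃ s, E s c) :
    blockNodes E (fun _ : Fin J => (0 : Fin 1)) 0 = Set.univ := by
  ext x
  cases x <;> simp [blockNodes, mem_blockTypes_trivial hS]

lemma existsUnique_poolingEquations [NeZero J] (hG : (compatGraph E).IsTree)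
    (hw : Weights E α rate a w) (c₀ : Fin I) :
    ∃! q : (Fin J → Fin I → ℝ) × ℝ, PoolingEquations E α rate q.1 q.2 := by
  have hS := exists_compat_server hG.1 (0 : Fin J)
  have hT := mem_blockTypes_trivial hS
  have hconn : ((compatGraph E).induce
      (blockNodes E (fun _ : Fin J => (0 : Fin 1)) 0)).Connected := by
    rw [blockNodes_trivial hS]
    exact (SimpleGraph.Iso.connected_iff (SimpleGraph.induceUnivIso (compatGraph E))).2 hG.1
  obtain ⟨η, y, h⟩ := exists_blockEquations hw ⟨c₀, hT c₀⟩ hconn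
  refine ⟨(η, y), (poolingEquations_iff_blockEquations hw hS).2 h, ?_⟩
  rintro ⟨η', y'⟩ h'
  have h' := (poolingEquations_iff_blockEquations hw hS).1 h'
  obtain ⟨h1, h2⟩ := blockEquations_unique hG.2 hw ⟨c₀, hT c₀⟩ h h'
  exact Prod.ext h1 h2

end Tree

/-! ### Allocations of the service capacity -/

/-- A continuous function whose right slopes are at most `C` grows at rate at most `C`. -/
lemma sub_le_of_right_growth {f : ℝ → ℝ} {p q C : ℝ} (hpq : p ≤ q)
    (hf : ContinuousOn f (Icc p q))
    (h : ∀ τ ∈ Ioo p q, ∀ ε > 0, ∀ᶠ σ in 𝓝[>] τ, f σ - f τ ≤ (C + ε) * (σ - τ)) :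
    f q - f p ≤ C * (q - p) := by
  rcases hpq.eq_or_lt with rfl | hpq
  · simp
  -- The growth hypothesis says nothing at `p` itself, so the mean value inequality is applied from
  -- an interior point `p'`, which then tends to `p`.
  have key : ∀ p' ∈ Ioo p q, f q - f p' ≤ C * (q - p') := by
    intro p' hp'
    have := image_le_of_liminf_slope_right_le_deriv_boundary (f := f) (a := p') (b := q)
      (B := fun x => f p' + C * (x - p')) (B' := fun _ => C)
      (hf.mono (Icc_subset_Icc_left hp'.1.le)) (by simp) (by fun_prop)
      (fun x _ => by
        have : HasDerivAt (fun x => f p' + C * (x - p')) C x := by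
          simpa using (((hasDerivAt_id x).sub_const p').const_mul C).const_add (f p')
        exact this.hasDerivWithinAt)
      (fun x hx r hr => by
        have hx' : x ∈ Ioo p q := ⟨hp'.1.trans_le hx.1, hx.2⟩
        have hε : 0 < (r - C) / 2 := by linarith
        refine Eventually.frequently ?_
        filter_upwards [h x hx' _ hε, self_mem_nhdsWithin] with z hz hzx
        have hzx' : 0 < z - x := sub_pos.2 hzx
        rw [slope_def_field, div_lt_iff₀ hzx']
        nlinarith)
      (right_mem_Icc.2 hp'.2.le)
    linarith
  have hlim : Tendsto (fun p' => f q - f p') (𝓝[>] p) (𝓝 (f q - f p)) := by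
    refine Tendsto.const_sub _ ?_
    have := (hf p (left_mem_Icc.2 hpq.le)).mono_left
      (nhdsWithin_mono p Ioc_subset_Icc_self)
    rwa [nhdsWithin_Ioc_eq_nhdsGT hpq] at this
  have hlim2 : Tendsto (fun p' => C * (q - p')) (𝓝[>] p) (𝓝 (C * (q - p))) :=
    ((continuous_const.mul (continuous_const.sub continuous_id)).tendsto p).mono_left
      nhdsWithin_le_nhds
  refine le_of_tendsto_of_tendsto hlim hlim2 ?_
  filter_upwards [Ioo_mem_nhdsGT hpq] with p' hp' using key p' hp'

section Flow

variable {J I : ℕ}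

/-- A division of `h` units of time of every server over the compatible types. -/
structure Feasible (E : Fin J → Fin I → Prop) (h : ℝ) (x : Fin J → Fin I → ℝ) : Prop where
  nonneg : ∀ s c, 0 ≤ x s c
  supp : ∀ s c, ¬ E s c → x s c = 0
  total : ∀ s, ∑ c, x s c ≤ h

/-- The division of time prescribed by first come first served, when the first waiting customer
of type `c` is at distance `r c` from the last arrival: servers work on the lowest compatible
level, and may idle only if there is no compatible level below zero. -/
structure IsAlloc (E : Fin J → Fin I → Prop) (r : Fin I → ℝ) (h : ℝ)
    (x : Fin J → Fin I → ℝ) : Prop extends Feasible E h x where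
  first : ∀ s c c', E s c' → r c' < r c → x s c = 0
  nonpos : ∀ s c, 0 < r c → x s c = 0
  busy : ∀ s c, E s c → r c < 0 → ∑ c, x s c = h

variable {E : Fin J → Fin I → Prop} {r r' : Fin I → ℝ} {h : ℝ} {x x' : Fin J → Fin I → ℝ}

lemma Feasible.le_one (hx : Feasible E h x) (s : Fin J) (c : Fin I) : x s c ≤ h :=
  (Finset.single_le_sum (f := fun c => x s c) (fun c _ => hx.nonneg s c)
    (Finset.mem_univ c)).trans (hx.total s)

/-- Any feasible division weighs `r` at least as much as a lower bound of `0` and `r`. -/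
lemma Feasible.le_sum (hx : Feasible E h x) {s : Fin J} {m : ℝ} (hm : m ≤ 0)
    (hmr : ∀ c, E s c → m ≤ r c) : m * h ≤ ∑ c, x s c * r c := by
  calc m * h ≤ m * ∑ c, x s c := mul_le_mul_of_nonpos_left (hx.total s) hm
    _ = ∑ c, x s c * m := by rw [Finset.mul_sum]; simp [mul_comm]
    _ ≤ ∑ c, x s c * r c := by
      refine Finset.sum_le_sum fun c _ => ?_
      by_cases hE : E s c
      · exact mul_le_mul_of_nonneg_left (hmr c hE) (hx.nonneg s c)
      · rw [hx.supp s c hE]; simp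

/-- A server that works spends its time on one common level `m`, its lowest compatible one; it uses
all of `h` unless `m = 0`, in which case the amount does not matter. A server that does no work gets
`m = 0`. -/
lemma IsAlloc.exists_level (hx : IsAlloc E r h x) (hh : 0 < h) (s : Fin J) :
    ∃ m, m ≤ 0 ∧ (∀ c, E s c → m ≤ r c) ∧ ∑ c, x s c * r c = m * h := by
  by_cases hz : ∀ c, x s c = 0
  · refine ⟨0, le_rfl, fun c hc => ?_, by simp [hz]⟩
    by_contra hneg
    have := hx.busy s c hc (not_le.1 hneg)
    simp [hz] at this
    exact hh.ne this
  · push Not at hz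
    obtain ⟨c₀, hc₀⟩ := hz
    have hmin : ∀ c, E s c → r c₀ ≤ r c := fun c hc => by
      by_contra hlt
      exact hc₀ (hx.first s c₀ c hc (not_le.1 hlt))
    have hE₀ : E s c₀ := by
      by_contra hE
      exact hc₀ (hx.supp s c₀ hE)
    have hle : r c₀ ≤ 0 := by
      by_contra hlt
      exact hc₀ (hx.nonpos s c₀ (not_le.1 hlt))
    refine ⟨r c₀, hle, hmin, ?_⟩
    have h1 : ∑ c, x s c * r c = ∑ c, x s c * r c₀ := by
      refine Finset.sum_congr rfl fun c _ => ?_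
      by_cases hxc : x s c = 0
      · simp [hxc]
      · have : r c ≤ r c₀ := by
          by_contra hlt
          exact hxc (hx.first s c c₀ hE₀ (not_le.1 hlt))
        have hE : E s c := by
          by_contra hE
          exact hxc (hx.supp s c hE)
        rw [le_antisymm this (hmin c hE)]
    rw [h1, ← Finset.sum_mul, mul_comm]
    rcases hle.eq_or_lt with h0 | h0
    · simp [h0]
    · rw [hx.busy s c₀ hE₀ h0]

/-- First come, first served is optimality in a linear programme, server by server. This is what
makes the velocity a supergradient of a concave function of the levels. -/
lemma IsAlloc.le_of_feasible (hx : IsAlloc E r h x) (hh : 0 < h) (hx' : Feasible E h x')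
    (s : Fin J) : ∑ c, x s c * r c ≤ ∑ c, x' s c * r c := by
  obtain ⟨m, hm, hmr, heq⟩ := hx.exists_level hh s
  rw [heq]
  exact hx'.le_sum hm hmr

/-- Complementary slackness: with `V` the value of row `s`, the non-negative quantities `x s c * (r
c - V / h)` and `(V / h) * (∑ c, x s c - h)` add up to zero, so each of them vanishes. This replaces
the case rules of an allocation by linear inequalities, which suit perturbations of `r`. -/
lemma Feasible.isAlloc (hx : Feasible E h x) (hh : 0 < h)
    (h0 : ∀ s, ∑ c, x s c * r c ≤ 0) (hr : ∀ s c, E s c → ∑ c, x s c * r c ≤ h * r c) :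
    IsAlloc E r h x := by
  have key : ∀ s, ∃ m, m ≤ 0 ∧ (∀ c, E s c → m ≤ r c) ∧ (∀ c, x s c ≠ 0 → r c = m) ∧
      (m = 0 ∨ ∑ c, x s c = h) := by
    intro s
    set V := ∑ c, x s c * r c with hV
    have hm0 : V / h ≤ 0 := div_nonpos_of_nonpos_of_nonneg (h0 s) hh.le
    have hmr : ∀ c, E s c → V / h ≤ r c := fun c hc => by
      rw [div_le_iff₀ hh, mul_comm]; exact hr s c hc
    have h1 : ∑ c, x s c * (r c - V / h) + (V / h) * (∑ c, x s c - h) = 0 := by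
      simp only [mul_sub, Finset.sum_sub_distrib, ← Finset.sum_mul]
      rw [← hV]; field_simp; ring
    have hterm : ∀ c, 0 ≤ x s c * (r c - V / h) := fun c => by
      by_cases hE : E s c
      · exact mul_nonneg (hx.nonneg s c) (sub_nonneg.2 (hmr c hE))
      · rw [hx.supp s c hE]; simp
    have hlast : 0 ≤ (V / h) * (∑ c, x s c - h) :=
      mul_nonneg_of_nonpos_of_nonpos hm0 (sub_nonpos.2 (hx.total s))
    have hsum := Finset.sum_nonneg fun c (_ : c ∈ Finset.univ) => hterm c
    refine ⟨V / h, hm0, hmr, fun c hc => ?_, ?_⟩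
    · have := (Finset.sum_eq_zero_iff_of_nonneg fun c _ => hterm c).1
        (by linarith) c (Finset.mem_univ c)
      rcases mul_eq_zero.1 this with h2 | h2
      · exact absurd h2 hc
      · linarith
    · have : (V / h) * (∑ c, x s c - h) = 0 := by linarith
      rcases mul_eq_zero.1 this with h2 | h2
      · exact Or.inl h2
      · right; linarith
  refine ⟨hx, fun s c c' hE hlt => ?_, fun s c hpos => ?_, fun s c hE hneg => ?_⟩
  · obtain ⟨m, hm, hmr, hxm, -⟩ := key s
    by_contra hne
    have := hmr c' hE
    rw [hxm c hne] at hlt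
    linarith
  · obtain ⟨m, hm, hmr, hxm, -⟩ := key s
    by_contra hne
    rw [hxm c hne] at hpos
    linarith
  · obtain ⟨m, hm, hmr, hxm, h2⟩ := key s
    rcases h2 with h2 | h2
    · have := hmr c hE; linarith
    · exact h2

/-- Monotonicity of the allocation. -/
lemma IsAlloc.mono {a : Fin J → ℝ} (ha : ∀ s, 0 < a s) (hh : 0 < h) (hx : IsAlloc E r h x)
    (hx' : IsAlloc E r' h x') :
    ∑ s, a s * ∑ c, (r c - r' c) * (x s c - x' s c) ≤ 0 := by
  refine Finset.sum_nonpos fun s _ => mul_nonpos_of_nonneg_of_nonpos (ha s).le ?_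
  have h1 := hx.le_of_feasible hh hx'.toFeasible s
  have h2 := hx'.le_of_feasible hh hx.toFeasible s
  have : ∑ c, (r c - r' c) * (x s c - x' s c) = (∑ c, x s c * r c - ∑ c, x' s c * r c)
      + (∑ c, x' s c * r' c - ∑ c, x s c * r' c) := by
    simp only [← Finset.sum_sub_distrib, ← Finset.sum_add_distrib]
    exact Finset.sum_congr rfl fun c _ => by ring
  rw [this]; linarith

lemma IsAlloc.smul (hx : IsAlloc E r h x) {k : ℝ} (hk : 0 ≤ k) :
    IsAlloc E r (k * h) (k • x) where
  nonneg s c := mul_nonneg hk (hx.nonneg s c)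
  supp s c hE := by simp [hx.supp s c hE]
  total s := by
    simp only [Pi.smul_apply, smul_eq_mul, ← Finset.mul_sum]
    exact mul_le_mul_of_nonneg_left (hx.total s) hk
  first s c c' hE hlt := by simp [hx.first s c c' hE hlt]
  nonpos s c hpos := by simp [hx.nonpos s c hpos]
  busy s c hE hneg := by
    simp only [Pi.smul_apply, smul_eq_mul, ← Finset.mul_sum]
    rw [hx.busy s c hE hneg]

lemma IsAlloc.convex : Convex ℝ {x | IsAlloc E r h x} := by
  intro x hx y hy p q hp hq hpq
  refine ⟨⟨fun s c => ?_, fun s c hE => ?_, fun s => ?_⟩, fun s c c' hE hlt => ?_,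
    fun s c hpos => ?_, fun s c hE hneg => ?_⟩
  · exact add_nonneg (mul_nonneg hp (hx.nonneg s c)) (mul_nonneg hq (hy.nonneg s c))
  · simp [hx.supp s c hE, hy.supp s c hE]
  · simp only [Pi.add_apply, Pi.smul_apply, smul_eq_mul, Finset.sum_add_distrib, ← Finset.mul_sum]
    have h1 := mul_le_mul_of_nonneg_left (hx.total s) hp
    have h2 := mul_le_mul_of_nonneg_left (hy.total s) hq
    have : p * h + q * h = h := by rw [← add_mul, hpq, one_mul]
    linarith
  · simp [hx.first s c c' hE hlt, hy.first s c c' hE hlt]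
  · simp [hx.nonpos s c hpos, hy.nonpos s c hpos]
  · simp only [Pi.add_apply, Pi.smul_apply, smul_eq_mul, Finset.sum_add_distrib, ← Finset.mul_sum]
    rw [hx.busy s c hE hneg, hy.busy s c hE hneg, ← add_mul, hpq, one_mul]

/-- Each server puts all its time on one lowest compatible type if that level is negative, and idles
otherwise. -/
lemma exists_isAlloc (E : Fin J → Fin I → Prop) (r : Fin I → ℝ) : ∃ x, IsAlloc E r 1 x := by
  classical
  have hrow : ∀ s, ∃ y : Fin I → ℝ, (∀ c, 0 ≤ y c) ∧ (∀ c, ¬ E s c → y c = 0) ∧ ∑ c, y c ≤ 1 ∧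
      ∑ c, y c * r c ≤ 0 ∧ ∀ c, E s c → ∑ c, y c * r c ≤ r c := by
    intro s
    by_cases hneg : ∃ c, E s c ∧ r c < 0
    · obtain ⟨c₁, hc₁, hr₁⟩ := hneg
      obtain ⟨c₀, hc₀, hmin⟩ := Set.exists_min_image {c | E s c} r (Set.toFinite _) ⟨c₁, hc₁⟩
      have hc₀ : E s c₀ := hc₀
      refine ⟨Pi.single c₀ 1, fun c => ?_, fun c hE => ?_, by simp, ?_, fun c hE => ?_⟩
      · by_cases hcc : c = c₀
        · subst hcc; simp
        · simp [hcc]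
      · have : c ≠ c₀ := by rintro rfl; exact hE hc₀
        simp [this]
      · have := hmin c₁ hc₁
        simp [Pi.single_apply]; linarith
      · simpa [Pi.single_apply] using hmin c hE
    · push Not at hneg
      exact ⟨0, by simp, by simp, by simp, by simp, by simpa using hneg⟩
  choose y h1 h2 h3 h4 h5 using hrow
  exact ⟨y, Feasible.isAlloc ⟨h1, h2, h3⟩ one_pos h4 (by simpa using h5)⟩

lemma isCompact_isAlloc (E : Fin J → Fin I → Prop) (r : Fin I → ℝ) :
    IsCompact {x | IsAlloc E r 1 x} := by
  refine IsCompact.of_isClosed_subset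
    (isCompact_univ_pi fun _ : Fin J => isCompact_univ_pi fun _ : Fin I =>
      isCompact_Icc (a := (0:ℝ)) (b := 1))
    ?_ fun x hx => ?_
  · have : {x | IsAlloc E r 1 x} = {x : Fin J → Fin I → ℝ | (∀ s c, 0 ≤ x s c) ∧
        (∀ s c, ¬ E s c → x s c = 0) ∧ (∀ s, ∑ c, x s c ≤ 1) ∧
        (∀ s c c', E s c' → r c' < r c → x s c = 0) ∧ (∀ s c, 0 < r c → x s c = 0) ∧
        (∀ s c, E s c → r c < 0 → ∑ c, x s c = 1)} := by
      ext x
      exact ⟨fun h => ⟨h.nonneg, h.supp, h.total, h.first, h.nonpos, h.busy⟩,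
        fun ⟨h1, h2, h3, h4, h5, h6⟩ => ⟨⟨h1, h2, h3⟩, h4, h5, h6⟩⟩
    rw [this]
    simp only [Set.ofPred_and, Set.ofPred_forall]
    refine IsClosed.inter ?_ (IsClosed.inter ?_ (IsClosed.inter ?_ (IsClosed.inter ?_
      (IsClosed.inter ?_ ?_))))
    · exact isClosed_iInter fun s => isClosed_iInter fun c =>
        isClosed_le (by fun_prop) (by fun_prop)
    · exact isClosed_iInter fun s => isClosed_iInter fun c => isClosed_iInter fun _ =>
        isClosed_eq (by fun_prop) (by fun_prop)
    · exact isClosed_iInter fun s => isClosed_le (by fun_prop) (by fun_prop)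
    · exact isClosed_iInter fun s => isClosed_iInter fun c => isClosed_iInter fun _ =>
        isClosed_iInter fun _ => isClosed_iInter fun _ => isClosed_eq (by fun_prop) (by fun_prop)
    · exact isClosed_iInter fun s => isClosed_iInter fun c => isClosed_iInter fun _ =>
        isClosed_eq (by fun_prop) (by fun_prop)
    · exact isClosed_iInter fun s => isClosed_iInter fun c => isClosed_iInter fun _ =>
        isClosed_iInter fun _ => isClosed_eq (by fun_prop) (by fun_prop)
  · simp only [Set.mem_pi, Set.mem_univ, true_implies]
    exact fun s c => ⟨hx.nonneg s c, hx.toFeasible.le_one s c⟩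

/-- Allocations at nearby levels are allocations at `r`. -/
lemma eventually_isAlloc_imp (E : Fin J → Fin I → Prop) (r : Fin I → ℝ) :
    ∀ᶠ r' in 𝓝 r, ∀ h x, IsAlloc E r' h x → IsAlloc E r h x := by
  have h1 : ∀ᶠ r' : Fin I → ℝ in 𝓝 r, ∀ c c', r c' < r c → r' c' < r' c := by
    rw [eventually_all]; intro c
    rw [eventually_all]; intro c'
    by_cases hlt : r c' < r c
    · have : ∀ᶠ r' : Fin I → ℝ in 𝓝 r, r' c' < r' c :=
        (isOpen_lt (continuous_apply c') (continuous_apply c)).mem_nhds hlt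
      exact this.mono fun r' hr' _ => hr'
    · exact Eventually.of_forall fun r' h => absurd h hlt
  have h2 : ∀ᶠ r' : Fin I → ℝ in 𝓝 r, ∀ c, 0 < r c → 0 < r' c := by
    rw [eventually_all]; intro c
    by_cases hlt : 0 < r c
    · have : ∀ᶠ r' : Fin I → ℝ in 𝓝 r, 0 < r' c :=
        (isOpen_lt continuous_const (continuous_apply c)).mem_nhds hlt
      exact this.mono fun r' hr' _ => hr'
    · exact Eventually.of_forall fun r' h => absurd h hlt
  have h3 : ∀ᶠ r' : Fin I → ℝ in 𝓝 r, ∀ c, r c < 0 → r' c < 0 := by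
    rw [eventually_all]; intro c
    by_cases hlt : r c < 0
    · have : ∀ᶠ r' : Fin I → ℝ in 𝓝 r, r' c < 0 :=
        (isOpen_lt (continuous_apply c) continuous_const).mem_nhds hlt
      exact this.mono fun r' hr' _ => hr'
    · exact Eventually.of_forall fun r' h => absurd h hlt
  filter_upwards [h1, h2, h3] with r' h1 h2 h3 h x hx
  exact ⟨hx.toFeasible, fun s c c' hE hlt => hx.first s c c' hE (h1 c c' hlt),
    fun s c hpos => hx.nonpos s c (h2 c hpos), fun s c hE hneg => hx.busy s c hE (h3 c hneg)⟩

/-- The velocity of the levels under an allocation (per unit of time). -/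
noncomputable def velocity (a : Fin J → ℝ) (w : Fin I → ℝ) (lam : ℝ)
    (x : Fin J → Fin I → ℝ) (c : Fin I) : ℝ :=
  (∑ s, a s * x s c) / w c - lam

/-- The weighted square norm. -/
def energy (w g : Fin I → ℝ) : ℝ := ∑ c, w c * g c ^ 2

variable {a : Fin J → ℝ} {w : Fin I → ℝ} {lam : ℝ}

/-- The weights cancel the denominators of the velocity, so its pairing with `y` in the inner
product of `energy` becomes a sum over servers, to which optimality of each row applies. -/
lemma sum_velocity_mul (hw : ∀ c, 0 < w c) (x : Fin J → Fin I → ℝ) (y : Fin I → ℝ) :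
    ∑ c, w c * (velocity a w lam x c * y c)
      = ∑ s, a s * ∑ c, x s c * y c - lam * ∑ c, w c * y c := by
  have : ∀ c, w c * (velocity a w lam x c * y c)
      = ∑ s, a s * (x s c * y c) - lam * (w c * y c) := by
    intro c
    have := (hw c).ne'
    have h2 : ∑ s, a s * (x s c * y c) = (∑ s, a s * x s c) * y c := by
      rw [Finset.sum_mul]; exact Finset.sum_congr rfl fun s _ => by ring
    rw [velocity, h2]
    field_simp
  simp only [this, Finset.sum_sub_distrib, Finset.mul_sum]
  rw [Finset.sum_comm]

lemma energy_nonneg (hw : ∀ c, 0 < w c) (g : Fin I → ℝ) : 0 ≤ energy w g :=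
  Finset.sum_nonneg fun c _ => mul_nonneg (hw c).le (sq_nonneg _)

lemma energy_eq_zero (hw : ∀ c, 0 < w c) {g : Fin I → ℝ} (hg : energy w g ≤ 0) : g = 0 := by
  have h0 : energy w g = 0 := le_antisymm hg (energy_nonneg hw g)
  funext c
  have := (Finset.sum_eq_zero_iff_of_nonneg
    (fun c _ => mul_nonneg (hw c).le (sq_nonneg (g c)))).1 h0 c (Finset.mem_univ c)
  simpa [(hw c).ne'] using this

lemma energy_add (g k : Fin I → ℝ) :
    energy w (g + k) = energy w g + 2 * ∑ c, w c * (g c * k c) + energy w k := by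
  simp only [energy, Finset.mul_sum, ← Finset.sum_add_distrib, Pi.add_apply]
  exact Finset.sum_congr rfl fun c _ => by ring

/-- An allocation of minimal energy in a set of allocations. -/
noncomputable def leastAlloc (a : Fin J → ℝ) (w : Fin I → ℝ) (lam : ℝ)
    (S : Set (Fin J → Fin I → ℝ)) : Fin J → Fin I → ℝ :=
  Classical.epsilon fun x => x ∈ S ∧
    ∀ y ∈ S, energy w (velocity a w lam x) ≤ energy w (velocity a w lam y)

/-- The allocation that the system uses at levels `r`, up to its null space. -/
noncomputable def restAlloc (E : Fin J → Fin I → Prop) (a : Fin J → ℝ) (w : Fin I → ℝ) (lam : ℝ)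
    (r : Fin I → ℝ) : Fin J → Fin I → ℝ :=
  leastAlloc a w lam {x | IsAlloc E r 1 x}

/-- The right velocity of the levels at `r`. -/
noncomputable def restVel (E : Fin J → Fin I → Prop) (a : Fin J → ℝ) (w : Fin I → ℝ) (lam : ℝ)
    (r : Fin I → ℝ) : Fin I → ℝ :=
  velocity a w lam (restAlloc E a w lam r)

lemma continuous_energy_velocity :
    Continuous fun x : Fin J → Fin I → ℝ => energy w (velocity a w lam x) := by
  unfold energy velocity
  fun_prop

lemma restAlloc_spec (E : Fin J → Fin I → Prop) (a : Fin J → ℝ) (w : Fin I → ℝ) (lam : ℝ)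
    (r : Fin I → ℝ) :
    IsAlloc E r 1 (restAlloc E a w lam r) ∧ ∀ y, IsAlloc E r 1 y →
      energy w (restVel E a w lam r) ≤ energy w (velocity a w lam y) := by
  have : ∃ x, x ∈ {x | IsAlloc E r 1 x} ∧ ∀ y ∈ {x | IsAlloc E r 1 x},
      energy w (velocity a w lam x) ≤ energy w (velocity a w lam y) := by
    obtain ⟨x, hx, hmin⟩ := (isCompact_isAlloc E r).exists_isMinOn (exists_isAlloc E r)
      (continuous_energy_velocity (a := a) (w := w) (lam := lam)).continuousOn
    exact ⟨x, hx, fun y hy => hmin hy⟩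
  exact Classical.epsilon_spec this

/-- The set of allocations at `r` depends only on the order of the levels and on their signs, and
`leastAlloc` selects an element from the set alone. Finitely many such patterns leave finitely many
velocities. -/
lemma finite_range_restVel (E : Fin J → Fin I → Prop) (a : Fin J → ℝ) (w : Fin I → ℝ) (lam : ℝ) :
    (Set.range (restVel E a w lam)).Finite := by
  let pat : (Fin I → ℝ) → (Fin I → Fin I → Prop) × (Fin I → Prop) × (Fin I → Prop) :=
    fun r => (fun c c' => r c' < r c, fun c => 0 < r c, fun c => r c < 0)
  let F : (Fin I → Fin I → Prop) × (Fin I → Prop) × (Fin I → Prop) → (Fin I → ℝ) :=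
    fun p => velocity a w lam (leastAlloc a w lam {x | Feasible E 1 x ∧
      (∀ s c c', E s c' → p.1 c c' → x s c = 0) ∧ (∀ s c, p.2.1 c → x s c = 0) ∧
      ∀ s c, E s c → p.2.2 c → ∑ c, x s c = 1})
  have : restVel E a w lam = F ∘ pat := by
    funext r
    simp only [restVel, restAlloc, F, pat, Function.comp]
    congr 2
    ext x
    exact ⟨fun h => ⟨h.toFeasible, h.first, h.nonpos, h.busy⟩,
      fun ⟨h1, h2, h3, h4⟩ => ⟨h1, h2, h3, h4⟩⟩
  rw [this]
  exact (Set.finite_range F).subset (Set.range_comp_subset_range _ _)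

/-- First-order condition at the point of least norm of a convex set: a step `θ` towards `y` must
not decrease the energy; dividing by `θ` and letting `θ` tend to zero removes the quadratic term. -/
lemma restVel_variational {y : Fin J → Fin I → ℝ} (hy : IsAlloc E r 1 y) :
    0 ≤ ∑ c, w c * (restVel E a w lam r c * (velocity a w lam y c - restVel E a w lam r c)) := by
  obtain ⟨hx, hmin⟩ := restAlloc_spec E a w lam r
  set g := restVel E a w lam r with hg
  set k := velocity a w lam y - g with hk
  have hsum : ∑ c, w c * (g c * (velocity a w lam y c - g c)) = ∑ c, w c * (g c * k c) := rfl
  rw [hsum]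
  have key : ∀ θ ∈ Ioc (0:ℝ) 1, 0 ≤ 2 * ∑ c, w c * (g c * k c) + θ * energy w k := by
    intro θ hθ
    have hmem := IsAlloc.convex hx hy (sub_nonneg.2 hθ.2) hθ.1.le (by ring)
    have h1 := hmin _ hmem
    have h2 : velocity a w lam ((1 - θ) • restAlloc E a w lam r + θ • y) = g + θ • k := by
      funext c
      simp only [hk, hg, restVel, velocity, Pi.add_apply, Pi.smul_apply, Pi.sub_apply, smul_eq_mul,
        mul_add, Finset.sum_add_distrib]
      have e1 : ∑ s, a s * ((1 - θ) * restAlloc E a w lam r s c)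
          = (1 - θ) * ∑ s, a s * restAlloc E a w lam r s c := by
        rw [Finset.mul_sum]; exact Finset.sum_congr rfl fun s _ => by ring
      have e2 : ∑ s, a s * (θ * y s c) = θ * ∑ s, a s * y s c := by
        rw [Finset.mul_sum]; exact Finset.sum_congr rfl fun s _ => by ring
      rw [e1, e2]; ring
    rw [h2, energy_add] at h1
    have h3 : energy w (θ • k) = θ ^ 2 * energy w k := by
      simp only [energy, Finset.mul_sum, Pi.smul_apply, smul_eq_mul]
      exact Finset.sum_congr rfl fun c _ => by ring
    have h4 : ∑ c, w c * (g c * (θ • k) c) = θ * ∑ c, w c * (g c * k c) := by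
      simp only [Finset.mul_sum, Pi.smul_apply, smul_eq_mul]
      exact Finset.sum_congr rfl fun c _ => by ring
    rw [h3, h4] at h1
    have : 0 ≤ θ * (2 * ∑ c, w c * (g c * k c) + θ * energy w k) := by nlinarith
    exact nonneg_of_mul_nonneg_right this hθ.1
  have hlim : Tendsto (fun θ : ℝ => 2 * ∑ c, w c * (g c * k c) + θ * energy w k) (𝓝[>] 0)
      (𝓝 (2 * ∑ c, w c * (g c * k c) + 0 * energy w k)) :=
    ((continuous_const.add (continuous_id.mul continuous_const)).tendsto 0).mono_left
      nhdsWithin_le_nhds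
  have := ge_of_tendsto hlim (by
    filter_upwards [Ioc_mem_nhdsGT (zero_lt_one' ℝ)] with θ hθ using key θ hθ)
  linarith

/-- The velocity of minimal energy is unique. -/
lemma eq_restVel (hw : ∀ c, 0 < w c) {y : Fin J → Fin I → ℝ} (hy : IsAlloc E r 1 y)
    (hle : energy w (velocity a w lam y) ≤ energy w (restVel E a w lam r)) :
    velocity a w lam y = restVel E a w lam r := by
  have h1 := restVel_variational (a := a) (w := w) (lam := lam) hy
  have h2 := energy_add (w := w) (restVel E a w lam r)
    (velocity a w lam y - restVel E a w lam r)
  rw [add_sub_cancel] at h2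
  simp only [Pi.sub_apply] at h2
  exact sub_eq_zero.1 (energy_eq_zero hw (by linarith))

/-- The minimal allocation persists along its own direction. -/
lemma exists_persist (ha : ∀ s, 0 < a s) (hw : ∀ c, 0 < w c) (r : Fin I → ℝ) :
    ∃ δ₀ > 0, ∀ δ ∈ Icc (0:ℝ) δ₀,
      IsAlloc E (r + δ • restVel E a w lam r) 1 (restAlloc E a w lam r) := by
  classical
  obtain ⟨hx, -⟩ := restAlloc_spec E a w lam r
  set x := restAlloc E a w lam r with hxdef
  set g := restVel E a w lam r with hg
  -- Exchanging row `s` for another row of equal value at `r` gives another allocation at `r`. The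
  -- variational inequality for this exchange says that row `s` of `x` is also optimal for the
  -- direction `g` among the tied rows.
  have hswap : ∀ s (y : Fin I → ℝ), (∀ c, 0 ≤ y c) → (∀ c, ¬ E s c → y c = 0) → ∑ c, y c ≤ 1 →
      ∑ c, y c * r c = ∑ c, x s c * r c → ∑ c, x s c * g c ≤ ∑ c, y c * g c := by
    intro s y hy0 hyE hy1 hyr
    have hup : ∀ (z : Fin I → ℝ) s', ∑ c, Function.update x s y s' c * z c
        = if s' = s then ∑ c, y c * z c else ∑ c, x s' c * z c := by
      intro z s'
      by_cases hs : s' = s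
      · subst hs; simp
      · simp [hs]
    have hup' : ∀ s', ∑ c, Function.update x s y s' c
        = if s' = s then ∑ c, y c else ∑ c, x s' c := by
      intro s'
      simpa using hup 1 s'
    have hupr : ∀ s', ∑ c, Function.update x s y s' c * r c = ∑ c, x s' c * r c := by
      intro s'
      rw [hup]
      split_ifs with hs
      · rw [hs, hyr]
      · rfl
    have hfeas : Feasible E 1 (Function.update x s y) := by
      refine ⟨fun s' c => ?_, fun s' c hE => ?_, fun s' => ?_⟩
      · by_cases hs : s' = s
        · subst hs; simpa using hy0 c
        · simpa [hs] using hx.nonneg s' c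
      · by_cases hs : s' = s
        · subst hs; simpa using hyE c hE
        · simpa [hs] using hx.supp s' c hE
      · rw [hup']
        split_ifs
        · exact hy1
        · exact hx.total s'
    have hz0 : Feasible E 1 (0 : Fin J → Fin I → ℝ) := ⟨by simp, by simp, by simp⟩
    have halloc : IsAlloc E r 1 (Function.update x s y) := by
      refine hfeas.isAlloc one_pos (fun s' => ?_) (fun s' c hE => ?_)
      · rw [hupr]
        obtain ⟨m, hm, -, h3⟩ := hx.exists_level one_pos s'
        rw [h3]; linarith
      · rw [hupr]
        obtain ⟨m, hm, h2, h3⟩ := hx.exists_level one_pos s'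
        rw [h3]; linarith [h2 c hE]
    have h1 := restVel_variational (a := a) (w := w) (lam := lam) halloc
    rw [← hg] at h1
    have h2 := sum_velocity_mul (a := a) (lam := lam) hw (Function.update x s y) g
    have h3 := sum_velocity_mul (a := a) (lam := lam) hw x g
    have hvx : velocity a w lam x = g := rfl
    rw [hvx] at h3
    have h4 : ∑ c, w c * (g c * (velocity a w lam (Function.update x s y) c - g c))
        = ∑ c, w c * (velocity a w lam (Function.update x s y) c * g c)
          - ∑ c, w c * (g c * g c) := by
      rw [← Finset.sum_sub_distrib]
      exact Finset.sum_congr rfl fun c _ => by ring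
    have h5 : ∑ s', a s' * ∑ c, Function.update x s y s' c * g c
        - ∑ s', a s' * ∑ c, x s' c * g c = a s * (∑ c, y c * g c - ∑ c, x s c * g c) := by
      rw [← Finset.sum_sub_distrib, Finset.sum_eq_single s]
      · rw [hup, if_pos rfl]; ring
      · intro s' _ hs
        rw [hup, if_neg hs]; ring
      · simp
    have h6 : 0 ≤ a s * (∑ c, y c * g c - ∑ c, x s c * g c) := by linarith
    have := nonneg_of_mul_nonneg_right h6 (ha s)
    linarith
  -- Row `s` is compared with idling here, and with each single compatible type below: a tie at `r`
  -- is settled by optimality for `g`, and a strict inequality at `r` survives for small `δ`.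
  have hzero : ∀ s, ∀ᶠ δ in 𝓝[≥] (0:ℝ), ∑ c, x s c * (r + δ • g) c ≤ 0 := by
    intro s
    have hle : ∑ c, x s c * r c ≤ 0 := by
      obtain ⟨m, hm, -, h3⟩ := hx.exists_level one_pos s
      rw [h3]; linarith
    rcases hle.eq_or_lt with h0 | h0
    · have := hswap s 0 (by simp) (by simp) (by simp) (by simp [h0])
      filter_upwards [self_mem_nhdsWithin] with δ hδ
      simp only [Pi.add_apply, Pi.smul_apply, smul_eq_mul, mul_add, Finset.sum_add_distrib, h0]
      have h2 : ∑ c, x s c * (δ * g c) = δ * ∑ c, x s c * g c := by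
        rw [Finset.mul_sum]; exact Finset.sum_congr rfl fun c _ => by ring
      rw [h2]
      simp only [Pi.zero_apply, zero_mul, Finset.sum_const_zero] at this
      have := mul_nonpos_of_nonneg_of_nonpos (a := δ) hδ this
      linarith
    · have hc : Continuous fun δ : ℝ => ∑ c, x s c * (r + δ • g) c := by
        simp only [Pi.add_apply, Pi.smul_apply, smul_eq_mul]; fun_prop
      have : ∀ᶠ δ in 𝓝 (0:ℝ), ∑ c, x s c * (r + δ • g) c < 0 :=
        (hc.tendsto 0).eventually_lt_const (by simpa using h0)
      exact (this.filter_mono nhdsWithin_le_nhds).mono fun _ h => h.le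
  have htype : ∀ s c, E s c → ∀ᶠ δ in 𝓝[≥] (0:ℝ),
      ∑ c, x s c * (r + δ • g) c ≤ (r + δ • g) c := by
    intro s c₀ hE
    have hle : ∑ c, x s c * r c ≤ r c₀ := by
      obtain ⟨m, hm, h2, h3⟩ := hx.exists_level one_pos s
      rw [h3]; linarith [h2 c₀ hE]
    rcases hle.eq_or_lt with h0 | h0
    · have := hswap s (Pi.single c₀ 1)
        (fun c => by by_cases h : c = c₀ <;> simp [h])
        (fun c hc => by
          have : c ≠ c₀ := by rintro rfl; exact hc hE
          simp [this]) (by simp) (by simp [Pi.single_apply, h0])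
      filter_upwards [self_mem_nhdsWithin] with δ hδ
      simp only [Pi.add_apply, Pi.smul_apply, smul_eq_mul, mul_add, Finset.sum_add_distrib, h0]
      have h2 : ∑ c, x s c * (δ * g c) = δ * ∑ c, x s c * g c := by
        rw [Finset.mul_sum]; exact Finset.sum_congr rfl fun c _ => by ring
      rw [h2]
      simp only [Pi.single_apply, ite_mul, one_mul, zero_mul, Finset.sum_ite_eq',
        Finset.mem_univ, if_true] at this
      have := mul_le_mul_of_nonneg_left this (show (0:ℝ) ≤ δ from hδ)
      linarith
    · have hc : Continuous fun δ : ℝ => ∑ c, x s c * (r + δ • g) c := by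
        simp only [Pi.add_apply, Pi.smul_apply, smul_eq_mul]; fun_prop
      have hc' : Continuous fun δ : ℝ => (r + δ • g) c₀ := by
        simp only [Pi.add_apply, Pi.smul_apply, smul_eq_mul]; fun_prop
      have : ∀ᶠ δ in 𝓝 (0:ℝ), ∑ c, x s c * (r + δ • g) c < (r + δ • g) c₀ :=
        (isOpen_lt hc hc').mem_nhds (by simpa using h0)
      exact (this.filter_mono nhdsWithin_le_nhds).mono fun _ h => h.le
  have hall : ∀ᶠ δ in 𝓝[≥] (0:ℝ), IsAlloc E (r + δ • g) 1 x := by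
    have h1 := eventually_all.2 hzero
    have h2 : ∀ᶠ δ in 𝓝[≥] (0:ℝ), ∀ s c, E s c → ∑ c, x s c * (r + δ • g) c ≤ (r + δ • g) c := by
      rw [eventually_all]; intro s
      rw [eventually_all]; intro c
      by_cases hE : E s c
      · exact (htype s c hE).mono fun δ h _ => h
      · exact Eventually.of_forall fun δ h => absurd h hE
    filter_upwards [h1, h2] with δ h1 h2
    exact hx.toFeasible.isAlloc one_pos h1 (by simpa using h2)
  obtain ⟨δ₀, hδ₀, hsub⟩ := (mem_nhdsGE_iff_exists_Icc_subset).1 hall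
  exact ⟨δ₀, hδ₀, fun δ hδ => hsub hδ⟩

end Flow

/-! ### The fluid dynamics of the fronts -/

section Flow

variable {J I : ℕ} {E : Fin J → Fin I → Prop} {a : Fin J → ℝ} {w : Fin I → ℝ} {lam : ℝ}

/-- `R` follows the fluid dynamics on `(t₁, t₂)`: over short times after `τ`, the levels move
according to an allocation prescribed at `τ`. -/
structure Flow (E : Fin J → Fin I → Prop) (a : Fin J → ℝ) (w : Fin I → ℝ) (lam : ℝ)
    (R : ℝ → Fin I → ℝ) (t₁ t₂ : ℝ) : Prop where
  cont : ContinuousOn R (Icc t₁ t₂)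
  rule : ∀ τ ∈ Ioo t₁ t₂, ∀ᶠ σ in 𝓝[>] τ, ∃ x, IsAlloc E (R τ) (σ - τ) x ∧
    ∀ c, R σ c - R τ c = (∑ s, a s * x s c) / w c - lam * (σ - τ)

lemma Flow.mono {R : ℝ → Fin I → ℝ} {t₁ t₂ t₁' t₂' : ℝ} (h : Flow E a w lam R t₁ t₂)
    (h₁ : t₁ ≤ t₁') (h₂ : t₂' ≤ t₂) : Flow E a w lam R t₁' t₂' :=
  ⟨h.cont.mono (Icc_subset_Icc h₁ h₂), fun τ hτ => h.rule τ ⟨h₁.trans_lt hτ.1, hτ.2.trans_le h₂⟩⟩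

/-- Solutions of the fluid dynamics do not move apart. -/
lemma Flow.contraction (ha : ∀ s, 0 < a s) (hw : ∀ c, 0 < w c) {R R' : ℝ → Fin I → ℝ}
    {t₁ t₂ : ℝ} (ht : t₁ ≤ t₂) (hR : Flow E a w lam R t₁ t₂) (hR' : Flow E a w lam R' t₁ t₂) :
    energy w (R t₂ - R' t₂) ≤ energy w (R t₁ - R' t₁) := by
  have hcont : ContinuousOn (fun t => energy w (R t - R' t)) (Icc t₁ t₂) := by
    have h1 : Continuous fun g : Fin I → ℝ => energy w g := by unfold energy; fun_prop
    exact h1.comp_continuousOn (hR.cont.sub hR'.cont)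
  have := sub_le_of_right_growth (f := fun t => energy w (R t - R' t)) (C := 0) ht hcont ?_
  · simp only [zero_mul] at this; linarith
  intro τ hτ ε hε
  -- `K` bounds the energy of the difference of two increments per squared unit of time. The
  -- distance energy changes by twice a cross term, nonpositive by monotonicity of allocations, plus
  -- at most `K * (σ - τ) ^ 2`, which is of second order.
  set K : ℝ := energy w (fun c => (∑ s, a s) / w c) with hK
  have hK0 : 0 ≤ K := energy_nonneg hw _
  have hclose : ∀ᶠ σ in 𝓝[>] τ, K * (σ - τ) ≤ ε := by
    have hc : Tendsto (fun σ : ℝ => K * (σ - τ)) (𝓝 τ) (𝓝 (K * (τ - τ))) := by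
      exact (continuous_const.mul (continuous_id.sub continuous_const)).tendsto τ
    have : ∀ᶠ σ in 𝓝 τ, K * (σ - τ) < ε := hc.eventually_lt_const (by simpa using hε)
    exact (this.filter_mono nhdsWithin_le_nhds).mono fun _ h => h.le
  filter_upwards [hR.rule τ hτ, hR'.rule τ hτ, hclose, self_mem_nhdsWithin] with
    σ ⟨x, hx, hxR⟩ ⟨x', hx', hxR'⟩ hKε hσ
  have hh : 0 < σ - τ := sub_pos.2 hσ
  set k : Fin I → ℝ := fun c => (∑ s, a s * (x s c - x' s c)) / w c with hk
  have heq : R σ - R' σ = (R τ - R' τ) + k := by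
    funext c
    have h1 := hxR c
    have h2 := hxR' c
    simp only [Pi.sub_apply, Pi.add_apply, hk, mul_sub, Finset.sum_sub_distrib, sub_div]
    linarith
  have hcross : ∑ c, w c * ((R τ - R' τ) c * k c) ≤ 0 := by
    have h1 := hx.mono ha hh hx'
    have h2 : ∑ c, w c * ((R τ - R' τ) c * k c)
        = ∑ s, a s * ∑ c, (R τ c - R' τ c) * (x s c - x' s c) := by
      simp only [Finset.mul_sum]
      rw [Finset.sum_comm]
      refine Finset.sum_congr rfl fun c _ => ?_
      have := (hw c).ne'
      simp only [hk, Pi.sub_apply]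
      have e1 : w c * ((R τ c - R' τ c) * ((∑ s, a s * (x s c - x' s c)) / w c))
          = (R τ c - R' τ c) * ∑ s, a s * (x s c - x' s c) := by field_simp
      rw [e1, Finset.mul_sum]
      exact Finset.sum_congr rfl fun s _ => by ring
    rw [h2]; exact h1
  have hquad : energy w k ≤ K * (σ - τ) ^ 2 := by
    rw [hK]
    simp only [energy, Finset.sum_mul]
    refine Finset.sum_le_sum fun c _ => ?_
    rw [mul_assoc]
    refine mul_le_mul_of_nonneg_left ?_ (hw c).le
    rw [← mul_pow, hk]
    refine sq_le_sq' ?_ ?_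
    · rw [neg_le, div_mul_eq_mul_div, ← neg_div]
      refine div_le_div_of_nonneg_right ?_ (hw c).le
      rw [← Finset.sum_neg_distrib, Finset.sum_mul]
      refine Finset.sum_le_sum fun s _ => ?_
      have h1 := hx.nonneg s c
      have h2 := hx'.toFeasible.le_one s c
      nlinarith [ha s]
    · rw [div_mul_eq_mul_div]
      refine div_le_div_of_nonneg_right ?_ (hw c).le
      rw [Finset.sum_mul]
      refine Finset.sum_le_sum fun s _ => ?_
      have h1 := hx'.nonneg s c
      have h2 := hx.toFeasible.le_one s c
      nlinarith [ha s]
  simp only [heq, energy_add]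
  nlinarith

lemma Flow.unique (ha : ∀ s, 0 < a s) (hw : ∀ c, 0 < w c) {R R' : ℝ → Fin I → ℝ}
    {t₁ t₂ : ℝ} (hR : Flow E a w lam R t₁ t₂) (hR' : Flow E a w lam R' t₁ t₂)
    (h₀ : R t₁ = R' t₁) : ∀ t ∈ Icc t₁ t₂, R t = R' t := by
  intro t ht
  have := Flow.contraction ha hw ht.1 (hR.mono le_rfl ht.2) (hR'.mono le_rfl ht.2)
  rw [h₀, sub_self] at this
  have h0 : energy w (0 : Fin I → ℝ) = 0 := by simp [energy]
  exact sub_eq_zero.1 (energy_eq_zero hw (by linarith))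

/-- The path that moves linearly with constant allocation `x` solves the fluid dynamics as long as
`x` is an allocation for its levels. -/
lemma flow_linear {r : Fin I → ℝ} {x : Fin J → Fin I → ℝ} {t₁ t₂ : ℝ}
    (hx : ∀ t ∈ Ioo t₁ t₂, IsAlloc E (r + (t - t₁) • velocity a w lam x) 1 x) :
    Flow E a w lam (fun t => r + (t - t₁) • velocity a w lam x) t₁ t₂ := by
  refine ⟨by fun_prop, fun τ hτ => ?_⟩
  filter_upwards [self_mem_nhdsWithin] with σ hσ
  have hh : 0 < σ - τ := sub_pos.2 hσ
  refine ⟨(σ - τ) • x, by simpa using (hx τ hτ).smul hh.le, fun c => ?_⟩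
  have : ∑ s, a s * ((σ - τ) • x) s c = (σ - τ) * ∑ s, a s * x s c := by
    rw [Finset.mul_sum]
    exact Finset.sum_congr rfl fun s _ => by simp; ring
  rw [this]
  simp only [velocity, Pi.add_apply, Pi.smul_apply, smul_eq_mul]
  ring

/-- To the right of every time, the levels move linearly with the rest velocity. -/
lemma Flow.right_linear (ha : ∀ s, 0 < a s) (hw : ∀ c, 0 < w c) {R : ℝ → Fin I → ℝ}
    {t₁ t₂ : ℝ} (ht : t₁ < t₂) (hR : Flow E a w lam R t₁ t₂) :
    ∃ δ > 0, t₁ + δ ≤ t₂ ∧ ∀ t ∈ Icc t₁ (t₁ + δ),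
      R t = R t₁ + (t - t₁) • restVel E a w lam (R t₁) ∧
      IsAlloc E (R t) 1 (restAlloc E a w lam (R t₁)) := by
  obtain ⟨δ₀, hδ₀, hp⟩ := exists_persist (E := E) (lam := lam) ha hw (R t₁)
  refine ⟨min δ₀ (t₂ - t₁), lt_min hδ₀ (sub_pos.2 ht), by
    linarith [min_le_right δ₀ (t₂ - t₁)], ?_⟩
  set δ := min δ₀ (t₂ - t₁)
  have hδ : δ ≤ δ₀ := min_le_left _ _
  have hδ2 : t₁ + δ ≤ t₂ := by linarith [min_le_right δ₀ (t₂ - t₁)]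
  have hlin : Flow E a w lam (fun t => R t₁ + (t - t₁) • restVel E a w lam (R t₁)) t₁ (t₁ + δ) :=
    flow_linear fun t ht => hp (t - t₁) ⟨by linarith [ht.1], by linarith [ht.2]⟩
  intro t ht
  have := (hR.mono le_rfl hδ2).unique ha hw hlin (by simp) t ht
  refine ⟨this, ?_⟩
  rw [this]
  exact hp (t - t₁) ⟨by linarith [ht.1], by linarith [ht.2]⟩

/-- If the levels move linearly on an interval, the velocity is attained at its right end point. -/
lemma Flow.velocity_at_end {R : ℝ → Fin I → ℝ} {t₁ t' t₂ : ℝ} {g : Fin I → ℝ}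
    (ht : t₁ < t') (ht' : t' ≤ t₂) (hR : Flow E a w lam R t₁ t₂)
    (hlin : ∀ t ∈ Icc t₁ t', R t = R t₁ + (t - t₁) • g) :
    ∃ x, IsAlloc E (R t') 1 x ∧ velocity a w lam x = g := by
  have hcont : Tendsto R (𝓝[<] t') (𝓝 (R t')) := by
    have := (hR.mono le_rfl ht').cont t' (right_mem_Icc.2 ht.le)
    have := this.mono_left (nhdsWithin_mono t' Ico_subset_Icc_self)
    rwa [nhdsWithin_Ico_eq_nhdsLT ht] at this
  -- The rule of the dynamics looks to the right of a time, so it is used at some `τ < t'`. For `τ`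
  -- close to `t'` an allocation at `R τ` is one at `R t'`, since strict inequalities between the
  -- levels at `t'` already hold at `τ`.
  obtain ⟨τ, hτ, hτ'⟩ := ((hcont.eventually (eventually_isAlloc_imp E (R t'))).and
    (Ioo_mem_nhdsLT ht)).exists
  have hrule := hR.rule τ ⟨hτ'.1, hτ'.2.trans_le ht'⟩
  obtain ⟨σ, ⟨x, hx, hxR⟩, hσ⟩ := (hrule.and (Ioo_mem_nhdsGT hτ'.2)).exists
  have hh : 0 < σ - τ := sub_pos.2 hσ.1
  refine ⟨(σ - τ)⁻¹ • x, hτ _ _ ?_, ?_⟩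
  · have := hx.smul (inv_nonneg.2 hh.le)
    rwa [inv_mul_cancel₀ hh.ne'] at this
  · funext c
    have h1 := hxR c
    rw [hlin σ ⟨hτ'.1.le.trans hσ.1.le, hσ.2.le⟩, hlin τ ⟨hτ'.1.le, hτ'.2.le⟩] at h1
    simp only [Pi.add_apply, Pi.smul_apply, smul_eq_mul] at h1
    have h2 : ∑ s, a s * ((σ - τ)⁻¹ • x) s c = (σ - τ)⁻¹ * ∑ s, a s * x s c := by
      rw [Finset.mul_sum]
      exact Finset.sum_congr rfl fun s _ => by simp; ring
    rw [velocity, h2]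
    have h3 : (∑ s, a s * x s c) / w c = (σ - τ) * (g c + lam) := by linarith
    rw [mul_div_assoc, h3]
    field_simp
    ring

/-- From every time on, either the levels move linearly for ever, or up to some later time, after
which they have a velocity of smaller energy. -/
lemma Flow.exists_segment (ha : ∀ s, 0 < a s) (hw : ∀ c, 0 < w c) {R : ℝ → Fin I → ℝ}
    {t₁ : ℝ} (hR : ∀ t₂, Flow E a w lam R t₁ t₂) :
    (∀ t ≥ t₁, R t = R t₁ + (t - t₁) • restVel E a w lam (R t₁)) ∨
    ∃ t' > t₁, (∀ t ∈ Icc t₁ t', R t = R t₁ + (t - t₁) • restVel E a w lam (R t₁)) ∧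
      energy w (restVel E a w lam (R t')) < energy w (restVel E a w lam (R t₁)) := by
  set g := restVel E a w lam (R t₁) with hg
  set S : Set ℝ := {t | t₁ ≤ t ∧ ∀ τ ∈ Icc t₁ t, R τ = R t₁ + (τ - t₁) • g} with hS
  obtain ⟨δ, hδ, -, hlin⟩ := (hR (t₁ + 1)).right_linear ha hw (by linarith)
  have hδS : t₁ + δ ∈ S := ⟨by linarith, fun τ hτ => (hlin τ hτ).1⟩
  by_cases hbdd : BddAbove S
  swap
  · left
    intro t ht
    rw [not_bddAbove_iff] at hbdd
    obtain ⟨t', ht', htt'⟩ := hbdd t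
    exact ht'.2 t ⟨ht, htt'.le⟩
  right
  set t' := sSup S with ht'
  have ht₁ : t₁ < t' := by linarith [le_csSup hbdd hδS]
  have hbefore : ∀ τ ∈ Ico t₁ t', R τ = R t₁ + (τ - t₁) • g := by
    intro τ hτ
    obtain ⟨t, htS, hτt⟩ := exists_lt_of_lt_csSup ⟨_, hδS⟩ hτ.2
    exact htS.2 τ ⟨hτ.1, hτt.le⟩
  have hat : R t' = R t₁ + (t' - t₁) • g := by
    have h1 : Tendsto R (𝓝[<] t') (𝓝 (R t')) := by
      have := (hR t').cont t' (right_mem_Icc.2 ht₁.le)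
      have := this.mono_left (nhdsWithin_mono t' Ico_subset_Icc_self)
      rwa [nhdsWithin_Ico_eq_nhdsLT ht₁] at this
    have h2 : Tendsto (fun t : ℝ => R t₁ + (t - t₁) • g) (𝓝[<] t')
        (𝓝 (R t₁ + (t' - t₁) • g)) := by
      have : Continuous fun t : ℝ => R t₁ + (t - t₁) • g := by fun_prop
      exact (this.tendsto t').mono_left nhdsWithin_le_nhds
    refine tendsto_nhds_unique_of_eventuallyEq h1 h2 ?_
    filter_upwards [Ioo_mem_nhdsLT ht₁] with τ hτ using hbefore τ ⟨hτ.1.le, hτ.2⟩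
  have hall : ∀ t ∈ Icc t₁ t', R t = R t₁ + (t - t₁) • g := by
    intro t ht
    rcases ht.2.eq_or_lt with h | h
    · rw [h, hat]
    · exact hbefore t ⟨ht.1, h⟩
  refine ⟨t', ht₁, hall, ?_⟩
  -- As `g` is the velocity of an allocation at `R t'`, the least energy there is at most that of
  -- `g`. If it were not smaller, `g` would also be the velocity after `t'`, and the segment would
  -- extend beyond the supremum of its length.
  obtain ⟨x, hx, hxg⟩ := (hR t').velocity_at_end ht₁ le_rfl hall
  by_contra hcon
  have heq : g = restVel E a w lam (R t') := by
    rw [← hxg]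
    exact eq_restVel hw hx (by rw [hxg]; exact not_lt.1 hcon)
  obtain ⟨δ', hδ', -, hlin'⟩ := ((hR (t' + 1)).mono ht₁.le le_rfl).right_linear ha hw (by linarith)
  have hmem : t' + δ' ∈ S := by
    refine ⟨by linarith, fun τ hτ => ?_⟩
    rcases le_total τ t' with h | h
    · exact hall τ ⟨hτ.1, h⟩
    · rw [(hlin' τ ⟨h, hτ.2⟩).1, ← heq, hat, add_assoc, ← add_smul]
      congr 2; ring
  linarith [le_csSup hbdd hmem]

/-- The levels follow finitely many affine functions. -/
lemma Flow.exists_finite_affine (ha : ∀ s, 0 < a s) (hw : ∀ c, 0 < w c) {R : ℝ → Fin I → ℝ}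
    {t₁ : ℝ} (hR : ∀ t₂, Flow E a w lam R t₁ t₂) :
    ∃ A : Set ((Fin I → ℝ) × (Fin I → ℝ)), A.Finite ∧
      ∀ t ≥ t₁, ∃ p ∈ A, R t = p.1 + t • p.2 := by
  have hfin := finite_range_restVel E a w lam
  -- The induction runs over the number of possible velocities of smaller energy than the present
  -- one, which drops at every breakpoint.
  obtain ⟨n, hn⟩ : ∃ n, ({g ∈ Set.range (restVel E a w lam) |
    energy w g < energy w (restVel E a w lam (R t₁))}).ncard = n := ⟨_, rfl⟩
  induction n using Nat.strong_induction_on generalizing t₁ with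
  | _ n ih =>
    set g := restVel E a w lam (R t₁) with hg
    have hrew : ∀ t : ℝ, R t₁ + (t - t₁) • g = (R t₁ - t₁ • g) + t • g := fun t => by
      rw [sub_smul]; abel
    rcases Flow.exists_segment ha hw hR with h | ⟨t', ht', hlin, hlt⟩
    · exact ⟨{(R t₁ - t₁ • g, g)}, Set.finite_singleton _, fun t ht =>
        ⟨_, rfl, by rw [h t ht, hrew]⟩⟩
    · obtain ⟨A, hA, hAt⟩ := ih _ (by
        rw [← hn]
        refine Set.ncard_lt_ncard ?_ (hfin.subset fun _ h => h.1)
        refine ⟨fun k hk => ⟨hk.1, hk.2.trans hlt⟩, fun hsub => ?_⟩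
        exact lt_irrefl _ (hsub ⟨⟨R t', rfl⟩, hlt⟩).2) (fun t₂ => (hR t₂).mono ht'.le le_rfl) rfl
      refine ⟨insert (R t₁ - t₁ • g, g) A, hA.insert _, fun t ht => ?_⟩
      rcases le_total t t' with h | h
      · exact ⟨_, Set.mem_insert _ _, by rw [hlin t ⟨ht, h⟩, hrew]⟩
      · obtain ⟨p, hp, hpt⟩ := hAt t h
        exact ⟨p, Set.mem_insert_of_mem _ hp, hpt⟩

/-- A continuous function that follows finitely many affine functions is piecewise linear. -/
lemma piecewiseLinear_of_finite_affine {f : ℝ → ℝ} (hf : ContinuousOn f (Ioi 0))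
    {A : Set (ℝ × ℝ)} (hA : A.Finite) (h : ∀ t > 0, ∃ p ∈ A, f t = p.1 + t * p.2) :
    PiecewiseLinear f := by
  classical
  -- The breakpoints are the abscissae at which two of the affine functions cross. Pairs of equal
  -- slope contribute the harmless point `0`, by division by zero.
  set B : Finset ℝ := (hA.toFinset ×ˢ hA.toFinset).image
    fun q => (q.2.1 - q.1.1) / (q.1.2 - q.2.2) with hB
  refine ⟨B, fun p q hp hpq hF => ?_⟩
  obtain ⟨m₀, hm₀⟩ := exists_between hpq
  obtain ⟨e, he, hfe⟩ := h m₀ (hp.trans hm₀.1)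
  have hcross : ∀ e' ∈ A, ∀ t ∈ Ioo p q, e'.1 + t * e'.2 = e.1 + t * e.2 → e' = e := by
    intro e' he' t ht heq
    by_cases hs : e'.2 = e.2
    · refine Prod.ext ?_ hs
      rw [hs] at heq; linarith
    · exfalso
      refine hF t ?_ ht
      rw [hB, Finset.mem_image]
      refine ⟨(e', e), by simp [he, he'], ?_⟩
      have : e'.2 - e.2 ≠ 0 := sub_ne_zero.2 hs
      rw [div_eq_iff this]
      linarith
  have hsub : Ioo p q ⊆ Ioi 0 := fun t ht => hp.trans ht.1
  have hconst : ∀ t ∈ Ioo p q, f t = e.1 + t * e.2 := by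
    set U : Set ℝ := {t ∈ Ioo p q | f t = e.1 + t * e.2} with hU
    set V : Set ℝ := {t ∈ Ioo p q | ∃ e' ∈ A \ {e}, f t = e'.1 + t * e'.2} with hV
    by_contra hcon
    push Not at hcon
    obtain ⟨t, ht, htne⟩ := hcon
    -- Between breakpoints, the points where `f` follows `e` and those where it follows another of
    -- the functions form two relatively closed sets that cover the interval and cannot meet;
    -- connectedness excludes the second.
    have hpre := isPreconnected_closed_iff.1 (isPreconnected_Ioo (a := p) (b := q))
    have hcl : ∀ e' : ℝ × ℝ, ∃ C : Set ℝ, IsClosed C ∧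
        C ∩ Ioo p q = {t ∈ Ioo p q | f t = e'.1 + t * e'.2} := by
      intro e'
      have hc : ContinuousOn (fun t => f t - (e'.1 + t * e'.2)) (Ioo p q) :=
        (hf.mono hsub).sub (by fun_prop)
      obtain ⟨C, hC, hCe⟩ := continuousOn_iff_isClosed.1 hc {0} isClosed_singleton
      refine ⟨C, hC, ?_⟩
      rw [← hCe]
      ext x
      simp only [Set.mem_inter_iff, Set.mem_preimage, Set.mem_singleton_iff, sub_eq_zero,
        Set.mem_ofPred_eq]
      tauto
    choose C hC hCe using hcl
    have hmemC : ∀ e' t, t ∈ Ioo p q → (t ∈ C e' ↔ f t = e'.1 + t * e'.2) := by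
      intro e' t ht
      have := Set.ext_iff.1 (hCe e') t
      simp only [Set.mem_inter_iff, ht, and_true, Set.mem_ofPred_eq, true_and] at this
      exact this
    have := hpre (C e) (⋃ e' ∈ A \ {e}, C e') (hC e)
      ((hA.subset Set.sdiff_subset).isClosed_biUnion fun e' _ => hC e') ?_ ?_ ?_
    · obtain ⟨t', ht', h1, h2⟩ := this
      rw [hmemC e t' ht'] at h1
      simp only [Set.mem_iUnion] at h2
      obtain ⟨e', he', h2⟩ := h2
      rw [hmemC e' t' ht'] at h2
      exact he'.2 (hcross e' he'.1 t' ht' (h2.symm.trans h1))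
    · intro t' ht'
      obtain ⟨e', he', h'⟩ := h t' (hsub ht')
      by_cases hee : e' = e
      · left; rw [hmemC e t' ht', ← hee]; exact h'
      · right
        simp only [Set.mem_iUnion]
        exact ⟨e', ⟨he', hee⟩, (hmemC e' t' ht').2 h'⟩
    · exact ⟨m₀, hm₀, (hmemC e m₀ hm₀).2 hfe⟩
    · obtain ⟨e', he', h'⟩ := h t (hsub ht)
      refine ⟨t, ht, ?_⟩
      simp only [Set.mem_iUnion]
      refine ⟨e', ⟨he', ?_⟩, (hmemC e' t ht).2 h'⟩
      rintro rfl
      exact htne h'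
  refine ⟨e.2, e.1, fun t ht => ?_⟩
  have hclo : Icc p q ⊆ closure (Ioo p q) := (closure_Ioo hpq.ne).ge
  have hsub' : Icc p q ⊆ Ioi 0 := fun t ht => hp.trans_le ht.1
  have := Set.EqOn.of_subset_closure (f := f) (g := fun t => e.1 + t * e.2) (s := Ioo p q)
    (t := Icc p q) hconst (hf.mono hsub') (by fun_prop) Ioo_subset_Icc_self hclo
  rw [this ht]; ring

end Flow

/-! ### Convergence to the pooled state -/

section Settle

variable {J I : ℕ} {E : Fin J → Fin I → Prop} {a : Fin J → ℝ} {w : Fin I → ℝ} {lam : ℝ}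

/-- The lowest level compatible with server `s`, or `0` if this is lower. -/
noncomputable def lowest (E : Fin J → Fin I → Prop) (s : Fin J) (r : Fin I → ℝ) : ℝ :=
  open Classical in
  (Finset.univ : Finset (Option (Fin I))).inf' ⟨none, Finset.mem_univ _⟩
    fun o => o.elim 0 fun c => if E s c then r c else 0

lemma lowest_nonpos (E : Fin J → Fin I → Prop) (s : Fin J) (r : Fin I → ℝ) :
    lowest E s r ≤ 0 :=
  Finset.inf'_le _ (Finset.mem_univ none)

lemma lowest_le {s : Fin J} {c : Fin I} (h : E s c) (r : Fin I → ℝ) : lowest E s r ≤ r c := by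
  classical
  have := Finset.inf'_le (s := (Finset.univ : Finset (Option (Fin I))))
    (fun o => o.elim 0 fun c => if E s c then r c else 0) (Finset.mem_univ (some c))
  simpa [lowest, h] using this

lemma le_lowest {s : Fin J} {r : Fin I → ℝ} {m : ℝ} (hm : m ≤ 0) (hmr : ∀ c, E s c → m ≤ r c) :
    m ≤ lowest E s r := by
  classical
  refine Finset.le_inf' _ _ fun o _ => ?_
  cases o with
  | none => exact hm
  | some c =>
    simp only [Option.elim_some]
    split_ifs with h
    · exact hmr c h
    · exact hm

lemma continuous_lowest (E : Fin J → Fin I → Prop) (s : Fin J) : Continuous (lowest E s) := by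
  classical
  unfold lowest
  refine Continuous.finset_inf'_apply _ fun o _ => ?_
  cases o with
  | none => exact continuous_const
  | some c =>
    simp only [Option.elim_some]
    split_ifs <;> fun_prop

/-- All allocations at `r` share the optimal value, which is therefore a function of `r`. While one
allocation persists, this function changes linearly along the flow, which allows the growth of the
potential to be computed. -/
lemma IsAlloc.sum_mul_eq_lowest {r : Fin I → ℝ} {x : Fin J → Fin I → ℝ} (hx : IsAlloc E r 1 x)
    (s : Fin J) : ∑ c, x s c * r c = lowest E s r := by
  obtain ⟨m, hm, hmr, heq⟩ := hx.exists_level one_pos s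
  refine le_antisymm ?_ ?_
  · rw [heq, mul_one]; exact le_lowest hm hmr
  · have := hx.toFeasible.le_sum (lowest_nonpos E s r) fun c h => lowest_le h r
    simpa using this

/-- The data of a solution of the pooling equations, in weighted form. -/
structure Pooled (E : Fin J → Fin I → Prop) (a : Fin J → ℝ) (w : Fin I → ℝ)
    (η : Fin J → Fin I → ℝ) (m : ℝ) : Prop where
  a_pos : ∀ s, 0 < a s
  w_pos : ∀ c, 0 < w c
  supp : ∀ s c, ¬ E s c → η s c = 0
  server : ∀ s, ∑ c, η s c = 1
  customer : ∀ c, ∑ s, a s * η s c = w c * m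

variable {η : Fin J → Fin I → ℝ} {m : ℝ}

lemma Pooled.sum_a (h : Pooled E a w η m) : ∑ s, a s = m * ∑ c, w c := by
  have h1 : ∑ s, ∑ c, a s * η s c = ∑ s, a s := by
    simp only [← Finset.mul_sum, h.server, mul_one]
  rw [← h1, Finset.sum_comm, Finset.mul_sum]
  exact Finset.sum_congr rfl fun c _ => by rw [h.customer]; ring

lemma Pooled.rate_pos [NeZero J] (h : Pooled E a w η m) : 0 < m := by
  have h1 : 0 < ∑ s, a s := Finset.sum_pos (fun s _ => h.a_pos s) ⟨0, Finset.mem_univ _⟩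
  rw [h.sum_a] at h1
  exact pos_of_mul_pos_left h1 (Finset.sum_nonneg fun c _ => (h.w_pos c).le)

lemma Pooled.sum_mul (h : Pooled E a w η m) (r : Fin I → ℝ) :
    ∑ s, a s * ∑ c, η s c * r c = m * ∑ c, w c * r c := by
  simp only [Finset.mul_sum]
  rw [Finset.sum_comm]
  refine Finset.sum_congr rfl fun c _ => ?_
  have : ∑ s, a s * (η s c * r c) = (∑ s, a s * η s c) * r c := by
    rw [Finset.sum_mul]; exact Finset.sum_congr rfl fun s _ => by ring
  rw [this, h.customer]; ring

/-- The terminal velocity of all the levels. -/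
noncomputable def terminalVel (I : ℕ) (m lam : ℝ) : Fin I → ℝ := fun _ => min (m - lam) 0

/-- The potential of the pooled dynamics. -/
noncomputable def potential (E : Fin J → Fin I → Prop) (a : Fin J → ℝ) (w : Fin I → ℝ)
    (m lam : ℝ) (r : Fin I → ℝ) : ℝ :=
  ∑ s, a s * lowest E s r - (lam + min (m - lam) 0) * ∑ c, w c * r c

/-- The linear term is distributed over the servers by means of `η`, using `Pooled.sum_mul`. The
potential then compares, for each server, its lowest level with a multiple of an `η`-average of its
levels. -/
lemma Pooled.potential_eq (h : Pooled E a w η m) (hm : 0 < m) (r : Fin I → ℝ) :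
    potential E a w m lam r
      = ∑ s, a s * (lowest E s r - ((lam + min (m - lam) 0) / m) * ∑ c, η s c * r c) := by
  simp only [mul_sub, Finset.sum_sub_distrib, potential]
  congr 1
  have : ∑ s, a s * ((lam + min (m - lam) 0) / m * ∑ c, η s c * r c)
      = (lam + min (m - lam) 0) / m * ∑ s, a s * ∑ c, η s c * r c := by
    rw [Finset.mul_sum]; exact Finset.sum_congr rfl fun s _ => by ring
  rw [this, h.sum_mul]
  field_simp

/-- The numerator is `min m lam`, the absolute speed of the fronts in the terminal regime: the
pooled rate under overload and the arrival rate otherwise. -/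
lemma terminal_ratio (hm : 0 < m) (hlam : 0 < lam) :
    0 < (lam + min (m - lam) 0) / m ∧ (lam + min (m - lam) 0) / m ≤ 1 := by
  constructor
  · refine div_pos ?_ hm
    rcases min_cases (m - lam) 0 with ⟨h1, -⟩ | ⟨h1, -⟩ <;> rw [h1] <;> linarith
  · rw [div_le_one hm]
    linarith [min_le_left (m - lam) 0]

/-- The two non-negative parts of the gap between `κ ∑ η r` and the lowest level. -/
lemma Pooled.gap_eq (h : Pooled E a w η m) (r : Fin I → ℝ) (s : Fin J) (κ : ℝ) :
    κ * ∑ c, η s c * r c - lowest E s r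
      = κ * ∑ c, η s c * (r c - lowest E s r) + (κ - 1) * lowest E s r := by
  simp only [mul_sub, Finset.sum_sub_distrib, ← Finset.sum_mul, h.server]
  ring

lemma Pooled.sum_gap_nonneg (h : Pooled E a w η m) (hη : ∀ s c, E s c → 0 ≤ η s c)
    (r : Fin I → ℝ) (s : Fin J) (c : Fin I) : 0 ≤ η s c * (r c - lowest E s r) := by
  by_cases hE : E s c
  · exact mul_nonneg (hη s c hE) (sub_nonneg.2 (lowest_le hE r))
  · rw [h.supp s c hE]; simp

/-- Every server contributes minus its gap, and by `Pooled.gap_eq` the gap has two non-negative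
parts: averages exceed the lowest level, and a ratio at most one multiplies a level at most zero. -/
lemma Pooled.potential_nonpos (h : Pooled E a w η m) (hm : 0 < m) (hlam : 0 < lam)
    (hη : ∀ s c, E s c → 0 ≤ η s c) (r : Fin I → ℝ) : potential E a w m lam r ≤ 0 := by
  obtain ⟨hκ0, hκ1⟩ := terminal_ratio hm hlam
  rw [h.potential_eq hm]
  refine Finset.sum_nonpos fun s _ => mul_nonpos_of_nonneg_of_nonpos (h.a_pos s).le ?_
  have h1 := h.gap_eq r s ((lam + min (m - lam) 0) / m)
  have h2 := mul_nonneg hκ0.le (Finset.sum_nonneg fun c (_ : c ∈ Finset.univ) =>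
    h.sum_gap_nonneg hη r s c)
  have h3 := mul_nonneg_of_nonpos_of_nonpos (sub_nonpos.2 hκ1) (lowest_nonpos E s r)
  linarith

/-- The energy of a velocity splits at the terminal velocity. -/
lemma Pooled.terminal_inner (h : Pooled E a w η m) {x : Fin J → Fin I → ℝ}
    (hx : Feasible E 1 x) :
    0 ≤ min (m - lam) 0 * ∑ c, w c * (velocity a w lam x c - min (m - lam) 0) := by
  rcases le_total 0 (m - lam) with h0 | h0
  · rw [min_eq_right h0]; simp
  · rw [min_eq_left h0]
    refine mul_nonneg_of_nonpos_of_nonpos h0 ?_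
    have h1 := sum_velocity_mul (a := a) (lam := lam) h.w_pos x (fun _ => 1)
    simp only [mul_one] at h1
    simp only [mul_sub, Finset.sum_sub_distrib, h1, ← Finset.sum_mul]
    have h2 : ∑ s, a s * ∑ c, x s c ≤ ∑ s, a s :=
      Finset.sum_le_sum fun s _ => mul_le_of_le_one_right (h.a_pos s).le (hx.total s)
    rw [h.sum_a] at h2
    nlinarith

/-- `Pooled.terminal_inner` says that a feasible velocity does not form an acute angle, at the
terminal velocity, with the direction of the origin; Pythagoras then holds as an inequality. In
particular no feasible velocity has less energy than the terminal one. -/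
lemma Pooled.energy_split (h : Pooled E a w η m) {x : Fin J → Fin I → ℝ}
    (hx : Feasible E 1 x) :
    energy w (terminalVel I m lam) + energy w (velocity a w lam x - terminalVel I m lam)
      ≤ energy w (velocity a w lam x) := by
  have h1 := energy_add (w := w) (terminalVel I m lam)
    (velocity a w lam x - terminalVel I m lam)
  rw [add_sub_cancel] at h1
  have h2 := h.terminal_inner (lam := lam) hx
  have h3 : ∑ c, w c * (terminalVel I m lam c * (velocity a w lam x - terminalVel I m lam) c)
      = min (m - lam) 0 * ∑ c, w c * (velocity a w lam x c - min (m - lam) 0) := by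
    rw [Finset.mul_sum]
    exact Finset.sum_congr rfl fun c _ => by simp [terminalVel]; ring
  rw [h3] at h1
  linarith

/-- Once all the levels have the terminal velocity, they keep it. -/
lemma Flow.terminal_forever (h : Pooled E a w η m) {R : ℝ → Fin I → ℝ} {t₁ : ℝ}
    (hR : ∀ t₂, Flow E a w lam R t₁ t₂)
    (hg : restVel E a w lam (R t₁) = terminalVel I m lam) :
    ∀ t ≥ t₁, R t = R t₁ + (t - t₁) • terminalVel I m lam := by
  rcases Flow.exists_segment h.a_pos h.w_pos hR with h1 | ⟨t', -, -, hlt⟩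
  · rwa [hg] at h1
  -- A change of velocity would require a velocity of energy below that of the terminal one.
  · exfalso
    have h1 := h.energy_split (lam := lam) (restAlloc_spec E a w lam (R t')).1.toFeasible
    have h2 := energy_nonneg h.w_pos (velocity a w lam (restAlloc E a w lam (R t'))
      - terminalVel I m lam)
    rw [hg] at hlt
    change energy w (velocity a w lam (restAlloc E a w lam (R t'))) < _ at hlt
    linarith

/-- The potential grows along the flow at a rate at least the energy of the deviation from the
terminal velocity. -/
lemma Flow.potential_growth (h : Pooled E a w η m) {R : ℝ → Fin I → ℝ} {t₁ t₂ : ℝ}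
    (ht : t₁ < t₂) (hR : Flow E a w lam R t₁ t₂) :
    ∀ᶠ σ in 𝓝[>] t₁, (σ - t₁) * energy w (restVel E a w lam (R t₁) - terminalVel I m lam)
      ≤ potential E a w m lam (R σ) - potential E a w m lam (R t₁) := by
  obtain ⟨δ, hδ, -, hlin⟩ := hR.right_linear h.a_pos h.w_pos ht
  set x := restAlloc E a w lam (R t₁) with hx
  set g := restVel E a w lam (R t₁) with hg
  have hx1 : IsAlloc E (R t₁) 1 x := (hlin t₁ ⟨le_rfl, by linarith⟩).2
  filter_upwards [Ioc_mem_nhdsGT (show t₁ < t₁ + δ by linarith)] with σ hσ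
  obtain ⟨h1, h2⟩ := hlin σ ⟨hσ.1.le, hσ.2⟩
  have hh : 0 < σ - t₁ := sub_pos.2 hσ.1
  have hlow : ∀ s, lowest E s (R σ) - lowest E s (R t₁) = (σ - t₁) * ∑ c, x s c * g c := by
    intro s
    rw [← h2.sum_mul_eq_lowest s, ← hx1.sum_mul_eq_lowest s, ← Finset.sum_sub_distrib,
      Finset.mul_sum]
    refine Finset.sum_congr rfl fun c _ => ?_
    rw [h1]; simp only [Pi.add_apply, Pi.smul_apply, smul_eq_mul]; ring
  have hsw : ∑ c, w c * R σ c - ∑ c, w c * R t₁ c = (σ - t₁) * ∑ c, w c * g c := by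
    rw [← Finset.sum_sub_distrib, Finset.mul_sum]
    refine Finset.sum_congr rfl fun c _ => ?_
    rw [h1]; simp only [Pi.add_apply, Pi.smul_apply, smul_eq_mul]; ring
  have hpot : potential E a w m lam (R σ) - potential E a w m lam (R t₁)
      = (σ - t₁) * (∑ s, a s * ∑ c, x s c * g c
        - (lam + min (m - lam) 0) * ∑ c, w c * g c) := by
    have e1 : ∑ s, a s * lowest E s (R σ) - ∑ s, a s * lowest E s (R t₁)
        = (σ - t₁) * ∑ s, a s * ∑ c, x s c * g c := by
      rw [← Finset.sum_sub_distrib, Finset.mul_sum]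
      refine Finset.sum_congr rfl fun s _ => ?_
      rw [← mul_sub, hlow]; ring
    simp only [potential]
    linear_combination e1 - (lam + min (m - lam) 0) * hsw
  rw [hpot]
  refine mul_le_mul_of_nonneg_left ?_ hh.le
  have h3 := sum_velocity_mul (a := a) (lam := lam) h.w_pos x g
  have h4 := h.terminal_inner (lam := lam) hx1.toFeasible
  have hvx : velocity a w lam x = g := rfl
  rw [hvx] at h3 h4
  have h5 : energy w (g - terminalVel I m lam) = ∑ c, w c * (g c * g c)
      - min (m - lam) 0 * ∑ c, w c * g c
      - min (m - lam) 0 * ∑ c, w c * (g c - min (m - lam) 0) := by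
    simp only [energy, Finset.mul_sum, ← Finset.sum_sub_distrib, Pi.sub_apply, terminalVel]
    exact Finset.sum_congr rfl fun c _ => by ring
  rw [h5]
  linarith

/-- If the solution of the pooling equations is non-negative, all levels attain the terminal
velocity within a time that depends only on the initial distance. -/
lemma exists_settling_time (h : Pooled E a w η m) (hm : 0 < m) (hlam : 0 < lam)
    (hη : ∀ s c, E s c → 0 ≤ η s c) (d : ℝ) :
    ∃ t₀ > 0, ∀ R : ℝ → Fin I → ℝ, (∀ t₂, Flow E a w lam R 0 t₂) →
      (∀ c, R 0 c ≤ 0) → (∀ c, -d ≤ R 0 c) →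
      ∀ t ≥ t₀, R t = R t₀ + (t - t₀) • terminalVel I m lam := by
  set V := Set.range (restVel E a w lam) \ {terminalVel I m lam} with hV
  have hVfin : V.Finite := (finite_range_restVel E a w lam).subset Set.sdiff_subset
  obtain ⟨γ, hγ, hγV⟩ : ∃ γ > 0, ∀ g ∈ V, γ ≤ energy w (g - terminalVel I m lam) := by
    rcases V.eq_empty_or_nonempty with hE | hne
    · exact ⟨1, one_pos, by simp [hE]⟩
    · obtain ⟨g₀, hg₀, hmin⟩ := Set.exists_min_image V
        (fun g => energy w (g - terminalVel I m lam)) hVfin hne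
      refine ⟨_, ?_, hmin⟩
      by_contra hle
      have := energy_eq_zero h.w_pos (not_lt.1 hle)
      exact hg₀.2 (sub_eq_zero.1 this)
  set A := ∑ s, a s with hA
  have hA0 : 0 ≤ A := Finset.sum_nonneg fun s _ => (h.a_pos s).le
  -- The potential starts at `-(|d| * A)` or more, never exceeds zero, and grows at rate at least
  -- `γ` as long as the velocity is not terminal; this can last at most `|d| * A / γ`. The added one
  -- makes the contradiction strict.
  set t₀ := (|d| * A) / γ + 1 with ht₀
  have ht₀pos : 0 < t₀ := by positivity
  refine ⟨t₀, ht₀pos, fun R hR hR0 hRd => ?_⟩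
  obtain ⟨τ, hτ, hτg⟩ : ∃ τ ∈ Icc 0 t₀, restVel E a w lam (R τ) = terminalVel I m lam := by
    by_contra hcon
    push Not at hcon
    have hcont : ContinuousOn (fun t => - potential E a w m lam (R t)) (Icc 0 t₀) := by
      have hc : Continuous (potential E a w m lam) := by
        unfold potential
        have := continuous_lowest (J := J) (I := I) E
        refine Continuous.sub ?_ (by fun_prop)
        exact continuous_finsetSum _ fun s _ => continuous_const.mul (this s)
      exact (hc.comp_continuousOn (hR t₀).cont).neg
    have hgrow := sub_le_of_right_growth (C := -γ) ht₀pos.le hcont (fun τ hτ ε hε => by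
      have h1 := Flow.potential_growth h hτ.2 ((hR t₀).mono hτ.1.le le_rfl)
      filter_upwards [h1, self_mem_nhdsWithin] with σ h1 hσ
      have hh : 0 < σ - τ := sub_pos.2 hσ
      have h2 := hγV _ ⟨⟨R τ, rfl⟩, hcon τ ⟨hτ.1.le, hτ.2.le⟩⟩
      have h3 := mul_le_mul_of_nonneg_left h2 hh.le
      nlinarith)
    have hend := h.potential_nonpos hm hlam hη (R t₀)
    have hstart : - potential E a w m lam (R 0) ≤ |d| * A := by
      have h1 : ∀ s, -|d| ≤ lowest E s (R 0) := fun s =>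
        le_lowest (by simp) fun c _ => (neg_le_neg (le_abs_self d)).trans (hRd c)
      have h2 : -(|d| * A) ≤ ∑ s, a s * lowest E s (R 0) := by
        rw [hA, Finset.mul_sum, ← Finset.sum_neg_distrib]
        refine Finset.sum_le_sum fun s _ => ?_
        have := mul_le_mul_of_nonneg_left (h1 s) (h.a_pos s).le
        linarith
      have h3 : ∑ c, w c * R 0 c ≤ 0 :=
        Finset.sum_nonpos fun c _ => mul_nonpos_of_nonneg_of_nonpos (h.w_pos c).le (hR0 c)
      have h4 : 0 ≤ lam + min (m - lam) 0 := by
        have := (terminal_ratio hm hlam).1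
        rw [lt_div_iff₀ hm] at this
        linarith
      have := mul_nonpos_of_nonneg_of_nonpos h4 h3
      simp only [potential]
      linarith
    have h5 : γ * t₀ = |d| * A + γ := by rw [ht₀]; field_simp
    simp only [sub_zero] at hgrow
    linarith
  have h1 := Flow.terminal_forever h (fun t₂ => (hR t₂).mono hτ.1 le_rfl) hτg
  intro t ht
  rw [h1 t (hτ.2.trans ht), h1 t₀ hτ.2, add_assoc, ← add_smul]
  congr 2; ring

/-- If the solution of the pooling equations is positive and the levels move with the terminal
velocity, compatible levels coincide. -/
lemma Flow.pooled_of_terminal (h : Pooled E a w η m) (hm : 0 < m) (hlam : 0 < lam)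
    (hη : ∀ s c, E s c → 0 < η s c) {R : ℝ → Fin I → ℝ} {t₁ t t₂ : ℝ} (ht : t₁ < t) (ht' : t ≤ t₂)
    (hR : Flow E a w lam R t₁ t₂)
    (hlin : ∀ τ ∈ Icc t₁ t, R τ = R t₁ + (τ - t₁) • terminalVel I m lam) :
    ∀ s c, E s c → R t c = lowest E s (R t) := by
  obtain ⟨x, hx, hxg⟩ := hR.velocity_at_end ht ht' hlin
  obtain ⟨hκ0, hκ1⟩ := terminal_ratio hm hlam
  set r := R t
  set κ := (lam + min (m - lam) 0) / m with hκ
  -- Some allocation at `r` has the terminal velocity. Pairing this velocity with `r` itself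
  -- expresses the potential as zero, so all the non-negative gaps of the servers vanish.
  have h1 : potential E a w m lam r = 0 := by
    have h2 := sum_velocity_mul (a := a) (lam := lam) h.w_pos x r
    simp only [hxg, hx.sum_mul_eq_lowest, terminalVel] at h2
    have h3 : ∑ c, w c * (min (m - lam) 0 * r c) = min (m - lam) 0 * ∑ c, w c * r c := by
      rw [Finset.mul_sum]; exact Finset.sum_congr rfl fun c _ => by ring
    rw [h3] at h2
    simp only [potential]
    linarith
  rw [h.potential_eq hm, ← neg_eq_zero, ← Finset.sum_neg_distrib] at h1
  have hgap : ∀ s, 0 ≤ κ * ∑ c, η s c * (r c - lowest E s r) := fun s =>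
    mul_nonneg hκ0.le (Finset.sum_nonneg fun c (_ : c ∈ Finset.univ) =>
      h.sum_gap_nonneg (fun s c hE => (hη s c hE).le) r s c)
  have hlow : ∀ s, 0 ≤ (κ - 1) * lowest E s r := fun s =>
    mul_nonneg_of_nonpos_of_nonpos (sub_nonpos.2 hκ1) (lowest_nonpos E s r)
  have hterm : ∀ s, -(a s * (lowest E s r - κ * ∑ c, η s c * r c))
      = a s * (κ * ∑ c, η s c * (r c - lowest E s r) + (κ - 1) * lowest E s r) := by
    intro s
    rw [← h.gap_eq]; ring
  intro s c hE
  have h2 := (Finset.sum_eq_zero_iff_of_nonneg (fun s _ => by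
    rw [hterm]; exact mul_nonneg (h.a_pos s).le (add_nonneg (hgap s) (hlow s)))).1 h1 s
    (Finset.mem_univ s)
  rw [hterm] at h2
  have h3 := (mul_eq_zero.1 h2).resolve_left (h.a_pos s).ne'
  have h4 : ∑ c, η s c * (r c - lowest E s r) = 0 := by
    have h5 : κ * ∑ c, η s c * (r c - lowest E s r) = 0 := by linarith [hgap s, hlow s]
    exact (mul_eq_zero.1 h5).resolve_left hκ0.ne'
  have h5 := (Finset.sum_eq_zero_iff_of_nonneg (fun c _ =>
    h.sum_gap_nonneg (fun s c hE => (hη s c hE).le) r s c)).1 h4 c (Finset.mem_univ c)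
  have := (mul_eq_zero.1 h5).resolve_left (hη s c hE).ne'
  linarith

/-- A function on the types that is constant on the neighbourhoods of the servers of a connected
graph is constant. -/
lemma eq_of_connected (hG : (compatGraph E).Connected) {f : Fin J → ℝ} {k : Fin I → ℝ}
    (h : ∀ s c, E s c → k c = f s) : ∀ c c', k c = k c' := by
  let F : Fin J ⊕ Fin I → ℝ := Sum.elim f k
  have hF : ∀ x y, F x = F y := by
    intro x y
    obtain ⟨p⟩ := hG.preconnected x y
    induction p with
    | nil => rfl
    | cons hadj _ ih =>
      rw [← ih]
      obtain ⟨s, c, hE, ⟨rfl, rfl⟩ | ⟨rfl, rfl⟩⟩ := compatGraph_adj_iff.1 hadj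
      · exact (h s c hE).symm
      · exact h s c hE
  exact fun c c' => hF (Sum.inr c) (Sum.inr c')

/-- Groups of types with different levels that each move with the pooled speed solve the fluid
dynamics. -/
lemma flow_pooled (h : Pooled E a w η m) (hη : ∀ s c, 0 ≤ η s c) {r : Fin I → ℝ}
    (hr : ∀ c, r c ≤ 0) (hfirst : ∀ s c c', E s c' → r c' < r c → η s c = 0)
    (hm : m < lam) (t₂ : ℝ) :
    Flow E a w lam (fun t c => r c + t * (m - lam)) 0 t₂ := by
  have hvel : velocity a w lam η = fun _ => m - lam := by
    funext c
    rw [velocity, h.customer, mul_comm, mul_div_assoc, div_self (h.w_pos c).ne', mul_one]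
  have := flow_linear (E := E) (a := a) (w := w) (lam := lam) (r := r) (x := η) (t₁ := 0)
    (t₂ := t₂) (fun t ht => ?_)
  · rw [hvel] at this
    convert this using 1
    funext t c
    simp
  · rw [hvel]
    refine ⟨⟨hη, h.supp, fun s => (h.server s).le⟩, fun s c c' hE hlt => ?_,
      fun s c hpos => ?_, fun s c _ _ => h.server s⟩
    · refine hfirst s c c' hE ?_
      simpa using hlt
    · exfalso
      simp only [sub_zero, Pi.add_apply, Pi.smul_apply, smul_eq_mul] at hpos
      nlinarith [hr c, ht.1]

end Settle

/-! ### States along the events -/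

namespace State

variable {J I : ℕ} {E : Fin J → Fin I → Prop} {w : Sample J I}

/-- The position of a server, cut off at the last arrival. -/
def cutPos (x : State J I) (s : Fin J) : ℤ := min (x.pos s) x.arrived

/-- The largest position of the servers compatible with type `c`: all earlier customers of this
type have been taken, all later ones are waiting. -/
noncomputable def front (E : Fin J → Fin I → Prop) (x : State J I) (c : Fin I) : ℤ :=
  sSup (x.cutPos '' {s | E s c})

lemma isGreatest_front {c : Fin I} (hS : ∃ s, E s c) (x : State J I) :
    IsGreatest (x.cutPos '' {s | E s c}) (x.front E c) := by
  have hne : (x.cutPos '' {s | E s c}).Nonempty := Set.Nonempty.image _ hS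
  have hfin : (x.cutPos '' {s | E s c}).Finite := Set.toFinite _
  exact ⟨hne.csSup_mem hfin, fun y hy => le_csSup hfin.bddAbove hy⟩

lemma cutPos_le_front {s : Fin J} {c : Fin I} (h : E s c) (x : State J I) :
    x.cutPos s ≤ x.front E c :=
  (isGreatest_front ⟨s, h⟩ x).2 ⟨s, h, rfl⟩

lemma exists_cutPos_eq_front {c : Fin I} (hS : ∃ s, E s c) (x : State J I) :
    ∃ s, E s c ∧ x.cutPos s = x.front E c :=
  (isGreatest_front hS x).1

lemma front_le_arrived {c : Fin I} (hS : ∃ s, E s c) (x : State J I) :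
    x.front E c ≤ x.arrived := by
  obtain ⟨s, -, h⟩ := exists_cutPos_eq_front hS x
  rw [← h]; exact min_le_right _ _

lemma front_mono {c : Fin I} (hS : ∃ s, E s c) {x y : State J I}
    (h : ∀ s, x.cutPos s ≤ y.cutPos s) : x.front E c ≤ y.front E c := by
  obtain ⟨s, hs, h'⟩ := exists_cutPos_eq_front hS x
  rw [← h']; exact (h s).trans (cutPos_le_front hs y)

lemma cutPos_of_busy {x : State J I} {s : Fin J} (h : x.Busy s) : x.cutPos s = x.pos s :=
  min_eq_left h

lemma cutPos_of_idle {x : State J I} {s : Fin J} (h : ¬ x.Busy s) : x.cutPos s = x.arrived :=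
  min_eq_right (not_le.1 h).le

/-- An arrived customer beyond the front of its type is waiting. -/
lemma waiting_of_front_lt {x : State J I} {k : ℤ} (hk : k ≤ x.arrived)
    (hf : x.front E (w.ξ k) < k) : x.Waiting E w k := by
  refine ⟨hk, fun s hs => ?_⟩
  have h1 := (cutPos_le_front hs x).trans_lt hf
  by_contra h2
  have h3 : k ≤ x.cutPos s := le_min (not_lt.1 h2) hk
  omega

/-- The number of customers of type `c` among the customers `p + 1, …, q`. -/
noncomputable def count (w : Sample J I) (c : Fin I) (p q : ℤ) : ℕ :=
  ((Finset.Ioc p q).filter fun k => w.ξ k = c).card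

lemma count_add {c : Fin I} {p q r : ℤ} (h : p ≤ q) (h' : q ≤ r) :
    count w c p q + count w c q r = count w c p r := by
  unfold count
  rw [← Finset.card_union_of_disjoint, ← Finset.filter_union, Finset.Ioc_union_Ioc_eq_Ioc h h']
  refine Finset.disjoint_filter_filter ?_
  rw [Finset.disjoint_left]
  intro k hk hk'
  rw [Finset.mem_Ioc] at hk hk'
  omega

lemma count_eq_zero {c : Fin I} {p q : ℤ} (h : ∀ k, p < k → k ≤ q → w.ξ k ≠ c) :
    count w c p q = 0 := by
  unfold count
  rw [Finset.card_eq_zero, Finset.filter_eq_empty_iff]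
  intro k hk
  rw [Finset.mem_Ioc] at hk
  exact h k hk.1 hk.2

lemma count_eq_one {c : Fin I} {p q : ℤ} (hpq : p < q) (hq : w.ξ q = c)
    (h : ∀ k, p < k → k < q → w.ξ k ≠ c) : count w c p q = 1 := by
  unfold count
  rw [Finset.card_eq_one]
  refine ⟨q, ?_⟩
  ext k
  simp only [Finset.mem_filter, Finset.mem_Ioc, Finset.mem_singleton]
  constructor
  · rintro ⟨⟨h1, h2⟩, h3⟩
    by_contra hne
    exact h k h1 (lt_of_le_of_ne h2 hne) h3
  · rintro rfl
    exact ⟨⟨hpq, le_rfl⟩, hq⟩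

/-- An event at the instant at which it is due. -/
inductive Jump (E : Fin J → Fin I → Prop) (w : Sample J I) : State J I → State J I → Prop
  | arrivalServed (x : State J I) (s : Fin J) (h₀ : x.nextArrival = 0)
      (hidle : ¬ x.Busy s) (hcompat : E s (w.ξ (x.arrived + 1))) :
      Jump E w x (((x.shiftIdleBelow (x.pos s)).arrive w).start w s (x.arrived + 1))
  | arrivalWaits (x : State J I) (h₀ : x.nextArrival = 0)
      (hnone : ∀ s, E s (w.ξ (x.arrived + 1)) → x.Busy s) :
      Jump E w x (x.shiftIdle.arrive w)
  | completionNext (x : State J I) (s : Fin J) (ℓ : ℤ) (hbusy : x.Busy s) (h₀ : x.residual s = 0)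
      (hfirst : IsLeast {ℓ' | x.Waiting E w ℓ' ∧ E s (w.ξ ℓ')} ℓ) :
      Jump E w x ((x.complete w s).start w s ℓ)
  | completionIdle (x : State J I) (s : Fin J) (hbusy : x.Busy s) (h₀ : x.residual s = 0)
      (hnone : ∀ ℓ', x.Waiting E w ℓ' → ¬ E s (w.ξ ℓ')) :
      Jump E w x ((x.complete w s).becomeIdle s)

/-- Some time without events elapses, or one event takes place. -/
inductive Move (E : Fin J → Fin I → Prop) (w : Sample J I) : State J I → State J I → Prop
  | advance (x : State J I) (δ : ℝ) (hδ : 0 ≤ δ) (hw : x.CanWait δ) : Move E w x (x.advance w δ)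
  | jump (x y : State J I) (h : Jump E w x y) : Move E w x y

/-- A state that the system can reach from another one. -/
def Path (E : Fin J → Fin I → Prop) (w : Sample J I) : State J I → State J I → Prop :=
  Relation.ReflTransGen (Move E w)

/-- The monotone quantities. -/
structure Below (x y : State J I) : Prop where
  time : x.time ≤ y.time
  arrived : x.arrived ≤ y.arrived
  cutPos : ∀ s, x.cutPos s ≤ y.cutPos s
  work : ∀ s c, x.work s c ≤ y.work s c
  started : ∀ s c, x.started s c ≤ y.started s c
  done : ∀ s c, x.done s c ≤ y.done s c
  work_total : ∀ s, ∑ c, y.work s c - ∑ c, x.work s c ≤ y.time - x.time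

lemma Below.refl (x : State J I) : x.Below x :=
  ⟨le_rfl, le_rfl, fun _ => le_rfl, fun _ _ => le_rfl, fun _ _ => le_rfl, fun _ _ => le_rfl,
    fun _ => by simp⟩

lemma Below.trans {x y z : State J I} (h : x.Below y) (h' : y.Below z) : x.Below z :=
  ⟨h.time.trans h'.time, h.arrived.trans h'.arrived, fun s => (h.cutPos s).trans (h'.cutPos s),
    fun s c => (h.work s c).trans (h'.work s c), fun s c => (h.started s c).trans (h'.started s c),
    fun s c => (h.done s c).trans (h'.done s c),
    fun s => by linarith [h.work_total s, h'.work_total s]⟩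

lemma Below.work_le {x y : State J I} (h : x.Below y) (s : Fin J) (c : Fin I) :
    y.work s c - x.work s c ≤ y.time - x.time := by
  have h1 := h.work_total s
  rw [← Finset.sum_sub_distrib] at h1
  exact (Finset.single_le_sum (f := fun c => y.work s c - x.work s c)
    (fun c _ => sub_nonneg.2 (h.work s c)) (Finset.mem_univ c)).trans h1

lemma advance_work_total (x : State J I) (δ : ℝ) (s : Fin J) :
    ∑ c, (x.advance w δ).work s c - ∑ c, x.work s c
      = open Classical in if x.Busy s then δ else 0 := by
  classical
  rw [← Finset.sum_sub_distrib, Finset.sum_eq_single (w.ξ (x.pos s))]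
  · by_cases h : x.Busy s <;> simp [advance, h]
  · intro c _ hc
    have : ¬ (x.Busy s ∧ w.ξ (x.pos s) = c) := fun h => hc h.2.symm
    simp [advance, this]
  · simp

/-- An idle server that is assigned an arrival may step back in the list, from further out to the
place next to the last arrival. Positions are thus not monotone, but positions cut off at the last
arrival are. -/
lemma Jump.below {x y : State J I} (h : Jump E w x y) : x.Below y := by
  classical
  cases h with
  | arrivalServed s h₀ hidle hcompat =>
    refine ⟨le_rfl, by simp [start, arrive, shiftIdleBelow], fun s' => ?_, fun _ _ => le_rfl,
      fun s' c => ?_, fun _ _ => le_rfl, fun _ => by simp [start, arrive, shiftIdleBelow]⟩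
    · simp only [State.cutPos, start, arrive, shiftIdleBelow]
      by_cases hs : s' = s
      · subst hs; simp
      · simp only [ne_eq, hs, not_false_eq_true, Function.update_of_ne]
        split_ifs <;> omega
    · simp only [start, arrive, shiftIdleBelow]
      split_ifs <;> omega
  | arrivalWaits h₀ hnone =>
    refine ⟨le_rfl, by simp [arrive, shiftIdle], fun s' => ?_, fun _ _ => le_rfl,
      fun _ _ => le_rfl, fun _ _ => le_rfl, fun _ => by simp [arrive, shiftIdle]⟩
    simp only [State.cutPos, arrive, shiftIdle]
    split_ifs <;> omega
  | completionNext s ℓ hbusy h₀ hfirst =>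
    refine ⟨le_rfl, le_rfl, fun s' => ?_, fun _ _ => le_rfl, fun s' c => ?_, fun s' c => ?_,
      fun _ => by simp [start, complete]⟩
    · simp only [State.cutPos, start, complete]
      by_cases hs : s' = s
      · subst hs
        have := hfirst.1.1.2 s' hfirst.1.2
        simp only [Function.update_self]; omega
      · simp [hs]
    · simp only [start, complete]
      split_ifs <;> omega
    · simp only [start, complete]
      split_ifs <;> omega
  | completionIdle s hbusy h₀ hnone =>
    refine ⟨le_rfl, le_rfl, fun s' => ?_, fun _ _ => le_rfl, fun s' c => le_rfl, fun s' c => ?_,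
      fun _ => by simp [becomeIdle, shiftIdle, complete]⟩
    · simp only [State.cutPos, becomeIdle, shiftIdle, complete]
      by_cases hs : s' = s
      · subst hs; simp only [Function.update_self]; omega
      · simp only [ne_eq, hs, not_false_eq_true, Function.update_of_ne]
        split_ifs <;> omega
    · simp only [becomeIdle, shiftIdle, complete]
      split_ifs <;> omega

lemma Move.below {x y : State J I} (h : Move E w x y) : x.Below y := by
  classical
  cases h with
  | advance δ hδ hw =>
    refine ⟨by simpa [State.advance] using hδ, le_rfl, fun _ => le_rfl, fun s c => ?_,
      fun _ _ => le_rfl, fun _ _ => le_rfl, fun s => ?_⟩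
    · simp only [State.advance]
      split_ifs <;> linarith
    · rw [advance_work_total]
      simp only [State.advance]
      split_ifs <;> linarith
  | jump _ h => exact Jump.below h

lemma Path.below {x y : State J I} (h : Path E w x y) : x.Below y := by
  induction h with
  | refl => exact Below.refl _
  | tail _ h ih => exact ih.trans h.below

/-- The effect of an event: the servers in `st` start a service, those in `cp` complete one. -/
structure Effect (E : Fin J → Fin I → Prop) (w : Sample J I) (z y : State J I)
    (st cp : Fin J → Prop) : Prop where
  time : y.time = z.time
  work : y.work = z.work
  done : ∀ s c, y.done s c = z.done s c +
    (open Classical in if cp s ∧ w.ξ (z.pos s) = c then 1 else 0)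
  complete : ∀ s, cp s → z.Busy s ∧ z.residual s = 0
  start : ∀ s, st s → (cp s ∨ ¬ z.Busy s) ∧ y.Busy s ∧ E s (w.ξ (y.pos s)) ∧
    y.residual s = w.v s (w.ξ (y.pos s)) (z.started s (w.ξ (y.pos s))) ∧
    y.front E (w.ξ (y.pos s)) = y.pos s
  started : ∀ s c, y.started s c = z.started s c +
    (open Classical in if st s ∧ w.ξ (y.pos s) = c then 1 else 0)
  keep : ∀ s, ¬ st s → ¬ cp s → (y.Busy s ↔ z.Busy s) ∧ (z.Busy s → y.pos s = z.pos s) ∧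
    y.residual s = z.residual s
  idle : ∀ s, ¬ st s → cp s → ¬ y.Busy s ∧ y.residual s = z.residual s
  count : ∀ c, ∑ s, y.started s c = ∑ s, z.started s c + count w c (z.front E c) (y.front E c)

/-- The invariants of the positions, and those of the clocks, given the initial state `x₀`. -/
structure Sound (E : Fin J → Fin I → Prop) (w : Sample J I) (x₀ x : State J I) : Prop where
  nextArrival_nonneg : 0 ≤ x.nextArrival
  residual_nonneg : ∀ s, 0 ≤ x.residual s
  arrived_nonneg : 0 ≤ x.arrived
  compat : ∀ s, x.Busy s → E s (w.ξ (x.pos s))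
  idle_inj : ∀ s s', ¬ x.Busy s → ¬ x.Busy s' → x.pos s = x.pos s' → s = s'
  idle_bound : ∀ s, x.pos s ≤ x.arrived + ({s' | ¬ x.Busy s'} : Set (Fin J)).ncard
  arrivals : x.time + x.nextArrival
    = x₀.nextArrival + ∑ i ∈ Finset.range x.arrived.toNat, w.u (i + 2)
  arrivals_lower : ∑ i ∈ Finset.range (x.arrived.toNat - 1), w.u (i + 2) ≤ x.time

lemma sum_started_update {z : State J I} {y : State J I} (s : Fin J) (ℓ : ℤ)
    (h : ∀ s' c, y.started s' c =
      (open Classical in if s' = s ∧ c = w.ξ ℓ then z.started s' c + 1 else z.started s' c))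
    (c : Fin I) : ∑ s, y.started s c = ∑ s, z.started s c +
      (open Classical in if w.ξ ℓ = c then 1 else 0) := by
  classical
  have : ∀ s', y.started s' c =
      z.started s' c + if s' = s then (if w.ξ ℓ = c then 1 else 0) else 0 := by
    intro s'
    rw [h]
    by_cases h1 : s' = s <;> by_cases h2 : c = w.ξ ℓ
    · simp [h1, h2]
    · simp [h1, h2, Ne.symm h2]
    · simp [h1]
    · simp [h1]
  simp only [this, Finset.sum_add_distrib]
  simp

/-- A front can pass at most the new customer, and this customer is taken by `s`. The other idle
servers remain beyond the enlarged list because their positions differ from that of `s`: the lower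
ones move up by one, the higher ones already have room. -/
lemma effect_arrivalServed (hS : ∀ c, ∃ s, E s c) {x₀ z : State J I} (hz : Sound E w x₀ z)
    {s : Fin J} (hidle : ¬ z.Busy s) (hcompat : E s (w.ξ (z.arrived + 1))) :
    Effect E w z (((z.shiftIdleBelow (z.pos s)).arrive w).start w s (z.arrived + 1))
      (fun s' => s' = s) (fun _ => False) := by
  classical
  set y := (((z.shiftIdleBelow (z.pos s)).arrive w).start w s (z.arrived + 1)) with hy
  have hpos : y.pos s = z.arrived + 1 := by simp [hy, State.start, arrive, shiftIdleBelow]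
  have harr : y.arrived = z.arrived + 1 := rfl
  have hpos' : ∀ s', s' ≠ s → y.pos s' = if ¬ z.Busy s' ∧ z.pos s' < z.pos s then z.pos s' + 1
      else z.pos s' := by
    intro s' hs'
    simp [hy, State.start, arrive, shiftIdleBelow, hs']
  have hidle' : z.arrived < z.pos s := not_le.1 hidle
  have hbusy : ∀ s', s' ≠ s → (y.Busy s' ↔ z.Busy s') ∧ (z.Busy s' → y.pos s' = z.pos s') := by
    intro s' hs'
    have h1 := hpos' s' hs'
    by_cases hb : z.Busy s'
    · simp only [hb, not_true_eq_false, false_and, if_false] at h1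
      refine ⟨⟨fun _ => hb, fun _ => ?_⟩, fun _ => h1⟩
      change y.pos s' ≤ y.arrived
      rw [h1, harr]
      exact (show z.pos s' ≤ z.arrived from hb).trans (by omega)
    · refine ⟨⟨fun hyb => ?_, fun h => absurd h hb⟩, fun h => absurd h hb⟩
      exfalso
      have hne : z.pos s' ≠ z.pos s := fun h => hs' (hz.idle_inj s' s hb hidle h)
      have hb' : z.arrived < z.pos s' := not_le.1 hb
      have hyb' : y.pos s' ≤ y.arrived := hyb
      rw [h1, harr] at hyb'
      by_cases hlt : z.pos s' < z.pos s
      · simp only [hb, hlt, not_false_eq_true, and_self, if_true] at hyb'; omega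
      · simp only [hlt, and_false, if_false] at hyb'; omega
  have hstarted : ∀ s' c, y.started s' c =
      if s' = s ∧ c = w.ξ (z.arrived + 1) then z.started s' c + 1 else z.started s' c := by
    intro s' c; simp [hy, State.start, arrive, shiftIdleBelow]
  have hgt : ∀ c k, w.ξ k = c → z.front E c < k → k ≤ y.front E c → k = z.arrived + 1 := by
    intro c k hk h1 h2
    obtain ⟨s', hs', h3⟩ := exists_cutPos_eq_front (hS c) y
    have h4 := cutPos_le_front hs' z
    have h6 := front_le_arrived (hS c) y
    rw [harr] at h6
    by_cases hb : z.Busy s'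
    · have hne : s' ≠ s := fun h => hidle (h ▸ hb)
      have h5 := hbusy s' hne
      rw [cutPos_of_busy (h5.1.2 hb), h5.2 hb] at h3
      rw [cutPos_of_busy hb] at h4
      omega
    · rw [cutPos_of_idle hb] at h4
      omega
  have hfront : y.front E (w.ξ (z.arrived + 1)) = z.arrived + 1 := by
    have h1 := cutPos_le_front hcompat y
    have h2 := front_le_arrived (hS (w.ξ (z.arrived + 1))) y
    have h3 : y.cutPos s = z.arrived + 1 := by simp [State.cutPos, hpos, harr]
    rw [harr] at h2; omega
  refine ⟨rfl, rfl, fun s' c => by simp [hy, State.start, arrive, shiftIdleBelow],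
    fun _ h => h.elim, ?_, ?_, fun s' hs' _ => ⟨(hbusy s' hs').1, (hbusy s' hs').2, ?_⟩,
    fun _ _ h => h.elim, fun c => ?_⟩
  · rintro s' rfl
    refine ⟨Or.inr hidle, by change y.pos s' ≤ y.arrived; rw [hpos, harr], by rwa [hpos], ?_, by
      rw [hpos, hfront]⟩
    rw [hpos]
    simp [hy, State.start, arrive, shiftIdleBelow]
  · intro s' c
    rw [hstarted]
    by_cases hs : s' = s
    · subst hs
      rw [hpos]
      by_cases hc : c = w.ξ (z.arrived + 1)
      · simp [hc]
      · simp [hc, Ne.symm hc]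
    · simp [hs]
  · simp [hy, State.start, arrive, shiftIdleBelow, hs']
  · rw [sum_started_update s (z.arrived + 1) hstarted]
    congr 1
    by_cases hc : w.ξ (z.arrived + 1) = c
    · rw [if_pos hc, ← hc, hfront, count_eq_one _ rfl]
      · intro k h1 h2 hk
        have := hgt _ k hk h1 (by rw [hfront]; omega)
        omega
      · have := front_le_arrived (hS (w.ξ (z.arrived + 1))) z
        omega
    · rw [if_neg hc, count_eq_zero]
      intro k h1 h2 hk
      have := hgt c k hk h1 h2
      rw [this] at hk
      exact hc hk

/-- A front advances only if it belongs to a type with an idle compatible server. It then passes the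
new customer alone, who is not of that type since all servers for the new customer are busy. -/
lemma effect_arrivalWaits (hS : ∀ c, ∃ s, E s c) {z : State J I}
    (hnone : ∀ s, E s (w.ξ (z.arrived + 1)) → z.Busy s) :
    Effect E w z (z.shiftIdle.arrive w) (fun _ => False) (fun _ => False) := by
  classical
  set y := z.shiftIdle.arrive w with hy
  have harr : y.arrived = z.arrived + 1 := rfl
  have hpos : ∀ s, y.pos s = if z.Busy s then z.pos s else z.pos s + 1 := fun s => rfl
  have hbusy : ∀ s, (y.Busy s ↔ z.Busy s) ∧ (z.Busy s → y.pos s = z.pos s) := by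
    intro s
    by_cases hb : z.Busy s
    · have hb' : z.pos s ≤ z.arrived := hb
      have h1 : y.pos s = z.pos s := by simp [hpos, hb]
      refine ⟨⟨fun _ => hb, fun _ => ?_⟩, fun _ => h1⟩
      change y.pos s ≤ y.arrived
      omega
    · have hb' : z.arrived < z.pos s := not_le.1 hb
      have h1 : y.pos s = z.pos s + 1 := by simp [hpos, hb]
      refine ⟨⟨fun hyb => ?_, fun h => absurd h hb⟩, fun h => absurd h hb⟩
      have hyb' : y.pos s ≤ y.arrived := hyb
      omega
  refine ⟨rfl, rfl, fun s' c => by simp [hy, arrive, shiftIdle], fun _ h => h.elim,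
    fun _ h => h.elim, fun s' c => by simp [hy, arrive, shiftIdle],
    fun s' _ _ => ⟨(hbusy s').1, (hbusy s').2, rfl⟩, fun _ _ h => h.elim, fun c => ?_⟩
  rw [count_eq_zero]
  · rfl
  · intro k h1 h2 hk
    obtain ⟨s', hs', h3⟩ := exists_cutPos_eq_front (hS c) y
    have h4 := cutPos_le_front hs' z
    have h6 := front_le_arrived (hS c) y
    by_cases hb : z.Busy s'
    · rw [cutPos_of_busy ((hbusy s').1.2 hb), (hbusy s').2 hb] at h3
      rw [cutPos_of_busy hb] at h4
      omega
    · rw [cutPos_of_idle hb] at h4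
      have : k = z.arrived + 1 := by omega
      subst this
      exact hb (hnone s' (by rwa [hk]))

/-- The move of `s` to `ℓ` may advance the fronts of all its types over many places. A customer
passed by the front of his own type was waiting and compatible with `s`, so by minimality of `ℓ` it
can only be `ℓ` itself. -/
lemma effect_completionNext (hS : ∀ c, ∃ s, E s c) {z : State J I}
    {s : Fin J} {ℓ : ℤ} (hbusy : z.Busy s) (h₀ : z.residual s = 0)
    (hfirst : IsLeast {ℓ' | z.Waiting E w ℓ' ∧ E s (w.ξ ℓ')} ℓ) :
    Effect E w z ((z.complete w s).start w s ℓ) (fun s' => s' = s) (fun s' => s' = s) := by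
  classical
  set y := (z.complete w s).start w s ℓ with hy
  have hpos : y.pos s = ℓ := by simp [hy, State.start, State.complete]
  have harr : y.arrived = z.arrived := rfl
  have hpos' : ∀ s', s' ≠ s → y.pos s' = z.pos s' := by
    intro s' hs'; simp [hy, State.start, State.complete, hs']
  have hstarted : ∀ s' c, y.started s' c =
      if s' = s ∧ c = w.ξ ℓ then z.started s' c + 1 else z.started s' c := by
    intro s' c; simp [hy, State.start, State.complete]
  have hℓ : ℓ ≤ z.arrived := hfirst.1.1.1
  have hlt : z.front E (w.ξ ℓ) < ℓ := by
    obtain ⟨s', hs', h3⟩ := exists_cutPos_eq_front (hS (w.ξ ℓ)) z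
    rw [← h3]
    exact (min_le_left _ _).trans_lt (hfirst.1.1.2 s' hs')
  have hcut : y.cutPos s = ℓ := by simp [State.cutPos, hpos, harr, hℓ]
  have hgt : ∀ c k, w.ξ k = c → z.front E c < k → k ≤ y.front E c → k = ℓ ∧ E s c := by
    intro c k hk h1 h2
    obtain ⟨s', hs', h3⟩ := exists_cutPos_eq_front (hS c) y
    have h4 := cutPos_le_front hs' z
    by_cases hss : s' = s
    · subst hss
      rw [hcut] at h3
      refine ⟨le_antisymm (by omega) (hfirst.2
        ⟨waiting_of_front_lt (by omega) (by rwa [hk]), ?_⟩), hs'⟩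
      rwa [hk]
    · have : y.cutPos s' = z.cutPos s' := by simp [State.cutPos, hpos' s' hss, harr]
      omega
  have hfront : y.front E (w.ξ ℓ) = ℓ := by
    have h1 := cutPos_le_front hfirst.1.2 y
    rw [hcut] at h1
    obtain ⟨s', hs', h3⟩ := exists_cutPos_eq_front (hS (w.ξ ℓ)) y
    by_cases hss : s' = s
    · rw [← h3, hss, hcut]
    · have : y.cutPos s' = z.cutPos s' := by simp [State.cutPos, hpos' s' hss, harr]
      have h4 := cutPos_le_front hs' z
      omega
  refine ⟨rfl, rfl, fun s' c => ?_, ?_, ?_, ?_, fun s' hs' _ => ⟨?_, fun _ => hpos' s' hs', ?_⟩,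
    fun _ h h' => absurd h' h, fun c => ?_⟩
  · simp only [hy, State.start, State.complete]
    by_cases hs : s' = s
    · subst hs
      by_cases hc : c = w.ξ (z.pos s')
      · simp [hc]
      · simp [hc, Ne.symm hc]
    · simp [hs]
  · rintro s' rfl; exact ⟨hbusy, h₀⟩
  · rintro s' rfl
    refine ⟨Or.inl rfl, by change y.pos s' ≤ y.arrived; rw [hpos, harr]; exact hℓ, by
      rw [hpos]; exact hfirst.1.2, ?_, by rw [hpos, hfront]⟩
    rw [hpos]
    simp [hy, State.start, State.complete]
  · intro s' c
    rw [hstarted]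
    by_cases hs : s' = s
    · subst hs
      rw [hpos]
      by_cases hc : c = w.ξ ℓ
      · simp [hc]
      · simp [hc, Ne.symm hc]
    · simp [hs]
  · change y.pos s' ≤ y.arrived ↔ z.pos s' ≤ z.arrived
    rw [hpos' s' hs', harr]
  · simp [hy, State.start, State.complete, hs']
  · rw [sum_started_update s ℓ hstarted]
    congr 1
    by_cases hc : w.ξ ℓ = c
    · rw [if_pos hc, ← hc, hfront, count_eq_one hlt rfl]
      intro k h1 h2 hk
      have := (hgt _ k hk h1 (by rw [hfront]; omega)).1
      omega
    · rw [if_neg hc, count_eq_zero]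
      intro k h1 h2 hk
      have := (hgt c k hk h1 h2).1
      rw [this] at hk
      exact hc hk

/-- The fronts of the types of `s` jump to the last arrival. They pass no customer of their own
type, as such a customer would have been waiting for `s`. -/
lemma effect_completionIdle (hS : ∀ c, ∃ s, E s c) {z : State J I}
    {s : Fin J} (hbusy : z.Busy s) (h₀ : z.residual s = 0)
    (hnone : ∀ ℓ', z.Waiting E w ℓ' → ¬ E s (w.ξ ℓ')) :
    Effect E w z ((z.complete w s).becomeIdle s) (fun _ => False) (fun s' => s' = s) := by
  classical
  set y := (z.complete w s).becomeIdle s with hy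
  have hpos : y.pos s = z.arrived + 1 := by simp [hy, becomeIdle, shiftIdle, State.complete]
  have harr : y.arrived = z.arrived := rfl
  have hpos' : ∀ s', s' ≠ s → y.pos s' = if z.Busy s' then z.pos s' else z.pos s' + 1 := by
    intro s' hs'
    by_cases hb : z.pos s' ≤ z.arrived <;>
      simp [hy, becomeIdle, shiftIdle, State.complete, hs', State.Busy, hb]
  have hkeep : ∀ s', s' ≠ s → (y.Busy s' ↔ z.Busy s') ∧ (z.Busy s' → y.pos s' = z.pos s') := by
    intro s' hs'
    have h1 := hpos' s' hs'
    by_cases hb : z.Busy s'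
    · rw [if_pos hb] at h1
      refine ⟨⟨fun _ => hb, fun _ => ?_⟩, fun _ => h1⟩
      change y.pos s' ≤ y.arrived
      rw [h1, harr]; exact hb
    · rw [if_neg hb] at h1
      have hb' : z.arrived < z.pos s' := not_le.1 hb
      refine ⟨⟨fun hyb => ?_, fun h => absurd h hb⟩, fun h => absurd h hb⟩
      have hyb' : y.pos s' ≤ y.arrived := hyb
      omega
  refine ⟨rfl, rfl, fun s' c => ?_, ?_, fun _ h => h.elim, ?_,
    fun s' _ hs' => ⟨(hkeep s' hs').1, (hkeep s' hs').2, rfl⟩, ?_, fun c => ?_⟩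
  · simp only [hy, becomeIdle, shiftIdle, State.complete]
    by_cases hs : s' = s
    · subst hs
      by_cases hc : c = w.ξ (z.pos s')
      · simp [hc]
      · simp [hc, Ne.symm hc]
    · simp [hs]
  · rintro s' rfl; exact ⟨hbusy, h₀⟩
  · intro s' c; simp [hy, becomeIdle, shiftIdle, State.complete]
  · rintro s' _ rfl
    refine ⟨?_, rfl⟩
    change ¬ y.pos s' ≤ y.arrived
    rw [hpos, harr]; omega
  · rw [count_eq_zero]
    · rfl
    · intro k h1 h2 hk
      obtain ⟨s', hs', h3⟩ := exists_cutPos_eq_front (hS c) y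
      have h4 := cutPos_le_front hs' z
      have h6 := front_le_arrived (hS c) y
      by_cases hss : s' = s
      · subst hss
        refine hnone k (waiting_of_front_lt (by omega) (by rwa [hk])) (by rwa [hk])
      · by_cases hb : z.Busy s'
        · rw [cutPos_of_busy ((hkeep s' hss).1.2 hb), (hkeep s' hss).2 hb] at h3
          rw [cutPos_of_busy hb] at h4
          omega
        · rw [cutPos_of_idle hb] at h4
          omega

lemma Jump.exists_effect (hS : ∀ c, ∃ s, E s c) {x₀ z y : State J I} (hz : Sound E w x₀ z)
    (h : Jump E w z y) : ∃ st cp, Effect E w z y st cp := by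
  cases h with
  | arrivalServed s h₀ hidle hcompat => exact ⟨_, _, effect_arrivalServed hS hz hidle hcompat⟩
  | arrivalWaits h₀ hnone => exact ⟨_, _, effect_arrivalWaits hS hnone⟩
  | completionNext s ℓ hbusy h₀ hfirst => exact ⟨_, _, effect_completionNext hS hbusy h₀ hfirst⟩
  | completionIdle s hbusy h₀ hnone => exact ⟨_, _, effect_completionIdle hS hbusy h₀ hnone⟩

end State

/-! ### Invariants of the states -/

namespace State

variable {J I : ℕ} {E : Fin J → Fin I → Prop} {w : Sample J I}

lemma IsInitial.busy {x₀ : State J I} (h : x₀.IsInitial E w) (s : Fin J) : x₀.Busy s := by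
  change x₀.pos s ≤ x₀.arrived
  rw [h.arrived_eq]; exact h.pos_nonpos s

lemma IsInitial.sound {x₀ : State J I} (h : x₀.IsInitial E w) : Sound E w x₀ x₀ where
  nextArrival_nonneg := h.nextArrival_nonneg
  residual_nonneg := h.residual_nonneg
  arrived_nonneg := h.arrived_eq.ge
  compat s _ := h.compat s
  idle_inj s _ hs _ _ := absurd (h.busy s) hs
  idle_bound s := (h.busy s).trans (by omega)
  arrivals := by simp [h.time_eq, h.arrived_eq]
  arrivals_lower := by simp [h.time_eq, h.arrived_eq]

/-- The sums begin with `u 2` because the delay before customer `1` is the initial `nextArrival`.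
The lower sum ends one term earlier: it omits the interval that has just begun. -/
lemma Sound.arrive_arrivals {x₀ z : State J I} (hz : Sound E w x₀ z) (h₀ : z.nextArrival = 0)
    (hna : 0 ≤ x₀.nextArrival) :
    z.time + w.u (z.arrived + 2) = x₀.nextArrival +
      ∑ i ∈ Finset.range (z.arrived + 1).toNat, w.u (i + 2) ∧
    ∑ i ∈ Finset.range ((z.arrived + 1).toNat - 1), w.u (i + 2) ≤ z.time := by
  have hn : (z.arrived + 1).toNat = z.arrived.toNat + 1 := by
    have := hz.arrived_nonneg; omega
  have hc : ((z.arrived.toNat : ℕ) : ℤ) = z.arrived := Int.toNat_of_nonneg hz.arrived_nonneg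
  have h1 := hz.arrivals
  rw [h₀, add_zero] at h1
  rw [hn, Finset.sum_range_succ, Nat.add_sub_cancel, hc]
  constructor
  · rw [h1]; ring
  · linarith

/-- The number of the last arrival plus the number of idle servers bounds all positions. An assigned
arrival raises the first and lowers the second; in the remaining events the bound rises by one
whenever idle servers move up. -/
lemma Move.sound (hS : ∀ c, ∃ s, E s c) (hu : ∀ ℓ, 0 ≤ w.u ℓ)
    (hv : ∀ s c, E s c → ∀ k, 0 ≤ w.v s c k) {x₀ x y : State J I} (hna : 0 ≤ x₀.nextArrival)
    (hx : Sound E w x₀ x) (h : Move E w x y) : Sound E w x₀ y := by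
  classical
  cases h with
  | advance δ hδ hw =>
    refine ⟨sub_nonneg.2 hw.1, fun s => ?_, hx.arrived_nonneg, hx.compat, hx.idle_inj,
      hx.idle_bound, ?_, ?_⟩
    · simp only [State.advance]
      split_ifs with hb
      · exact sub_nonneg.2 (hw.2 s hb)
      · exact hx.residual_nonneg s
    · have := hx.arrivals
      simp only [State.advance]
      linarith
    · have := hx.arrivals_lower
      simp only [State.advance]
      linarith
  | jump _ h =>
    obtain ⟨st, cp, he⟩ := h.exists_effect hS hx
    have hres : ∀ s, 0 ≤ y.residual s := by
      intro s
      by_cases hs : st s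
      · obtain ⟨-, -, hE, hr, -⟩ := he.start s hs
        rw [hr]; exact hv _ _ hE _
      · by_cases hc : cp s
        · rw [(he.idle s hs hc).2]; exact hx.residual_nonneg s
        · rw [(he.keep s hs hc).2.2]; exact hx.residual_nonneg s
    have hcom : ∀ s, y.Busy s → E s (w.ξ (y.pos s)) := by
      intro s hb
      by_cases hs : st s
      · exact (he.start s hs).2.2.1
      · by_cases hc : cp s
        · exact absurd hb (he.idle s hs hc).1
        · obtain ⟨h1, h2, -⟩ := he.keep s hs hc
          rw [h2 (h1.1 hb)]
          exact hx.compat s (h1.1 hb)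
    have hmono := h.below
    cases h with
    | arrivalServed s h₀ hidle hcompat =>
      obtain ⟨h1, h2⟩ := hx.arrive_arrivals h₀ hna
      have hpos : ∀ s', s' ≠ s →
          (((x.shiftIdleBelow (x.pos s)).arrive w).start w s (x.arrived + 1)).pos s'
          = if ¬ x.Busy s' ∧ x.pos s' < x.pos s then x.pos s' + 1 else x.pos s' := by
        intro s' hs'
        simp [State.start, arrive, shiftIdleBelow, hs']
      have hposs : (((x.shiftIdleBelow (x.pos s)).arrive w).start w s (x.arrived + 1)).pos s
          = x.arrived + 1 := by simp [State.start]
      have hbusy : ∀ s', (((x.shiftIdleBelow (x.pos s)).arrive w).start w s (x.arrived + 1)).Busy s'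
          ↔ s' = s ∨ x.Busy s' := by
        intro s'
        have he' := effect_arrivalServed hS hx hidle hcompat
        by_cases hs : s' = s
        · subst hs; simpa using (he'.start s' rfl).2.1
        · simpa [hs] using (he'.keep s' hs (fun h => h)).1
      refine ⟨hu _, hres, hx.arrived_nonneg.trans hmono.arrived, hcom, fun s₁ s₂ hs₁ hs₂ heq => ?_,
        fun s₁ => ?_, h1, h2⟩
      · rw [hbusy, not_or] at hs₁ hs₂
        rw [hpos s₁ hs₁.1, hpos s₂ hs₂.1] at heq
        have k1 : x.pos s₁ ≠ x.pos s := fun h => hs₁.1 (hx.idle_inj s₁ s hs₁.2 hidle h)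
        have k2 : x.pos s₂ ≠ x.pos s := fun h => hs₂.1 (hx.idle_inj s₂ s hs₂.2 hidle h)
        simp only [hs₁.2, hs₂.2, not_false_eq_true, true_and] at heq
        refine hx.idle_inj s₁ s₂ hs₁.2 hs₂.2 ?_
        split_ifs at heq <;> omega
      · have hcard : ({s' | ¬ x.Busy s'} : Set (Fin J)).ncard
            = ({s' | ¬ (((x.shiftIdleBelow (x.pos s)).arrive w).start w s
              (x.arrived + 1)).Busy s'} : Set (Fin J)).ncard + 1 := by
          rw [← Set.ncard_insert_of_notMem (a := s)]
          · congr 1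
            ext s'
            simp only [Set.mem_ofPred_eq, Set.mem_insert_iff, hbusy, not_or]
            by_cases hs : s' = s
            · subst hs; simp [hidle]
            · simp [hs]
          · simp [hbusy]
        have hle : (((x.shiftIdleBelow (x.pos s)).arrive w).start w s (x.arrived + 1)).arrived
            = x.arrived + 1 := rfl
        rw [hle]
        have hb := hx.idle_bound s
        have hb₁ := hx.idle_bound s₁
        by_cases hs : s₁ = s
        · subst hs
          rw [hposs]; omega
        · rw [hpos s₁ hs]
          split_ifs <;> omega
    | arrivalWaits h₀ hnone =>
      obtain ⟨h1, h2⟩ := hx.arrive_arrivals h₀ hna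
      have hbusy : ∀ s', (x.shiftIdle.arrive w).Busy s' ↔ x.Busy s' := fun s' =>
        ((effect_arrivalWaits hS hnone).keep s' id id).1
      refine ⟨hu _, hres, hx.arrived_nonneg.trans hmono.arrived, hcom, fun s₁ s₂ hs₁ hs₂ heq => ?_,
        fun s₁ => ?_, h1, h2⟩
      · rw [hbusy] at hs₁ hs₂
        simp only [arrive, shiftIdle, hs₁, hs₂, if_false] at heq
        exact hx.idle_inj s₁ s₂ hs₁ hs₂ (by omega)
      · have hb := hx.idle_bound s₁
        simp only [hbusy]
        simp only [arrive, shiftIdle]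
        split_ifs <;> omega
    | completionNext s ℓ hbusy h₀ hfirst =>
      have hb : ∀ s', ((x.complete w s).start w s ℓ).Busy s' ↔ x.Busy s' := by
        intro s'
        have he' := effect_completionNext hS hbusy h₀ hfirst
        by_cases hs : s' = s
        · subst hs; exact ⟨fun _ => hbusy, fun _ => (he'.start s' rfl).2.1⟩
        · exact (he'.keep s' hs hs).1
      have hpos : ∀ s', s' ≠ s → ((x.complete w s).start w s ℓ).pos s' = x.pos s' := by
        intro s' hs'; simp [State.start, State.complete, hs']
      have hposs : ((x.complete w s).start w s ℓ).pos s = ℓ := by simp [State.start]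
      refine ⟨hx.nextArrival_nonneg, hres, hx.arrived_nonneg, hcom, fun s₁ s₂ hs₁ hs₂ heq => ?_,
        fun s₁ => ?_, hx.arrivals, hx.arrivals_lower⟩
      · rw [hb] at hs₁ hs₂
        have k1 : s₁ ≠ s := fun h => hs₁ (h ▸ hbusy)
        have k2 : s₂ ≠ s := fun h => hs₂ (h ▸ hbusy)
        rw [hpos s₁ k1, hpos s₂ k2] at heq
        exact hx.idle_inj s₁ s₂ hs₁ hs₂ heq
      · simp only [hb]
        change _ ≤ x.arrived + _
        have hb₁ := hx.idle_bound s₁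
        by_cases hs : s₁ = s
        · have := hfirst.1.1.1
          rw [hs, hposs]; omega
        · rw [hpos s₁ hs]; exact hb₁
    | completionIdle s hbusy h₀ hnone =>
      have he' := effect_completionIdle hS hbusy h₀ hnone
      have hb : ∀ s', ((x.complete w s).becomeIdle s).Busy s' ↔ s' ≠ s ∧ x.Busy s' := by
        intro s'
        by_cases hs : s' = s
        · subst hs; simpa using (he'.idle s' id rfl).1
        · simpa [hs] using (he'.keep s' id hs).1
      have hpos : ∀ s', s' ≠ s → ((x.complete w s).becomeIdle s).pos s'
          = if x.Busy s' then x.pos s' else x.pos s' + 1 := by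
        intro s' hs'
        by_cases hb : x.pos s' ≤ x.arrived <;>
          simp [becomeIdle, shiftIdle, State.complete, hs', State.Busy, hb]
      have hposs : ((x.complete w s).becomeIdle s).pos s = x.arrived + 1 := by
        simp [becomeIdle, State.complete]
      have hidle : ∀ s', ¬ x.Busy s' → x.arrived < x.pos s' := fun s' h => not_le.1 h
      refine ⟨hx.nextArrival_nonneg, hres, hx.arrived_nonneg, hcom, fun s₁ s₂ hs₁ hs₂ heq => ?_,
        fun s₁ => ?_, hx.arrivals, hx.arrivals_lower⟩
      · rw [hb, not_and_or, not_not] at hs₁ hs₂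
        by_cases k1 : s₁ = s <;> by_cases k2 : s₂ = s
        · rw [k1, k2]
        · have k2' := hs₂.resolve_left k2
          rw [k1, hposs, hpos s₂ k2, if_neg k2'] at heq
          have := hidle s₂ k2'
          omega
        · have k1' := hs₁.resolve_left k1
          rw [k2, hposs, hpos s₁ k1, if_neg k1'] at heq
          have := hidle s₁ k1'
          omega
        · have k1' := hs₁.resolve_left k1
          have k2' := hs₂.resolve_left k2
          rw [hpos s₁ k1, hpos s₂ k2, if_neg k1', if_neg k2'] at heq
          exact hx.idle_inj s₁ s₂ k1' k2' (by omega)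
      · have hcard : ({s' | ¬ ((x.complete w s).becomeIdle s).Busy s'} : Set (Fin J)).ncard
            = ({s' | ¬ x.Busy s'} : Set (Fin J)).ncard + 1 := by
          rw [← Set.ncard_insert_of_notMem (a := s)]
          · congr 1
            ext s'
            simp only [Set.mem_ofPred_eq, Set.mem_insert_iff, hb, not_and_or, not_not, ne_eq]
          · simpa using hbusy
        rw [hcard]
        change _ ≤ x.arrived + _
        have hb₁ := hx.idle_bound s₁
        by_cases hs : s₁ = s
        · rw [hs, hposs]; push_cast; omega
        · rw [hpos s₁ hs]
          push_cast
          split_ifs <;> omega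

/-- The accounts of the services, given the initial state `x₀`. -/
structure Ledger (E : Fin J → Fin I → Prop) (w : Sample J I) (x₀ x : State J I) : Prop where
  work : ∀ s c, E s c → x.work s c +
      (open Classical in if x.Busy s ∧ w.ξ (x.pos s) = c then x.residual s else 0)
    = ∑ k ∈ Finset.range (x.started s c), w.v s c k +
      (open Classical in if w.ξ (x₀.pos s) = c then x₀.residual s else 0)
  work_lower : ∀ s c, E s c → ∑ k ∈ Finset.range (x.started s c - 1), w.v s c k ≤ x.work s c
  off : ∀ s c, ¬ E s c → x.started s c = 0 ∧ x.work s c = 0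
  done : ∀ s c, x.done s c + (open Classical in if x.Busy s ∧ w.ξ (x.pos s) = c then 1 else 0)
    = x.started s c + (open Classical in if w.ξ (x₀.pos s) = c then 1 else 0)
  front : ∀ c, ∑ s, x.started s c = count w c (x₀.front E c) (x.front E c)
  history : ∀ s, x.Busy s → x.time + x.residual s = x₀.residual s ∨
    ∃ z, Path E w x₀ z ∧ Path E w z x ∧ z.front E (w.ξ (x.pos s)) = x.pos s ∧
      ∃ i < x.started s (w.ξ (x.pos s)), x.time + x.residual s = z.time + w.v s (w.ξ (x.pos s)) i

lemma IsInitial.ledger {x₀ : State J I} (h : x₀.IsInitial E w) : Ledger E w x₀ x₀ where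
  work s c _ := by simp [h.work_eq, h.started_eq, h.busy s]
  work_lower s c _ := by simp [h.work_eq, h.started_eq]
  off s c _ := ⟨h.started_eq s c, h.work_eq s c⟩
  done s c := by simp [h.done_eq, h.started_eq, h.busy s]
  front c := by simp [h.started_eq, count]
  history s _ := Or.inl (by simp [h.time_eq])

/-- A server that starts or completes a service has no residual work before the event, so a start
adds exactly its processing time to the balance. The history of a new service is witnessed by the
state just after its start, when its customer is the front of its type. -/
lemma Move.ledger (hS : ∀ c, ∃ s, E s c) {x₀ x y : State J I} (hpath : Path E w x₀ x)
    (h₀ : ∀ s, 0 ≤ x₀.residual s) (hs : Sound E w x₀ x)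
    (hx : Ledger E w x₀ x) (h : Move E w x y) : Ledger E w x₀ y := by
  classical
  have hmove := h
  cases h with
  | advance δ hδ hw =>
    refine ⟨fun s c hE => ?_, fun s c hE => ?_, fun s c hE => ?_, hx.done, hx.front,
      fun s hb => ?_⟩
    · rw [show (x.advance w δ).started s c = x.started s c from rfl, ← hx.work s c hE]
      by_cases hb : x.Busy s ∧ w.ξ (x.pos s) = c
      · have hb' : (x.advance w δ).Busy s ∧ w.ξ ((x.advance w δ).pos s) = c := hb
        rw [if_pos hb, if_pos hb']
        simp [State.advance, hb]
      · have hb' : ¬ ((x.advance w δ).Busy s ∧ w.ξ ((x.advance w δ).pos s) = c) := hb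
        rw [if_neg hb, if_neg hb']
        simp [State.advance, hb]
    · exact (hx.work_lower s c hE).trans (hmove.below.work s c)
    · refine ⟨(hx.off s c hE).1, ?_⟩
      have hb : ¬ (x.Busy s ∧ w.ξ (x.pos s) = c) := by
        rintro ⟨hb, rfl⟩; exact hE (hs.compat s hb)
      simp [State.advance, hb, (hx.off s c hE).2]
    · have hb' : x.Busy s := hb
      have ht : (x.advance w δ).time + (x.advance w δ).residual s = x.time + x.residual s := by
        simp [State.advance, hb']
      rw [ht]
      rcases hx.history s hb' with h | ⟨z, h1, h2, h3, h4⟩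
      · exact Or.inl h
      · exact Or.inr ⟨z, h1, h2.tail hmove, h3, h4⟩
  | jump _ h =>
    obtain ⟨st, cp, he⟩ := h.exists_effect hS hs
    have hnostart : ∀ s c, (¬ st s ∨ w.ξ (y.pos s) ≠ c) → y.started s c = x.started s c := by
      intro s c hne
      rw [he.started, if_neg, add_zero]
      rintro ⟨h1, h2⟩
      rcases hne with h | h
      · exact h h1
      · exact h h2
    have hresid : ∀ s c, st s ∨ cp s →
        (if x.Busy s ∧ w.ξ (x.pos s) = c then x.residual s else 0) = 0 := by
      intro s c hsc
      by_cases hc : cp s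
      · rw [(he.complete s hc).2]; simp
      · have := ((he.start s (hsc.resolve_right hc)).1).resolve_left hc
        simp [this]
    have hinitial : ∀ s c, 0 ≤ if w.ξ (x₀.pos s) = c then x₀.residual s else 0 := by
      intro s c; split_ifs
      · exact h₀ s
      · exact le_rfl
    have hwork : ∀ s c, y.work s c = x.work s c := fun s c => by rw [he.work]
    refine ⟨fun s c hE => ?_, fun s c hE => ?_, fun s c hE => ?_, fun s c => ?_, fun c => ?_,
      fun s hb => ?_⟩
    · rw [hwork]
      have hw := hx.work s c hE
      by_cases hst : st s
      · obtain ⟨h1, h2, h3, h4, h5⟩ := he.start s hst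
        rw [hresid s c (Or.inl hst), add_zero] at hw
        by_cases hc : w.ξ (y.pos s) = c
        · have hstart : y.started s c = x.started s c + 1 := by rw [he.started, if_pos ⟨hst, hc⟩]
          rw [if_pos ⟨h2, hc⟩, hstart, Finset.sum_range_succ, h4, hc, hw]; ring
        · rw [if_neg (fun h => hc h.2), hnostart s c (Or.inr hc), hw]; ring
      · rw [hnostart s c (Or.inl hst)]
        by_cases hcp : cp s
        · rw [if_neg (fun h => (he.idle s hst hcp).1 h.1)]
          rwa [hresid s c (Or.inr hcp)] at hw
        · obtain ⟨h1, h2, h3⟩ := he.keep s hst hcp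
          rw [← hw, h3]
          congr 2
          refine propext ⟨fun h => ⟨h1.1 h.1, by rw [← h2 (h1.1 h.1)]; exact h.2⟩,
            fun h => ⟨h1.2 h.1, by rw [h2 h.1]; exact h.2⟩⟩
    · rw [hwork]
      by_cases hst : st s ∧ w.ξ (y.pos s) = c
      · have hstart : y.started s c = x.started s c + 1 := by rw [he.started, if_pos hst]
        have hw := hx.work s c hE
        rw [hresid s c (Or.inl hst.1), add_zero] at hw
        rw [hstart, Nat.add_sub_cancel, hw]
        linarith [hinitial s c]
      · have : y.started s c = x.started s c := by rw [he.started, if_neg hst, add_zero]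
        rw [this]; exact hx.work_lower s c hE
    · refine ⟨?_, by rw [hwork]; exact (hx.off s c hE).2⟩
      rw [he.started, if_neg, (hx.off s c hE).1]
      rintro ⟨h1, rfl⟩
      exact hE (he.start s h1).2.2.1
    · have hd := hx.done s c
      rw [he.done]
      have hcp0 : st s ∨ cp s → x.done s c + (if cp s ∧ w.ξ (x.pos s) = c then 1 else 0)
          = x.started s c + if w.ξ (x₀.pos s) = c then 1 else 0 := by
        intro hor
        rw [← hd]
        congr 2
        refine propext ⟨fun h => ⟨(he.complete s h.1).1, h.2⟩, fun h => ⟨?_, h.2⟩⟩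
        rcases hor with hst | hcp
        · exact ((he.start s hst).1).resolve_right (fun h' => h' h.1)
        · exact hcp
      by_cases hst : st s
      · obtain ⟨h1, h2, h3, h4, h5⟩ := he.start s hst
        rw [hcp0 (Or.inl hst)]
        by_cases hc : w.ξ (y.pos s) = c
        · have hstart : y.started s c = x.started s c + 1 := by rw [he.started, if_pos ⟨hst, hc⟩]
          simp [h2, hc, hstart]; ring
        · simp [hc, hnostart s c (Or.inr hc)]
      · rw [hnostart s c (Or.inl hst)]
        by_cases hcp : cp s
        · rw [hcp0 (Or.inr hcp)]; simp [(he.idle s hst hcp).1]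
        · obtain ⟨h1, h2, h3⟩ := he.keep s hst hcp
          rw [← hd, if_neg (fun h => hcp h.1), add_zero]
          congr 2
          refine propext ⟨fun h => ⟨h1.1 h.1, by rw [← h2 (h1.1 h.1)]; exact h.2⟩,
            fun h => ⟨h1.2 h.1, by rw [h2 h.1]; exact h.2⟩⟩
    · rw [he.count, hx.front]
      exact count_add (front_mono (hS c) hpath.below.cutPos) (front_mono (hS c) h.below.cutPos)
    · by_cases hst : st s
      · obtain ⟨h1, h2, h3, h4, h5⟩ := he.start s hst
        refine Or.inr ⟨y, hpath.tail hmove, Relation.ReflTransGen.refl, h5,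
          x.started s (w.ξ (y.pos s)), ?_, ?_⟩
        · rw [he.started, if_pos ⟨hst, rfl⟩]; omega
        · rw [h4]
      · have hcp : ¬ cp s := fun hcp => (he.idle s hst hcp).1 hb
        obtain ⟨h1, h2, h3⟩ := he.keep s hst hcp
        have hbx := h1.1 hb
        rw [he.time, h3, h2 hbx, hnostart s _ (Or.inl hst)]
        rcases hx.history s hbx with h | ⟨z, k1, k2, k3, k4⟩
        · exact Or.inl h
        · exact Or.inr ⟨z, k1, k2.tail hmove, k3, k4⟩

/-- All states that can be reached from an initial state are sound. -/
lemma Path.sound_ledger (hS : ∀ c, ∃ s, E s c) (hu : ∀ ℓ, 0 ≤ w.u ℓ)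
    (hv : ∀ s c, E s c → ∀ k, 0 ≤ w.v s c k) {x₀ x : State J I} (h₀ : x₀.IsInitial E w)
    (h : Path E w x₀ x) : Sound E w x₀ x ∧ Ledger E w x₀ x := by
  induction h with
  | refl => exact ⟨h₀.sound, h₀.ledger⟩
  | tail hp hm ih =>
    exact ⟨hm.sound hS hu hv h₀.nextArrival_nonneg ih.1,
      hm.ledger hS hp h₀.residual_nonneg ih.1 ih.2⟩

/-- If the work of a server on a type grows, the server is busy with this type at some time. -/
lemma Path.exists_serving {x y : State J I} (h : Path E w x y) (s : Fin J) (c : Fin I) :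
    y.work s c = x.work s c ∨
      ∃ z, Path E w x z ∧ Path E w z y ∧ z.Busy s ∧ w.ξ (z.pos s) = c := by
  induction h with
  | refl => exact Or.inl rfl
  | @tail y y' hp hm ih =>
    rcases ih with h | ⟨z, h1, h2, h3⟩
    swap
    · exact Or.inr ⟨z, h1, h2.tail hm, h3⟩
    cases hm with
    | advance δ hδ hw =>
      by_cases hb : y.Busy s ∧ w.ξ (y.pos s) = c
      · exact Or.inr ⟨y, hp, Relation.ReflTransGen.single (Move.advance y δ hδ hw), hb⟩
      · left
        rw [← h]
        simp [State.advance, hb]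
    | jump _ hj =>
      left
      rw [← h]
      have h1 := hj.below.work s c
      have h2 := hj.below.work_le s c
      have h3 : y'.time = y.time := by cases hj <;> rfl
      linarith

/-- A server that does not work all the time is idle at some time. -/
lemma Path.exists_idle {x y : State J I} (h : Path E w x y) (s : Fin J) :
    ∑ c, y.work s c - ∑ c, x.work s c = y.time - x.time ∨
      ∃ z, Path E w x z ∧ Path E w z y ∧ ¬ z.Busy s := by
  induction h with
  | refl => exact Or.inl (by simp)
  | @tail y y' hp hm ih =>
    rcases ih with h | ⟨z, h1, h2, h3⟩
    swap
    · exact Or.inr ⟨z, h1, h2.tail hm, h3⟩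
    cases hm with
    | advance δ hδ hw =>
      by_cases hb : y.Busy s
      · left
        have := y.advance_work_total (w := w) δ s
        rw [if_pos hb] at this
        have ht : (y.advance w δ).time = y.time + δ := rfl
        rw [ht]; linarith
      · exact Or.inr ⟨y, hp, Relation.ReflTransGen.single (Move.advance y δ hδ hw), hb⟩
    | jump _ hj =>
      left
      have h3 : y'.time = y.time := by cases hj <;> rfl
      have h4 : y'.work = y.work := by cases hj <;> rfl
      rw [h3, h4, h]

end State

/-! ### Runs -/

section Run

variable {J I : ℕ} {E : Fin J → Fin I → Prop} {w : Sample J I}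

open State

lemma State.advance_advance (x : State J I) (δ δ' : ℝ) :
    (x.advance w δ).advance w δ' = x.advance w (δ + δ') := by
  classical
  have hb : ∀ s, (x.advance w δ).Busy s ↔ x.Busy s := fun s => Iff.rfl
  simp only [State.advance, State.mk.injEq, true_and, and_true]
  refine ⟨by ring, ?_, by ring, ?_⟩
  · funext s
    change (if x.Busy s then _ else _) = _
    split_ifs <;> ring
  · funext s c
    change (if x.Busy s ∧ _ then _ else _) = _
    split_ifs <;> ring

lemma State.CanWait.of_le {x : State J I} {δ δ' : ℝ} (h : x.CanWait δ) (hle : δ' ≤ δ) :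
    x.CanWait δ' :=
  ⟨hle.trans h.1, fun s hs => hle.trans (h.2 s hs)⟩

lemma State.CanWait.advance {x : State J I} {δ δ' : ℝ} (h : x.CanWait (δ + δ')) :
    (x.advance w δ).CanWait δ' := by
  classical
  refine ⟨?_, fun s hs => ?_⟩
  · have := h.1
    simp only [State.advance]; linarith
  · have hs' : x.Busy s := hs
    have := h.2 s hs'
    simp only [State.advance, hs', if_true]; linarith

/-- Every step of a run consists of an elapse of time and an event. -/
lemma State.Step.exists_jump {x₀ x y : State J I} (hx : Sound E w x₀ x) (h : Step E w x y) :
    ∃ δ, 0 ≤ δ ∧ x.CanWait δ ∧ Jump E w (x.advance w δ) y := by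
  classical
  cases h with
  | arrivalServed s hδ hidle hcompat hlongest =>
    exact ⟨_, hx.nextArrival_nonneg, hδ,
      Jump.arrivalServed (x.advance w x.nextArrival) s (by simp [State.advance]) hidle hcompat⟩
  | arrivalWaits hδ hnone =>
    exact ⟨_, hx.nextArrival_nonneg, hδ,
      Jump.arrivalWaits (x.advance w x.nextArrival) (by simp [State.advance]) hnone⟩
  | completionNext s ℓ hbusy hδ hfirst =>
    exact ⟨_, hx.residual_nonneg s, hδ, Jump.completionNext (x.advance w (x.residual s)) s ℓ hbusy
      (by simp [State.advance, hbusy]) hfirst⟩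
  | completionIdle s hbusy hδ hnone =>
    exact ⟨_, hx.residual_nonneg s, hδ, Jump.completionIdle (x.advance w (x.residual s)) s hbusy
      (by simp [State.advance, hbusy]) hnone⟩

/-- Every state has a successor. -/
lemma State.exists_step (E : Fin J → Fin I → Prop) (w : Sample J I) (x : State J I) :
    ∃ y, Step E w x y := by
  classical
  by_cases harr : x.CanWait x.nextArrival
  · by_cases hidle : ∃ s, ¬ x.Busy s ∧ E s (w.ξ (x.arrived + 1))
    · obtain ⟨s, hs, hmax⟩ := Set.exists_max_image
        {s | ¬ x.Busy s ∧ E s (w.ξ (x.arrived + 1))} x.pos (Set.toFinite _) hidle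
      exact ⟨_, Step.arrivalServed x s harr hs.1 hs.2 fun s' h1 h2 => hmax s' ⟨h1, h2⟩⟩
    · push Not at hidle
      exact ⟨_, Step.arrivalWaits x harr fun s hs => by
        by_contra hb; exact hidle s hb hs⟩
  · have hex : ∃ s, x.Busy s ∧ x.residual s < x.nextArrival := by
      by_contra hcon
      push Not at hcon
      exact harr ⟨le_rfl, hcon⟩
    obtain ⟨s₁, hb₁, hs₁⟩ := hex
    obtain ⟨s, hs, hmin⟩ := Set.exists_min_image {s | x.Busy s} x.residual (Set.toFinite _)
      ⟨s₁, hb₁⟩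
    have hw : x.CanWait (x.residual s) := ⟨(hmin s₁ hb₁).trans hs₁.le, hmin⟩
    by_cases hwait : ∃ ℓ, x.Waiting E w ℓ ∧ E s (w.ξ ℓ)
    · obtain ⟨ℓ, hℓ, hleast⟩ := Int.exists_least_of_bdd
        (P := fun ℓ => x.Waiting E w ℓ ∧ E s (w.ξ ℓ))
        ⟨x.pos s, fun ℓ h => (h.1.2 s h.2).le⟩ hwait
      exact ⟨_, Step.completionNext x s ℓ hs hw ⟨hℓ, fun ℓ' h => hleast ℓ' h⟩⟩
    · push Not at hwait
      exact ⟨_, Step.completionIdle x s hs hw fun ℓ' h => hwait ℓ' h⟩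

/-- The nonnegativity of the clocks and the presence of a compatible server for every type. -/
structure Admissible (E : Fin J → Fin I → Prop) (w : Sample J I) : Prop where
  server : ∀ c, ∃ s, E s c
  u_nonneg : ∀ ℓ, 0 ≤ w.u ℓ
  v_nonneg : ∀ s c, E s c → ∀ k, 0 ≤ w.v s c k

lemma Admissible.sound (hw : Admissible E w) {x₀ x : State J I} (h₀ : x₀.IsInitial E w)
    (h : Path E w x₀ x) : Sound E w x₀ x :=
  (Path.sound_ledger hw.server hw.u_nonneg hw.v_nonneg h₀ h).1

lemma Admissible.ledger (hw : Admissible E w) {x₀ x : State J I} (h₀ : x₀.IsInitial E w)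
    (h : Path E w x₀ x) : Ledger E w x₀ x :=
  (Path.sound_ledger hw.server hw.u_nonneg hw.v_nonneg h₀ h).2

lemma State.Path.step {x₀ x y : State J I} (hx : Sound E w x₀ x) (h : Step E w x y) :
    Path E w x y := by
  obtain ⟨δ, h0, h1, h2⟩ := h.exists_jump hx
  exact (Relation.ReflTransGen.single (Move.advance x δ h0 h1)).tail (Move.jump _ _ h2)

/-- From every initial state there is a run. -/
lemma exists_run (hw : Admissible E w) {x₀ : State J I} (h₀ : x₀.IsInitial E w) :
    ∃ x, IsRun E w x ∧ x 0 = x₀ := by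
  classical
  have hnext : ∀ x : {x // Path E w x₀ x}, ∃ y : {x // Path E w x₀ x}, Step E w x.1 y.1 := by
    rintro ⟨x, hx⟩
    obtain ⟨y, hy⟩ := State.exists_step E w x
    exact ⟨⟨y, hx.trans (Path.step (hw.sound h₀ hx) hy)⟩, hy⟩
  choose f hf using hnext
  let X : ℕ → {x // Path E w x₀ x} := fun n =>
    Nat.rec ⟨x₀, Relation.ReflTransGen.refl⟩ (fun _ x => f x) n
  exact ⟨fun n => (X n).1, ⟨h₀, fun k => hf (X k)⟩, rfl⟩

lemma IsRun.path (hw : Admissible E w) {x : ℕ → State J I} (hx : IsRun E w x) (k : ℕ) :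
    Path E w (x 0) (x k) := by
  induction k with
  | zero => exact Relation.ReflTransGen.refl
  | succ k ih => exact ih.trans (Path.step (hw.sound hx.initial ih) (hx.step k))

lemma IsRun.path_of_le (hw : Admissible E w) {x : ℕ → State J I} (hx : IsRun E w x) {k n : ℕ}
    (h : k ≤ n) : Path E w (x k) (x n) := by
  induction n, h using Nat.le_induction with
  | base => exact Relation.ReflTransGen.refl
  | succ n _ ih =>
    exact ih.trans (Path.step (hw.sound hx.initial (hx.path hw n)) (hx.step n))

/-- The number of events. -/
lemma State.Jump.arrived_add_totalDone {x y : State J I} (h : Jump E w x y) :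
    y.arrived + y.totalDone = x.arrived + x.totalDone + 1 := by
  classical
  have key : ∀ s, (∑ s', ∑ c, if s' = s ∧ c = w.ξ (x.pos s) then x.done s' c + 1 else x.done s' c)
      = (∑ s', ∑ c, x.done s' c) + 1 := by
    intro s
    have : ∀ s' c, (if s' = s ∧ c = w.ξ (x.pos s) then x.done s' c + 1 else x.done s' c)
        = x.done s' c + if s' = s then (if c = w.ξ (x.pos s) then 1 else 0) else 0 := by
      intro s' c
      by_cases h1 : s' = s <;> by_cases h2 : c = w.ξ (x.pos s) <;> simp [h1, h2]
    simp only [this, Finset.sum_add_distrib]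
    congr 1
    rw [Finset.sum_eq_single s]
    · simp
    · intro s' _ hs
      simp [hs]
    · simp
  cases h with
  | arrivalServed s h₀ hidle hcompat =>
    simp only [totalDone, State.start, arrive, shiftIdleBelow]; ring
  | arrivalWaits h₀ hnone =>
    simp only [totalDone, arrive, shiftIdle]; ring
  | completionNext s ℓ hbusy h₀ hfirst =>
    simp only [totalDone, State.start, State.complete, key]; push_cast; ring
  | completionIdle s hbusy h₀ hnone =>
    simp only [totalDone, becomeIdle, shiftIdle, State.complete, key]; push_cast; ring

/-- Each event is one arrival or one completion. Bounds on these two counters over a finite time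
will therefore exclude an accumulation of events. -/
lemma IsRun.arrived_add_totalDone (hw : Admissible E w) {x : ℕ → State J I} (hx : IsRun E w x)
    (k : ℕ) : (x k).arrived + (x k).totalDone = k := by
  induction k with
  | zero => simp [hx.initial.arrived_eq, totalDone, hx.initial.done_eq]
  | succ k ih =>
    obtain ⟨δ, -, -, h⟩ := (hx.step k).exists_jump (hw.sound hx.initial (hx.path hw k))
    rw [h.arrived_add_totalDone]
    change (x k).arrived + (x k).totalDone + 1 = _
    rw [ih]; push_cast; ring

/-- The state at time `t` precedes the next event. -/
lemma IsRun.stateAt_spec (hw : Admissible E w) {x : ℕ → State J I} (hx : IsRun E w x)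
    (hunb : ∀ t, ∃ k, t < (x k).time) {t : ℝ} (ht : 0 ≤ t) :
    ∃ K : ℕ, ∃ δ δ' : ℝ, 0 ≤ δ ∧ 0 ≤ δ' ∧ (x K).CanWait (δ + δ') ∧
      stateAt w x t = (x K).advance w δ ∧ (x K).time + δ = t ∧
      Jump E w ((x K).advance w (δ + δ')) (x (K + 1)) ∧ t < (x (K + 1)).time := by
  set S : Set ℕ := {k | (x k).time ≤ t} with hS
  have hbdd : BddAbove S := by
    obtain ⟨n, hn⟩ := hunb t
    refine ⟨n, fun k hk => ?_⟩
    by_contra hlt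
    have := (hx.path_of_le hw (not_le.1 hlt).le).below.time
    have hk : (x k).time ≤ t := hk
    linarith
  have hne : S.Nonempty := ⟨0, by rw [hS]; change (x 0).time ≤ t; rw [hx.initial.time_eq]; exact ht⟩
  set K := sSup S with hK
  have hKS : (x K).time ≤ t := Nat.sSup_mem hne hbdd
  have hK1 : t < (x (K + 1)).time := by
    by_contra hle
    have : K + 1 ≤ K := le_csSup hbdd (not_lt.1 hle)
    omega
  obtain ⟨δ₀, h0, h1, h2⟩ := (hx.step K).exists_jump (hw.sound hx.initial (hx.path hw K))
  have ht1 : (x (K + 1)).time = (x K).time + δ₀ := by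
    have h3 := h2.below.time
    have : (x (K + 1)).time = ((x K).advance w δ₀).time := by
      generalize (x K).advance w δ₀ = z at h2
      generalize x (K + 1) = y at h2
      cases h2 <;> rfl
    rw [this]; rfl
  refine ⟨K, t - (x K).time, δ₀ - (t - (x K).time), by linarith, by linarith, ?_, rfl, by ring, ?_,
    hK1⟩
  · rwa [add_sub_cancel]
  · rwa [add_sub_cancel]

lemma IsRun.path_stateAt (hw : Admissible E w) {x : ℕ → State J I} (hx : IsRun E w x)
    (hunb : ∀ t, ∃ k, t < (x k).time) {t : ℝ} (ht : 0 ≤ t) :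
    Path E w (x 0) (stateAt w x t) ∧ (stateAt w x t).time = t := by
  obtain ⟨K, δ, δ', h1, h2, h3, h4, h5, -, -⟩ := hx.stateAt_spec hw hunb ht
  rw [h4]
  exact ⟨(hx.path hw K).tail (Move.advance _ _ h1 (h3.of_le (by linarith))), h5⟩

lemma IsRun.path_stateAt_of_le (hw : Admissible E w) {x : ℕ → State J I} (hx : IsRun E w x)
    (hunb : ∀ t, ∃ k, t < (x k).time) {t t' : ℝ} (ht : 0 ≤ t) (htt' : t ≤ t') :
    Path E w (stateAt w x t) (stateAt w x t') := by
  obtain ⟨K, δ, δ', h1, h2, h3, h4, h5, h6, h7⟩ := hx.stateAt_spec hw hunb ht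
  obtain ⟨K', ε, ε', k1, k2, k3, k4, k5, k6, k7⟩ := hx.stateAt_spec hw hunb (ht.trans htt')
  rw [h4, k4]
  rcases lt_trichotomy K K' with hlt | rfl | hgt
  · have e1 : Path E w ((x K).advance w δ) ((x K).advance w (δ + δ')) := by
      rw [← State.advance_advance]
      exact Relation.ReflTransGen.single (Move.advance _ _ h2 h3.advance)
    have e2 : Path E w ((x K).advance w δ) (x (K + 1)) := e1.tail (Move.jump _ _ h6)
    have e3 : Path E w ((x K).advance w δ) (x K') := e2.trans (hx.path_of_le hw hlt)
    exact e3.tail (Move.advance _ _ k1 (k3.of_le (by linarith)))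
  · have hδε : ε = δ + (ε - δ) := by ring
    rw [hδε, ← State.advance_advance]
    refine Relation.ReflTransGen.single (Move.advance _ _ (by linarith) ?_)
    refine State.CanWait.advance ?_
    rw [← hδε]
    exact k3.of_le (by linarith)
  · exfalso
    have := (hx.path_of_le hw (show K' + 1 ≤ K from hgt)).below.time
    linarith

end Run

/-! ### Law of large numbers bounds -/

/-- The finitely many `n` at which the error exceeds `ε * n` are absorbed into the constant. The
resulting bound holds for all `n`, hence can be used at random indices. -/
lemma exists_linear_bound {f : ℕ → ℝ} {L : ℝ}
    (h : Tendsto (fun n : ℕ => f n / n) atTop (𝓝 L)) {ε : ℝ} (hε : 0 < ε) :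
    ∃ M, 0 ≤ M ∧ ∀ n, |f n - L * n| ≤ ε * n + M := by
  have h1 : ∀ᶠ n : ℕ in atTop, |f n - L * n| ≤ ε * n := by
    have h2 : ∀ᶠ n : ℕ in atTop, |f n / n - L| < ε := by
      have := (Metric.tendsto_nhds.1 h) ε hε
      simpa [Real.dist_eq] using this
    filter_upwards [h2, eventually_gt_atTop 0] with n hn hn0
    have hn0' : (0:ℝ) < n := by exact_mod_cast hn0
    have : f n - L * n = (f n / n - L) * n := by field_simp
    rw [this, abs_mul, abs_of_pos hn0']
    exact mul_le_mul_of_nonneg_right hn.le hn0'.le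
  obtain ⟨N, hN⟩ := eventually_atTop.1 h1
  refine ⟨∑ n ∈ Finset.range N, |f n - L * n|, Finset.sum_nonneg fun _ _ => abs_nonneg _,
    fun n => ?_⟩
  have hεn : 0 ≤ ε * n := by positivity
  have hsum : 0 ≤ ∑ n ∈ Finset.range N, |f n - L * n| := Finset.sum_nonneg fun _ _ => abs_nonneg _
  rcases le_or_gt N n with hn | hn
  · linarith [hN n hn]
  · have := Finset.single_le_sum (f := fun n : ℕ => |f n - L * n|) (fun _ _ => abs_nonneg _)
      (Finset.mem_range.2 hn)
    linarith

/-- If partial sums grow at rate `L`, the number of terms within time `t` grows at rate `1 / L`. -/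
lemma exists_inverse_bound {f : ℕ → ℝ} {L : ℝ} (hL : 0 < L)
    (h : Tendsto (fun n : ℕ => f n / n) atTop (𝓝 L)) {ε : ℝ} (hε : 0 < ε) :
    ∃ M, 0 ≤ M ∧ ∀ (n : ℕ) (t b : ℝ), 0 ≤ t → 0 ≤ b → f (n - 1) ≤ t → t ≤ b + f n →
      |n - t / L| ≤ ε * t + M + b / L := by
  -- The first bound keeps the slope at least `L / 2`, so that `n - 1` is at most `2 * (t + M) / L`;
  -- the second turns the error `ε₁ * (n - 1)` into `ε * L * (t + M)`.
  set ε₁ := min (L / 2) (ε * L ^ 2 / 2) with hε₁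
  have hε₁pos : 0 < ε₁ := lt_min (by positivity) (by positivity)
  have h1 : ε₁ ≤ L / 2 := min_le_left _ _
  have h2 : ε₁ ≤ ε * L ^ 2 / 2 := min_le_right _ _
  obtain ⟨M, hM, hb⟩ := exists_linear_bound h hε₁pos
  refine ⟨1 + M / L + ε * M + ε₁ / L, by positivity, fun n t b ht hb0 hlow hup => ?_⟩
  have hk := abs_le.1 (hb (n - 1))
  have hn := abs_le.1 (hb n)
  set k : ℝ := ((n - 1 : ℕ) : ℝ) with hkdef
  have hkn : (n : ℝ) ≤ k + 1 := by
    rw [hkdef]; norm_cast; omega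
  have hk0 : 0 ≤ k := by positivity
  have hkb : k ≤ 2 * (t + M) / L := by
    rw [le_div_iff₀ hL]
    nlinarith
  have hε₁k : ε₁ * k ≤ ε * L * (t + M) := by
    calc ε₁ * k ≤ (ε * L ^ 2 / 2) * (2 * (t + M) / L) :=
          mul_le_mul h2 hkb hk0 (by positivity)
      _ = ε * L * (t + M) := by field_simp
  have hmain1 : L * k ≤ t + M + ε * L * (t + M) := by linarith
  have hmain2 : t ≤ b + L * n + (ε * L * (t + M) + ε₁) + M := by nlinarith
  rw [abs_le]
  have e1 : L * (1 + M / L + ε * M + ε₁ / L) = L + M + ε * L * M + ε₁ := by field_simp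
  have e2 : L * (t / L) = t := by field_simp
  have e3 : L * (b / L) = b := by field_simp
  constructor
  · have : L * (-(ε * t + (1 + M / L + ε * M + ε₁ / L) + b / L)) ≤ L * (n - t / L) := by
      rw [mul_neg, mul_add, mul_add, e1, mul_sub, e2, e3]; nlinarith
    exact le_of_mul_le_mul_left this hL
  · have : L * (n - t / L) ≤ L * (ε * t + (1 + M / L + ε * M + ε₁ / L) + b / L) := by
      rw [mul_add, mul_add, e1, mul_sub, e2, e3]; nlinarith
    exact le_of_mul_le_mul_left this hL

section Regular

variable {J I : ℕ}

open State

/-- A realisation of the primitives that satisfies the laws of large numbers. -/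
structure Regular (E : Fin J → Fin I → Prop) (α : Fin I → ℝ) (rate : Fin J → Fin I → ℝ)
    (lam : ℝ) (w : Sample J I) : Prop extends Admissible E w where
  lam_pos : 0 < lam
  α_pos : ∀ c, 0 < α c
  rate_pos : ∀ s c, E s c → 0 < rate s c
  u_lln : Tendsto (fun n : ℕ => (∑ i ∈ Finset.range n, w.u (i + 2)) / n) atTop (𝓝 (1 / lam))
  v_lln : ∀ s c, E s c →
    Tendsto (fun n : ℕ => (∑ k ∈ Finset.range n, w.v s c k) / n) atTop (𝓝 (1 / rate s c))
  ξ_pos : ∀ c, Tendsto (fun n : ℕ => (count w c 0 n : ℝ) / n) atTop (𝓝 (α c))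
  ξ_neg : ∀ c, Tendsto (fun n : ℕ => (count w c (-n) 0 : ℝ) / n) atTop (𝓝 (α c))

/-- Initial states whose fluid scalings converge. -/
structure Scaled (E : Fin J → Fin I → Prop) (w : Sample J I) (p₀ : Fin J → ℝ) (a : ℕ → ℝ)
    (x₀ : ℕ → State J I) : Prop where
  scale : Tendsto a atTop atTop
  initial : ∀ k, (x₀ k).IsInitial E w
  pos : ∀ s, Tendsto (fun k => ((x₀ k).pos s : ℝ) / a k) atTop (𝓝 (p₀ s))
  nextArrival : Tendsto (fun k => (x₀ k).nextArrival / a k) atTop (𝓝 0)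
  residual : ∀ s, Tendsto (fun k => (x₀ k).residual s / a k) atTop (𝓝 0)

variable {E : Fin J → Fin I → Prop} {α : Fin I → ℝ} {rate : Fin J → Fin I → ℝ} {lam : ℝ}
  {w : Sample J I} {p₀ : Fin J → ℝ} {a : ℕ → ℝ} {x₀ : ℕ → State J I}

/-- Counts are differences or sums of counts from customer `0`, to which the forward and backward
laws of large numbers apply; this is why the error is relative to the distances of both ends from
`0`. -/
lemma Regular.exists_count_bound (hw : Regular E α rate lam w) (c : Fin I) {ε : ℝ} (hε : 0 < ε) :
    ∃ M, 0 ≤ M ∧ ∀ p q : ℤ, p ≤ q →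
      |(count w c p q : ℝ) - α c * (q - p)| ≤ ε * (|(p:ℝ)| + |(q:ℝ)|) + M := by
  obtain ⟨M₁, hM₁, h₁⟩ := exists_linear_bound (hw.ξ_pos c) hε
  obtain ⟨M₂, hM₂, h₂⟩ := exists_linear_bound (hw.ξ_neg c) hε
  have hpos : ∀ p : ℤ, 0 ≤ p → |(count w c 0 p : ℝ) - α c * p| ≤ ε * |(p:ℝ)| + M₁ := by
    intro p hp
    obtain ⟨n, rfl⟩ := Int.eq_ofNat_of_zero_le hp
    simpa using h₁ n
  have hneg : ∀ p : ℤ, p ≤ 0 → |(count w c p 0 : ℝ) + α c * p| ≤ ε * |(p:ℝ)| + M₂ := by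
    intro p hp
    obtain ⟨n, hn⟩ := Int.eq_ofNat_of_zero_le (neg_nonneg.2 hp)
    obtain rfl : p = -(n : ℤ) := by omega
    have := h₂ n
    simp only [Int.cast_neg, Int.cast_natCast, abs_neg, Nat.abs_cast, mul_neg]
    rw [← sub_eq_add_neg]; exact this
  refine ⟨M₁ + M₁ + (M₂ + M₂), by positivity, fun p q hpq => ?_⟩
  rcases le_total 0 p with hp | hp
  · have h3 := count_add (w := w) (c := c) hp hpq
    have h3' : (count w c p q : ℝ) = count w c 0 q - count w c 0 p := by
      rw [← h3]; push_cast; ring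
    have h4 := hpos p hp
    have h5 := hpos q (hp.trans hpq)
    rw [h3']
    have : (count w c 0 q : ℝ) - count w c 0 p - α c * (q - p)
        = (count w c 0 q - α c * q) - (count w c 0 p - α c * p) := by ring
    rw [this]
    refine (abs_sub _ _).trans ?_
    linarith
  · rcases le_total 0 q with hq | hq
    · have h3 := count_add (w := w) (c := c) hp hq
      have h3' : (count w c p q : ℝ) = count w c p 0 + count w c 0 q := by
        rw [← h3]; push_cast; ring
      have h4 := hneg p hp
      have h5 := hpos q hq
      rw [h3']
      have : (count w c p 0 : ℝ) + count w c 0 q - α c * (q - p)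
          = (count w c p 0 + α c * p) + (count w c 0 q - α c * q) := by ring
      rw [this]
      refine (abs_add_le _ _).trans ?_
      linarith
    · have h3 := count_add (w := w) (c := c) hpq hq
      have h3' : (count w c p q : ℝ) = count w c p 0 - count w c q 0 := by
        rw [← h3]; push_cast; ring
      have h4 := hneg p hp
      have h5 := hneg q hq
      rw [h3']
      have : (count w c p 0 : ℝ) - count w c q 0 - α c * (q - p)
          = (count w c p 0 + α c * p) - (count w c q 0 + α c * q) := by ring
      rw [this]
      refine (abs_sub _ _).trans ?_
      linarith

lemma Scaled.eventually_const_le (hx : Scaled E w p₀ a x₀) (M : ℝ) {ε : ℝ} (hε : 0 < ε) :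
    ∀ᶠ k in atTop, M ≤ ε * a k :=
  (hx.scale.const_mul_atTop hε).eventually_ge_atTop M

lemma Scaled.eventually_pos (hx : Scaled E w p₀ a x₀) : ∀ᶠ k in atTop, 0 < a k :=
  hx.scale.eventually_gt_atTop 0

lemma Scaled.eventually_le (hx : Scaled E w p₀ a x₀) {b : ℕ → ℝ} {L ε : ℝ} (hε : L < ε)
    (hb : Tendsto (fun k => b k / a k) atTop (𝓝 L)) : ∀ᶠ k in atTop, b k ≤ ε * a k := by
  filter_upwards [hb.eventually_lt_const hε, hx.eventually_pos] with k h1 h2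
  rw [div_lt_iff₀ h2] at h1
  exact h1.le

/-- `P` holds eventually for all the states that can be reached up to time `B` (in fluid
scaling). -/
def EventuallyReached (E : Fin J → Fin I → Prop) (w : Sample J I) (a : ℕ → ℝ)
    (x₀ : ℕ → State J I) (B : ℝ) (P : ℕ → State J I → Prop) : Prop :=
  ∀ᶠ k in atTop, ∀ y, Path E w (x₀ k) y → y.time ≤ a k * B → P k y

lemma Scaled.time_nonneg (hx : Scaled E w p₀ a x₀) {k : ℕ} {y : State J I}
    (h : Path E w (x₀ k) y) : 0 ≤ y.time := by
  have := h.below.time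
  rwa [(hx.initial k).time_eq] at this

lemma Scaled.work_bounds (hx : Scaled E w p₀ a x₀) {k : ℕ} {y : State J I}
    (h : Path E w (x₀ k) y) (s : Fin J) (c : Fin I) : 0 ≤ y.work s c ∧ y.work s c ≤ y.time := by
  have h1 := h.below.work s c
  have h2 := h.below.work_le s c
  rw [(hx.initial k).work_eq] at h1 h2
  rw [(hx.initial k).time_eq] at h2
  exact ⟨h1, by linarith⟩

/-- The work lies between the sums of the first `started - 1` and the first `started` service times,
up to the initial residual, so the inverse law of large numbers applies. Thirds of `ε` pay for its
relative error, its constant and the initial residual. -/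
lemma Regular.started_estimate (hw : Regular E α rate lam w) (hx : Scaled E w p₀ a x₀) (B : ℝ)
    (s : Fin J) (c : Fin I) {ε : ℝ} (hε : 0 < ε) :
    EventuallyReached E w a x₀ B fun k y =>
      |(y.started s c : ℝ) - rate s c * y.work s c| ≤ ε * a k := by
  classical
  by_cases hE : E s c
  swap
  · filter_upwards [hx.eventually_pos] with k hk y hy ht
    obtain ⟨h1, h2⟩ := (hw.toAdmissible.ledger (hx.initial k) hy).off s c hE
    rw [h1, h2]
    simp; positivity
  have hr := hw.rate_pos s c hE
  set ε₁ := ε / (3 * (|B| + 1)) with hε₁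
  have hε₁pos : 0 < ε₁ := by positivity
  obtain ⟨M, hM, hbd⟩ := exists_inverse_bound (by positivity) (hw.v_lln s c hE) hε₁pos
  have hres := hx.eventually_le (L := 0) (ε := ε / (3 * rate s c)) (by positivity) (hx.residual s)
  filter_upwards [hx.eventually_pos, hx.eventually_const_le M (show 0 < ε / 3 by positivity), hres]
    with k hk h1 h2 y hy ht
  have hled := hw.toAdmissible.ledger (hx.initial k) hy
  have hsound := hw.toAdmissible.sound (hx.initial k) hy
  have hr0 := (hx.initial k).residual_nonneg s
  have hup : y.work s c ≤ (x₀ k).residual s + ∑ i ∈ Finset.range (y.started s c), w.v s c i := by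
    have h3 := hled.work s c hE
    have h4 : 0 ≤ if y.Busy s ∧ w.ξ (y.pos s) = c then y.residual s else 0 := by
      split_ifs
      · exact hsound.residual_nonneg s
      · exact le_rfl
    have h5 : (if w.ξ ((x₀ k).pos s) = c then (x₀ k).residual s else 0) ≤ (x₀ k).residual s := by
      split_ifs
      · exact le_rfl
      · exact hr0
    linarith
  obtain ⟨hw0, hwt⟩ := hx.work_bounds hy s c
  have h3 := hbd (y.started s c) (y.work s c) ((x₀ k).residual s) hw0 hr0
    (hled.work_lower s c hE) hup
  have e1 : y.work s c / (1 / rate s c) = rate s c * y.work s c := by field_simp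
  have e2 : (x₀ k).residual s / (1 / rate s c) = rate s c * (x₀ k).residual s := by field_simp
  rw [e1, e2] at h3
  have h4 : ε₁ * y.work s c ≤ ε / 3 * a k := by
    have : y.work s c ≤ a k * (|B| + 1) := by
      have := le_abs_self B
      nlinarith
    calc ε₁ * y.work s c ≤ ε₁ * (a k * (|B| + 1)) := mul_le_mul_of_nonneg_left this hε₁pos.le
      _ = ε / 3 * a k := by rw [hε₁]; field_simp
  have h5 : rate s c * (x₀ k).residual s ≤ ε / 3 * a k := by
    calc rate s c * (x₀ k).residual s ≤ rate s c * (ε / (3 * rate s c) * a k) :=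
          mul_le_mul_of_nonneg_left h2 hr.le
      _ = ε / 3 * a k := by field_simp
  linarith

lemma Regular.arrived_estimate (hw : Regular E α rate lam w) (hx : Scaled E w p₀ a x₀) (B : ℝ)
    {ε : ℝ} (hε : 0 < ε) :
    EventuallyReached E w a x₀ B fun k y => |(y.arrived : ℝ) - lam * y.time| ≤ ε * a k := by
  have hr := hw.lam_pos
  set ε₁ := ε / (3 * (|B| + 1)) with hε₁
  have hε₁pos : 0 < ε₁ := by positivity
  obtain ⟨M, hM, hbd⟩ := exists_inverse_bound (by positivity) hw.u_lln hε₁pos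
  have hres := hx.eventually_le (L := 0) (ε := ε / (3 * lam)) (by positivity) hx.nextArrival
  filter_upwards [hx.eventually_pos, hx.eventually_const_le M (show 0 < ε / 3 by positivity), hres]
    with k hk h1 h2 y hy ht
  have hsound := hw.toAdmissible.sound (hx.initial k) hy
  have ht0 := hx.time_nonneg hy
  have h3 := hbd y.arrived.toNat y.time (x₀ k).nextArrival ht0 (hx.initial k).nextArrival_nonneg
    hsound.arrivals_lower (by
      have := hsound.arrivals
      have := hsound.nextArrival_nonneg
      linarith)
  have hc : ((y.arrived.toNat : ℕ) : ℝ) = y.arrived := by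
    have := Int.toNat_of_nonneg hsound.arrived_nonneg
    exact_mod_cast congrArg (Int.cast : ℤ → ℝ) this
  have e1 : y.time / (1 / lam) = lam * y.time := by field_simp
  have e2 : (x₀ k).nextArrival / (1 / lam) = lam * (x₀ k).nextArrival := by field_simp
  rw [e1, e2, hc] at h3
  have h4 : ε₁ * y.time ≤ ε / 3 * a k := by
    have : y.time ≤ a k * (|B| + 1) := by
      have := le_abs_self B
      nlinarith
    calc ε₁ * y.time ≤ ε₁ * (a k * (|B| + 1)) := mul_le_mul_of_nonneg_left this hε₁pos.le
      _ = ε / 3 * a k := by rw [hε₁]; field_simp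
  have h5 : lam * (x₀ k).nextArrival ≤ ε / 3 * a k := by
    calc lam * (x₀ k).nextArrival ≤ lam * (ε / (3 * lam) * a k) :=
          mul_le_mul_of_nonneg_left h2 hr.le
      _ = ε / 3 * a k := by field_simp
  linarith

lemma Scaled.cutPos_eq (hx : Scaled E w p₀ a x₀) (k : ℕ) (s : Fin J) :
    (x₀ k).cutPos s = (x₀ k).pos s :=
  cutPos_of_busy ((hx.initial k).busy s)

/-- The services started are the customers between the two fronts, whose number is governed by the
law of large numbers for the types. Since its error is relative to positions, the fronts are first
bounded by multiples of `a k`, through the initial positions and the arrivals. -/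
lemma Regular.front_estimate (hw : Regular E α rate lam w) (hx : Scaled E w p₀ a x₀) (B : ℝ)
    (c : Fin I) {ε : ℝ} (hε : 0 < ε) :
    EventuallyReached E w a x₀ B fun k y =>
      |α c * ((y.front E c : ℝ) - (x₀ k).front E c) - ∑ s, (y.started s c : ℝ)| ≤ ε * a k := by
  set C : ℝ := ∑ s, |p₀ s| + 1 with hC
  have hC0 : 0 < C := by
    have : 0 ≤ ∑ s, |p₀ s| := Finset.sum_nonneg fun _ _ => abs_nonneg _
    positivity
  set C' : ℝ := C + (C + (lam * |B| + 1)) with hC'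
  have hlam := hw.lam_pos
  have hC'0 : 0 < C' := by positivity
  have hε₁pos : 0 < ε / (2 * C') := by positivity
  obtain ⟨M, hM, hbd⟩ := hw.exists_count_bound c hε₁pos
  have hp : ∀ᶠ k in atTop, ∀ s, |((x₀ k).pos s : ℝ)| ≤ C * a k := by
    rw [eventually_all]
    intro s
    have h1 : Tendsto (fun k => |((x₀ k).pos s : ℝ)| / a k) atTop (𝓝 |p₀ s|) := by
      refine (hx.pos s).abs.congr' ?_
      filter_upwards [hx.eventually_pos] with k hk
      rw [abs_div, abs_of_pos hk]
    refine hx.eventually_le ?_ h1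
    have := Finset.single_le_sum (f := fun s => |p₀ s|) (fun _ _ => abs_nonneg _)
      (Finset.mem_univ s)
    linarith
  filter_upwards [hx.eventually_pos, hx.eventually_const_le M (show 0 < ε / 2 by positivity), hp,
    hw.arrived_estimate hx B one_pos] with k hk h1 h2 h3 y hy ht
  have hled := hw.toAdmissible.ledger (hx.initial k) hy
  have hmono : (x₀ k).front E c ≤ y.front E c := front_mono (hw.server c) hy.below.cutPos
  have hfront0 : |((x₀ k).front E c : ℝ)| ≤ C * a k := by
    obtain ⟨s, -, hs⟩ := exists_cutPos_eq_front (hw.server c) (x₀ k)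
    rw [← hs, hx.cutPos_eq]; exact h2 s
  have harr := (abs_le.1 (h3 y hy ht)).2
  have hfront1 : |(y.front E c : ℝ)| ≤ (C + (lam * |B| + 1)) * a k := by
    have h4 : (y.front E c : ℝ) ≤ y.arrived := by
      exact_mod_cast front_le_arrived (hw.server c) y
    have h5 : ((x₀ k).front E c : ℝ) ≤ y.front E c := by exact_mod_cast hmono
    have h6 := (abs_le.1 hfront0).1
    have h7 : lam * y.time ≤ lam * |B| * a k := by
      have : y.time ≤ a k * |B| := ht.trans (mul_le_mul_of_nonneg_left (le_abs_self B) hk.le)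
      nlinarith
    have h8 : 0 ≤ lam * |B| * a k := by positivity
    rw [abs_le]
    constructor <;> nlinarith
  have h4 := hbd _ _ hmono
  rw [← hled.front c] at h4
  push_cast at h4
  rw [abs_sub_comm]
  refine h4.trans ?_
  have h5 : ε / (2 * C') * (|((x₀ k).front E c : ℝ)| + |(y.front E c : ℝ)|) ≤ ε / 2 * a k := by
    calc ε / (2 * C') * (|((x₀ k).front E c : ℝ)| + |(y.front E c : ℝ)|)
        ≤ ε / (2 * C') * (C' * a k) := by
          refine mul_le_mul_of_nonneg_left ?_ hε₁pos.le
          rw [hC']; linarith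
      _ = ε / 2 * a k := by field_simp
  linarith

/-- A single service time is the difference of two consecutive partial sums, both linear up to a
small relative error, and only of order `a k` services have been started. -/
lemma Regular.service_estimate (hw : Regular E α rate lam w) (hx : Scaled E w p₀ a x₀) (B : ℝ)
    (s : Fin J) (c : Fin I) (hE : E s c) {ε : ℝ} (hε : 0 < ε) :
    EventuallyReached E w a x₀ B fun k y => ∀ i < y.started s c, w.v s c i ≤ ε * a k := by
  have hr := hw.rate_pos s c hE
  set C : ℝ := rate s c * |B| + 1 with hC
  have hC0 : 0 < C := by positivity
  set ε₁ := ε / (4 * C) with hε₁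
  have hε₁pos : 0 < ε₁ := by positivity
  obtain ⟨M, hM, hbd⟩ := exists_linear_bound (hw.v_lln s c hE) hε₁pos
  filter_upwards [hx.eventually_pos, hw.started_estimate hx B s c one_pos,
    hx.eventually_const_le (1 / rate s c + 2 * M) (show 0 < ε / 2 by positivity)]
    with k hk h1 h2 y hy ht i hi
  have h3 := (abs_le.1 (h1 y hy ht)).2
  have h4 : (y.started s c : ℝ) ≤ C * a k := by
    have := (hx.work_bounds hy s c).2
    have h5 : y.time ≤ a k * |B| := ht.trans (mul_le_mul_of_nonneg_left (le_abs_self B) hk.le)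
    nlinarith
  have h6 : ((i : ℝ) + 1) ≤ y.started s c := by exact_mod_cast hi
  have h7 := abs_le.1 (hbd i)
  have h8 := abs_le.1 (hbd (i + 1))
  rw [Finset.sum_range_succ] at h8
  push_cast at h8
  have h9 : ε₁ * (C * a k) = ε / 4 * a k := by rw [hε₁]; field_simp
  have h10 : ε₁ * (i + 1) ≤ ε / 4 * a k := by
    rw [← h9]; exact mul_le_mul_of_nonneg_left (h6.trans h4) hε₁pos.le
  have h11 : ε₁ * i ≤ ε₁ * (i + 1) := mul_le_mul_of_nonneg_left (by linarith) hε₁pos.le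
  have h12 := h7.1
  have h13 := h8.2
  have : w.v s c i ≤ 1 / rate s c + ε₁ * (i + 1) + ε₁ * i + 2 * M := by linarith
  linarith

/-- The fronts move according to the work. -/
lemma Regular.front_work_estimate (hw : Regular E α rate lam w) (hx : Scaled E w p₀ a x₀)
    (B : ℝ) (c : Fin I) {ε : ℝ} (hε : 0 < ε) :
    EventuallyReached E w a x₀ B fun k y =>
      |(y.front E c : ℝ) - (x₀ k).front E c - (∑ s, rate s c * y.work s c) / α c| ≤ ε * a k := by
  have hα := hw.α_pos c
  have hall : ∀ᶠ k in atTop, ∀ s, ∀ y, Path E w (x₀ k) y → y.time ≤ a k * B →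
      |(y.started s c : ℝ) - rate s c * y.work s c| ≤ (ε * α c / (2 * (J + 1))) * a k := by
    rw [eventually_all]
    exact fun s => hw.started_estimate hx B s c (by positivity)
  filter_upwards [hall, hw.front_estimate hx B c (show 0 < ε * α c / 2 by positivity),
    hx.eventually_pos] with k h1 h2 hk y hy ht
  have h3 := h2 y hy ht
  have h4 : |∑ s, (y.started s c : ℝ) - ∑ s, rate s c * y.work s c| ≤ ε * α c / 2 * a k := by
    rw [← Finset.sum_sub_distrib]
    refine (Finset.abs_sum_le_sum_abs _ _).trans ?_
    refine (Finset.sum_le_sum fun s _ => h1 s y hy ht).trans ?_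
    rw [Finset.sum_const, Finset.card_univ, Fintype.card_fin, nsmul_eq_mul]
    have : (J : ℝ) * (ε * α c / (2 * (J + 1)) * a k) = (ε * α c / 2 * a k) * (J / (J + 1)) := by
      field_simp
    rw [this]
    refine mul_le_of_le_one_right (by positivity) ?_
    rw [div_le_one (by positivity)]; linarith
  have h5 : α c * ((y.front E c : ℝ) - (x₀ k).front E c - (∑ s, rate s c * y.work s c) / α c)
      = (α c * ((y.front E c : ℝ) - (x₀ k).front E c) - ∑ s, (y.started s c : ℝ))
        + (∑ s, (y.started s c : ℝ) - ∑ s, rate s c * y.work s c) := by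
    field_simp; ring
  have h6 : α c * |(y.front E c : ℝ) - (x₀ k).front E c - (∑ s, rate s c * y.work s c) / α c|
      ≤ α c * (ε * a k) := by
    rw [← abs_of_pos hα, ← abs_mul, abs_of_pos hα, h5]
    refine (abs_add_le _ _).trans ?_
    linarith
  exact le_of_mul_le_mul_left h6 hα

/-- A busy server is close to the front of the type that it serves. -/
lemma Regular.busy_estimate (hw : Regular E α rate lam w) (hx : Scaled E w p₀ a x₀)
    (B : ℝ) {ε : ℝ} (hε : 0 < ε) :
    EventuallyReached E w a x₀ B fun k y => ε * a k ≤ y.time → ∀ s, y.Busy s →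
      (y.front E (w.ξ (y.pos s)) : ℝ) ≤ y.pos s + ε * a k := by
  set K : ℝ := ∑ c, (∑ s, |rate s c|) / α c with hK
  have hKc : ∀ c, (∑ s, |rate s c|) / α c ≤ K := fun c =>
    Finset.single_le_sum (f := fun c => (∑ s, |rate s c|) / α c)
      (fun c _ => div_nonneg (Finset.sum_nonneg fun _ _ => abs_nonneg _) (hw.α_pos c).le)
      (Finset.mem_univ c)
  have hK0 : 0 ≤ K := Finset.sum_nonneg fun c _ =>
    div_nonneg (Finset.sum_nonneg fun _ _ => abs_nonneg _) (hw.α_pos c).le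
  -- `K` bounds the speed of all the fronts. During a service of length at most `ε₁ * a k` the front
  -- moves by at most a third of the allowance; the other two thirds are the estimates at the start
  -- of the service and at present.
  set ε₁ := ε / (3 * (K + 1)) with hε₁
  have hε₁pos : 0 < ε₁ := by positivity
  have hfr : ∀ᶠ k in atTop, ∀ c, ∀ y, Path E w (x₀ k) y → y.time ≤ a k * B →
      |(y.front E c : ℝ) - (x₀ k).front E c - (∑ s, rate s c * y.work s c) / α c|
        ≤ ε / 3 * a k := by
    rw [eventually_all]
    exact fun c => hw.front_work_estimate hx B c (by positivity)
  have hsv : ∀ᶠ k in atTop, ∀ s c, E s c → ∀ y, Path E w (x₀ k) y → y.time ≤ a k * B →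
      ∀ i < y.started s c, w.v s c i ≤ ε₁ * a k := by
    rw [eventually_all]; intro s
    rw [eventually_all]; intro c
    by_cases hE : E s c
    · exact (hw.service_estimate hx B s c hE hε₁pos).mono fun k h _ => h
    · exact Eventually.of_forall fun k h => absurd h hE
  have hres : ∀ᶠ k in atTop, ∀ s, (x₀ k).residual s ≤ ε / 2 * a k := by
    rw [eventually_all]
    exact fun s => hx.eventually_le (by positivity) (hx.residual s)
  filter_upwards [hfr, hsv, hres, hx.eventually_pos] with k h1 h2 h3 hk y hy ht htε s hb
  have hled := hw.toAdmissible.ledger (hx.initial k) hy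
  have hsound := hw.toAdmissible.sound (hx.initial k) hy
  -- The service in progress at time zero is over, since the initial residuals are at most `ε / 2 *
  -- a k`. Hence the present service began at a state `z`, in which the position of the server was
  -- the front.
  rcases hled.history s hb with h4 | ⟨z, h4, h5, h6, i, hi, h7⟩
  · exfalso
    have h8 := hsound.residual_nonneg s
    have h9 := h3 s
    nlinarith
  have hE := hsound.compat s hb
  set c := w.ξ (y.pos s) with hc
  have hzt : z.time ≤ a k * B := h5.below.time.trans ht
  have h8 := abs_le.1 (h1 c z h4 hzt)
  have h9 := abs_le.1 (h1 c y hy ht)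
  have h10 : y.time - z.time ≤ ε₁ * a k := by
    have := h2 s c hE y hy ht i hi
    have := hsound.residual_nonneg s
    linarith
  have h11 : (∑ s, rate s c * y.work s c) / α c - (∑ s, rate s c * z.work s c) / α c
      ≤ ε / 3 * a k := by
    rw [← sub_div, ← Finset.sum_sub_distrib]
    calc (∑ s, (rate s c * y.work s c - rate s c * z.work s c)) / α c
        ≤ (∑ s, |rate s c| * (y.time - z.time)) / α c := by
          refine div_le_div_of_nonneg_right (Finset.sum_le_sum fun s' _ => ?_) (hw.α_pos c).le
          rw [← mul_sub]
          have k1 := h5.below.work s' c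
          have k2 := h5.below.work_le s' c
          exact mul_le_mul (le_abs_self _) k2 (sub_nonneg.2 k1) (abs_nonneg _)
      _ = (∑ s, |rate s c|) / α c * (y.time - z.time) := by
          rw [← Finset.sum_mul]; ring
      _ ≤ K * (ε₁ * a k) := mul_le_mul (hKc c) h10 (sub_nonneg.2 h5.below.time) hK0
      _ ≤ (K + 1) * (ε₁ * a k) :=
          mul_le_mul_of_nonneg_right (by linarith) (by positivity)
      _ = ε / 3 * a k := by rw [hε₁]; field_simp
  have h12 : (z.front E c : ℝ) = y.pos s := by exact_mod_cast h6
  linarith [h8.1, h9.2]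

/-- Idle servers are at most `J` places beyond the last arrival, which is negligible on the fluid
scale. -/
lemma Regular.pos_estimate (hw : Regular E α rate lam w) (hx : Scaled E w p₀ a x₀)
    (B : ℝ) {ε : ℝ} (hε : 0 < ε) :
    EventuallyReached E w a x₀ B fun k y => ∀ s,
      (y.cutPos s : ℝ) ≤ y.pos s ∧ (y.pos s : ℝ) ≤ y.cutPos s + ε * a k := by
  filter_upwards [hx.eventually_const_le J hε, hx.eventually_pos] with k h1 hk y hy ht s
  have hsound := hw.toAdmissible.sound (hx.initial k) hy
  refine ⟨by exact_mod_cast min_le_left _ _, ?_⟩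
  by_cases hb : y.Busy s
  · rw [cutPos_of_busy hb]
    have : 0 < ε * a k := by positivity
    linarith
  · rw [cutPos_of_idle hb]
    have h2 := hsound.idle_bound s
    have h3 : ({s' | ¬ y.Busy s'} : Set (Fin J)).ncard ≤ J := by
      have := Set.ncard_le_ncard (Set.subset_univ {s' | ¬ y.Busy s'}) (Set.toFinite _)
      rwa [Set.ncard_univ, Nat.card_eq_fintype_card, Fintype.card_fin] at this
    have h4 : y.pos s ≤ y.arrived + J := by omega
    have h5 : (y.pos s : ℝ) ≤ y.arrived + J := by exact_mod_cast h4
    linarith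

/-- Completions and starts on a link differ by at most one: only the initial and the current
customer of the server can be counted on one side alone. -/
lemma Regular.done_estimate (hw : Regular E α rate lam w) (hx : Scaled E w p₀ a x₀) (B : ℝ)
    (s : Fin J) (c : Fin I) {ε : ℝ} (hε : 0 < ε) :
    EventuallyReached E w a x₀ B fun k y =>
      |(y.done s c : ℝ) - rate s c * y.work s c| ≤ ε * a k := by
  classical
  filter_upwards [hw.started_estimate hx B s c (show 0 < ε / 2 by positivity),
    hx.eventually_const_le 1 (show 0 < ε / 2 by positivity)] with k h1 h2 y hy ht
  have hled := hw.toAdmissible.ledger (hx.initial k) hy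
  have h3 := hled.done s c
  have h4 : |(y.done s c : ℝ) - y.started s c| ≤ 1 := by
    have h5 : y.done s c ≤ y.started s c + 1 := by split_ifs at h3 <;> omega
    have h6 : y.started s c ≤ y.done s c + 1 := by split_ifs at h3 <;> omega
    have h5' : (y.done s c : ℝ) ≤ y.started s c + 1 := by exact_mod_cast h5
    have h6' : (y.started s c : ℝ) ≤ y.done s c + 1 := by exact_mod_cast h6
    rw [abs_le]; constructor <;> linarith
  have h5 : (y.done s c : ℝ) - rate s c * y.work s c
      = (y.done s c - y.started s c) + (y.started s c - rate s c * y.work s c) := by ring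
  rw [h5]
  refine (abs_add_le _ _).trans ?_
  linarith [h1 y hy ht]

/-- The events of a run do not accumulate. -/
lemma Regular.unbounded (hw : Regular E α rate lam w) {x : ℕ → State J I} (hx : IsRun E w x) :
    ∀ t, ∃ k, t < (x k).time := by
  intro t
  by_contra hcon
  push Not at hcon
  have htend : Tendsto (fun k : ℕ => (k : ℝ)) atTop atTop := tendsto_natCast_atTop_atTop
  -- The run is compared with itself at scale `k`. The estimates concern all reachable states rather
  -- than `stateAt`, so they need no absence of accumulation; one large fixed `k` bounds arrivals
  -- and completions at every event before time `t`.
  have hsc : Scaled E w 0 (fun k : ℕ => (k : ℝ)) (fun _ => x 0) :=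
    ⟨htend, fun _ => hx.initial, fun s => tendsto_const_nhds.div_atTop htend,
      tendsto_const_nhds.div_atTop htend, fun s => tendsto_const_nhds.div_atTop htend⟩
  have hdone : ∀ᶠ k : ℕ in atTop, ∀ s c, ∀ y, Path E w (x 0) y → y.time ≤ (k : ℝ) * |t| →
      |(y.done s c : ℝ) - rate s c * y.work s c| ≤ 1 * (k : ℝ) := by
    rw [eventually_all]; intro s
    rw [eventually_all]; intro c
    exact hw.done_estimate hsc |t| s c one_pos
  obtain ⟨k, h1, h2, h3⟩ := (hdone.and ((hw.arrived_estimate hsc |t| one_pos).and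
    (eventually_ge_atTop 1))).exists
  have h3' : (1 : ℝ) ≤ k := by exact_mod_cast h3
  have htime : ∀ n, (x n).time ≤ (k : ℝ) * |t| := fun n => by
    have := hcon n
    have := le_abs_self t
    have := abs_nonneg t
    nlinarith
  set D : ℝ := ∑ s, ∑ c, (|rate s c| * |t| * k + k) with hD
  have hbound : ∀ n : ℕ, (n : ℝ) ≤ (lam * ((k : ℝ) * |t|) + k) + D := by
    intro n
    have hp := hx.path hw.toAdmissible n
    have h4 := hx.arrived_add_totalDone hw.toAdmissible n
    have h5 : ((x n).arrived : ℝ) + (x n).totalDone = n := by exact_mod_cast h4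
    have h6 := (abs_le.1 (h2 _ hp (htime n))).2
    have h7 : lam * (x n).time ≤ lam * ((k : ℝ) * |t|) :=
      mul_le_mul_of_nonneg_left (htime n) hw.lam_pos.le
    have h8 : ((x n).totalDone : ℝ) ≤ D := by
      rw [totalDone, hD]
      push_cast
      refine Finset.sum_le_sum fun s _ => Finset.sum_le_sum fun c _ => ?_
      have h9 := (abs_le.1 (h1 s c _ hp (htime n))).2
      obtain ⟨h10, h11⟩ := hsc.work_bounds (k := k) hp s c
      have h12 : rate s c * (x n).work s c ≤ |rate s c| * |t| * k := by
        have := mul_le_mul (le_abs_self (rate s c)) (h11.trans (htime n)) h10 (abs_nonneg _)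
        linarith
      linarith
    linarith
  obtain ⟨n, hn⟩ := exists_nat_gt ((lam * ((k : ℝ) * |t|) + k) + D)
  linarith [hbound n]

end Regular

/-! ### Fluid limits -/

lemma tendsto_isGreatest {ι : Type*} [Finite ι] {S : Set ι} {f : ℕ → ι → ℝ} {p : ι → ℝ}
    {g : ℕ → ℝ} {M : ℝ} (hf : ∀ i ∈ S, Tendsto (fun k => f k i) atTop (𝓝 (p i)))
    (hg : ∀ᶠ k in atTop, IsGreatest (f k '' S) (g k)) (hM : IsGreatest (p '' S) M) :
    Tendsto g atTop (𝓝 M) := by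
  rw [Metric.tendsto_nhds]
  intro ε hε
  have h1 : ∀ᶠ k in atTop, ∀ i, i ∈ S → |f k i - p i| < ε := by
    rw [eventually_all]
    intro i
    by_cases hi : i ∈ S
    · filter_upwards [(Metric.tendsto_nhds.1 (hf i hi)) ε hε] with k hk _
      simpa [Real.dist_eq] using hk
    · exact Eventually.of_forall fun k h => absurd h hi
  filter_upwards [h1, hg] with k hk hgk
  obtain ⟨i, hi, hgi⟩ := hgk.1
  obtain ⟨j, hj, hMj⟩ := hM.1
  have h2 : p i ≤ M := hM.2 ⟨i, hi, rfl⟩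
  have h3 : f k j ≤ g k := hgk.2 ⟨j, hj, rfl⟩
  have h4 := abs_lt.1 (hk i hi)
  have h5 := abs_lt.1 (hk j hj)
  rw [Real.dist_eq, abs_lt]
  constructor <;> linarith

section Fluid

variable {J I : ℕ}

open State

/-- The initial position of the front of type `c` in the fluid model. -/
noncomputable def initialFront (E : Fin J → Fin I → Prop) (p₀ : Fin J → ℝ) (c : Fin I) : ℝ :=
  sSup (p₀ '' {s | E s c})

/-- The position of the front of type `c` in the fluid model with cumulative processing times
`T`. -/
noncomputable def fluidFront (E : Fin J → Fin I → Prop) (α : Fin I → ℝ)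
    (rate : Fin J → Fin I → ℝ) (p₀ : Fin J → ℝ) (T : Fin J → Fin I → ℝ → ℝ) (t : ℝ)
    (c : Fin I) : ℝ :=
  initialFront E p₀ c + (∑ s, rate s c * T s c t) / α c

/-- The fronts relative to the last arrival. -/
noncomputable def fluidLag (E : Fin J → Fin I → Prop) (α : Fin I → ℝ)
    (rate : Fin J → Fin I → ℝ) (lam : ℝ) (p₀ : Fin J → ℝ) (T : Fin J → Fin I → ℝ → ℝ) (t : ℝ)
    (c : Fin I) : ℝ :=
  fluidFront E α rate p₀ T t c - lam * t

/-- The position of server `s` in the fluid model. -/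
noncomputable def fluidPos (E : Fin J → Fin I → Prop) (α : Fin I → ℝ)
    (rate : Fin J → Fin I → ℝ) (lam : ℝ) (p₀ : Fin J → ℝ) (T : Fin J → Fin I → ℝ → ℝ) (s : Fin J)
    (t : ℝ) : ℝ :=
  lam * t + lowest E s (fluidLag E α rate lam p₀ T t)

/-- The properties of the cumulative processing times of a fluid limit. -/
structure FluidPath (E : Fin J → Fin I → Prop) (α : Fin I → ℝ) (rate : Fin J → Fin I → ℝ)
    (lam : ℝ) (p₀ : Fin J → ℝ) (T : Fin J → Fin I → ℝ → ℝ) : Prop where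
  zero : ∀ s c, T s c 0 = 0
  supp : ∀ s c t, 0 ≤ t → ¬ E s c → T s c t = 0
  mono : ∀ s c t t', 0 ≤ t → t ≤ t' → T s c t ≤ T s c t'
  total : ∀ s t t', 0 ≤ t → t ≤ t' → ∑ c, T s c t' - ∑ c, T s c t ≤ t' - t
  front_le : ∀ t c, 0 ≤ t → fluidFront E α rate p₀ T t c ≤ lam * t
  greatest : ∀ t c, 0 < t → IsGreatest ((fun s => fluidPos E α rate lam p₀ T s t) '' {s | E s c})
    (fluidFront E α rate p₀ T t c)
  focus : ∀ τ s c c', 0 < τ → E s c' →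
    fluidFront E α rate p₀ T τ c' < fluidFront E α rate p₀ T τ c →
    ∀ᶠ σ in 𝓝 τ, T s c σ = T s c τ
  busy : ∀ τ s c, 0 < τ → E s c → fluidFront E α rate p₀ T τ c < lam * τ →
    ∀ᶠ σ in 𝓝 τ, ∑ c, T s c σ - ∑ c, T s c τ = σ - τ

/-- Fluid scalings of runs, whose cumulative processing times converge to `T`. -/
structure FluidScaling (E : Fin J → Fin I → Prop) (w : Sample J I) (p₀ : Fin J → ℝ) (a : ℕ → ℝ)
    (X : ℕ → ℕ → State J I) (T : Fin J → Fin I → ℝ → ℝ) : Prop where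
  run : ∀ k, IsRun E w (X k)
  nonneg : ∀ k, 0 ≤ a k
  scaled : Scaled E w p₀ a fun k => X k 0
  work : ∀ s c t, 0 ≤ t →
    Tendsto (fun k => (stateAt w (X k) (a k * t)).work s c / a k) atTop (𝓝 (T s c t))

lemma continuousOn_of_total {T : Fin J → Fin I → ℝ → ℝ}
    (hmono : ∀ s c t t', 0 ≤ t → t ≤ t' → T s c t ≤ T s c t')
    (htotal : ∀ s t t', 0 ≤ t → t ≤ t' → ∑ c, T s c t' - ∑ c, T s c t ≤ t' - t)
    (s : Fin J) (c : Fin I) : ContinuousOn (T s c) (Ici 0) := by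
  have key : ∀ t t', 0 ≤ t → t ≤ t' → |T s c t' - T s c t| ≤ t' - t := by
    intro t t' ht htt'
    rw [abs_of_nonneg (sub_nonneg.2 (hmono s c t t' ht htt'))]
    refine le_trans ?_ (htotal s t t' ht htt')
    rw [← Finset.sum_sub_distrib]
    exact Finset.single_le_sum (f := fun c => T s c t' - T s c t)
      (fun c _ => sub_nonneg.2 (hmono s c t t' ht htt')) (Finset.mem_univ c)
  have : LipschitzOnWith 1 (T s c) (Ici 0) := by
    refine LipschitzOnWith.of_dist_le_mul fun t ht t' ht' => ?_
    rw [NNReal.coe_one, one_mul, Real.dist_eq, Real.dist_eq]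
    rcases le_total t t' with h1 | h1
    · rw [abs_sub_comm, abs_sub_comm t]
      exact (key t t' ht h1).trans (le_abs_self _)
    · exact (key t' t ht' h1).trans (le_abs_self _)
  exact this.continuousOn

variable {E : Fin J → Fin I → Prop} {α : Fin I → ℝ} {rate : Fin J → Fin I → ℝ} {lam : ℝ}
  {w : Sample J I} {p₀ : Fin J → ℝ} {a : ℕ → ℝ} {X : ℕ → ℕ → State J I}
  {T : Fin J → Fin I → ℝ → ℝ}

lemma isGreatest_initialFront {c : Fin I} (hS : ∃ s, E s c) (p₀ : Fin J → ℝ) :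
    IsGreatest (p₀ '' {s | E s c}) (initialFront E p₀ c) := by
  have hfin : (p₀ '' {s | E s c}).Finite := Set.toFinite _
  have hne : (p₀ '' {s | E s c}).Nonempty := by
    obtain ⟨s, hs⟩ := hS; exact ⟨_, s, hs, rfl⟩
  exact ⟨hne.csSup_mem hfin, fun x hx => le_csSup hfin.bddAbove hx⟩

namespace FluidScaling

lemma path (hw : Regular E α rate lam w) (h : FluidScaling E w p₀ a X T) (k : ℕ) {t : ℝ}
    (ht : 0 ≤ t) : Path E w (X k 0) (stateAt w (X k) (a k * t)) ∧
      (stateAt w (X k) (a k * t)).time = a k * t :=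
  (h.run k).path_stateAt hw.toAdmissible (hw.unbounded (h.run k)) (mul_nonneg (h.nonneg k) ht)

lemma path_le (hw : Regular E α rate lam w) (h : FluidScaling E w p₀ a X T) (k : ℕ) {t t' : ℝ}
    (ht : 0 ≤ t) (htt' : t ≤ t') :
    Path E w (stateAt w (X k) (a k * t)) (stateAt w (X k) (a k * t')) :=
  (h.run k).path_stateAt_of_le hw.toAdmissible (hw.unbounded (h.run k))
    (mul_nonneg (h.nonneg k) ht) (mul_le_mul_of_nonneg_left htt' (h.nonneg k))

/-- An estimate for all small `ε` gives convergence of the fluid scaling. -/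
lemma tendsto_of_estimate (hw : Regular E α rate lam w) (h : FluidScaling E w p₀ a X T) {t : ℝ}
    (ht : 0 ≤ t) {f : ℕ → State J I → ℝ} {L : ℕ → ℝ} {l : ℝ} (hL : Tendsto L atTop (𝓝 l))
    (hf : ∀ ε > 0, EventuallyReached E w a (fun k => X k 0) t fun k y =>
      y.time = a k * t → y = stateAt w (X k) (a k * t) → |f k y - L k * a k| ≤ ε * a k) :
    Tendsto (fun k => f k (stateAt w (X k) (a k * t)) / a k) atTop (𝓝 l) := by
  have : Tendsto (fun k => f k (stateAt w (X k) (a k * t)) / a k - L k) atTop (𝓝 0) := by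
    rw [Metric.tendsto_nhds]
    intro ε hε
    filter_upwards [hf (ε / 2) (by positivity), h.scaled.eventually_pos] with k hk hak
    obtain ⟨h1, h2⟩ := h.path hw k ht
    have h3 := hk _ h1 h2.le h2 rfl
    rw [Real.dist_eq, sub_zero]
    have h4 : f k (stateAt w (X k) (a k * t)) / a k - L k
        = (f k (stateAt w (X k) (a k * t)) - L k * a k) / a k := by field_simp
    rw [h4, abs_div, abs_of_pos hak, div_lt_iff₀ hak]
    have : ε / 2 * a k < ε * a k := by nlinarith
    linarith
  simpa using this.add hL

lemma tendsto_front_zero (hw : Regular E α rate lam w) (h : FluidScaling E w p₀ a X T)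
    (c : Fin I) : Tendsto (fun k => ((X k 0).front E c : ℝ) / a k) atTop
      (𝓝 (initialFront E p₀ c)) := by
  refine tendsto_isGreatest (S := {s | E s c}) (f := fun k s => ((X k 0).pos s : ℝ) / a k)
    (fun s _ => h.scaled.pos s) ?_ (isGreatest_initialFront (hw.server c) p₀)
  filter_upwards [h.scaled.eventually_pos] with k hk
  constructor
  · obtain ⟨s, hs, hsf⟩ := exists_cutPos_eq_front (hw.server c) (X k 0)
    have h1 := h.scaled.cutPos_eq k s
    refine ⟨s, hs, ?_⟩
    simp only
    rw [← hsf, h1]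
  · rintro _ ⟨s, hs, rfl⟩
    have h1 := h.scaled.cutPos_eq k s
    have h2 := cutPos_le_front hs (X k 0)
    simp only
    rw [h1] at h2
    gcongr

lemma tendsto_front (hw : Regular E α rate lam w) (h : FluidScaling E w p₀ a X T) (c : Fin I)
    {t : ℝ} (ht : 0 ≤ t) :
    Tendsto (fun k => ((stateAt w (X k) (a k * t)).front E c : ℝ) / a k) atTop
      (𝓝 (fluidFront E α rate p₀ T t c)) := by
  refine h.tendsto_of_estimate hw ht (f := fun k y => (y.front E c : ℝ))
    (L := fun k => ((X k 0).front E c : ℝ) / a k +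
      (∑ s, rate s c * ((stateAt w (X k) (a k * t)).work s c / a k)) / α c)
    ((h.tendsto_front_zero hw c).add
      ((tendsto_finsetSum _ fun s _ => (h.work s c t ht).const_mul _).div_const _))
    fun ε hε => ?_
  filter_upwards [hw.front_work_estimate h.scaled t c hε, h.scaled.eventually_pos]
    with k hk hak y hy hyt _ he
  have h1 := hk y hy hyt
  rw [← he]
  have h2 : (((X k 0).front E c : ℝ) / a k + (∑ s, rate s c * (y.work s c / a k)) / α c) * a k
      = (X k 0).front E c + (∑ s, rate s c * y.work s c) / α c := by
    have : ∑ s, rate s c * (y.work s c / a k) = (∑ s, rate s c * y.work s c) / a k := by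
      rw [Finset.sum_div]; exact Finset.sum_congr rfl fun s _ => by ring
    rw [this]
    have := hw.α_pos c
    field_simp
  rw [h2, ← sub_sub]
  exact h1

lemma tendsto_arrived (hw : Regular E α rate lam w) (h : FluidScaling E w p₀ a X T)
    {t : ℝ} (ht : 0 ≤ t) :
    Tendsto (fun k => ((stateAt w (X k) (a k * t)).arrived : ℝ) / a k) atTop (𝓝 (lam * t)) := by
  refine h.tendsto_of_estimate hw ht (f := fun k y => (y.arrived : ℝ)) (L := fun _ => lam * t)
    tendsto_const_nhds fun ε hε => ?_
  filter_upwards [hw.arrived_estimate h.scaled t hε] with k hk y hy hyt h1 _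
  have h2 := hk y hy hyt
  rw [h1] at h2
  rw [show lam * t * a k = lam * (a k * t) by ring]
  exact h2

lemma tendsto_done (hw : Regular E α rate lam w) (h : FluidScaling E w p₀ a X T) (s : Fin J)
    (c : Fin I) {t : ℝ} (ht : 0 ≤ t) :
    Tendsto (fun k => ((stateAt w (X k) (a k * t)).done s c : ℝ) / a k) atTop
      (𝓝 (rate s c * T s c t)) := by
  refine h.tendsto_of_estimate hw ht (f := fun k y => (y.done s c : ℝ))
    (L := fun k => rate s c * ((stateAt w (X k) (a k * t)).work s c / a k))
    ((h.work s c t ht).const_mul _) fun ε hε => ?_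
  filter_upwards [hw.done_estimate h.scaled t s c hε, h.scaled.eventually_pos]
    with k hk hak y hy hyt _ he
  have h1 := hk y hy hyt
  rw [← he]
  rwa [show rate s c * (y.work s c / a k) * a k = rate s c * y.work s c by field_simp]

lemma front_le (hw : Regular E α rate lam w) (h : FluidScaling E w p₀ a X T) (c : Fin I)
    {t : ℝ} (ht : 0 ≤ t) : fluidFront E α rate p₀ T t c ≤ lam * t := by
  refine le_of_tendsto_of_tendsto' (h.tendsto_front hw c ht) (h.tendsto_arrived hw ht) fun k => ?_
  have h1 := front_le_arrived (hw.server c) (stateAt w (X k) (a k * t))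
  have := h.nonneg k
  gcongr

/-- A server is never ahead of a front that it can serve nor of the last arrival; when busy it is
hardly behind the front of the type it serves, and when idle its cut position is the last arrival.
The assumption `0 < t` ensures that the initial services are over. -/
lemma tendsto_cutPos (hw : Regular E α rate lam w) (h : FluidScaling E w p₀ a X T) (s : Fin J)
    {t : ℝ} (ht : 0 < t) :
    Tendsto (fun k => ((stateAt w (X k) (a k * t)).cutPos s : ℝ) / a k) atTop
      (𝓝 (fluidPos E α rate lam p₀ T s t)) := by
  rw [Metric.tendsto_nhds]
  intro ε hε
  set ε₁ := min (ε / 4) t with hε₁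
  have hε₁pos : 0 < ε₁ := lt_min (by positivity) ht
  have hε₁ε : ε₁ ≤ ε / 4 := min_le_left _ _
  have hε₁t : ε₁ ≤ t := min_le_right _ _
  have hfr : ∀ᶠ k in atTop, ∀ c,
      |((stateAt w (X k) (a k * t)).front E c : ℝ) / a k - fluidFront E α rate p₀ T t c| < ε₁ := by
    rw [eventually_all]
    intro c
    have := (Metric.tendsto_nhds.1 (h.tendsto_front hw c ht.le)) ε₁ hε₁pos
    simpa only [Real.dist_eq] using this
  have harr := (Metric.tendsto_nhds.1 (h.tendsto_arrived hw ht.le)) ε₁ hε₁pos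
  simp only [Real.dist_eq] at harr ⊢
  filter_upwards [hfr, harr, hw.busy_estimate h.scaled t hε₁pos, h.scaled.eventually_pos]
    with k h1 h2 h3 hk
  obtain ⟨h4, h5⟩ := h.path hw k ht.le
  have h6 := h3 _ h4 h5.le (by rw [h5, mul_comm]; exact mul_le_mul_of_nonneg_left hε₁t hk.le)
  have hsound := hw.toAdmissible.sound (h.scaled.initial k) h4
  set y := stateAt w (X k) (a k * t) with hy
  have h2' := abs_lt.1 h2
  have hlow : lowest E s (fluidLag E α rate lam p₀ T t) ≤ 0 := lowest_nonpos _ _ _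
  rw [fluidPos, abs_lt]
  constructor
  · by_cases hb : y.Busy s
    · have h7 := h6 s hb
      have h8 := hsound.compat s hb
      have h9 := lowest_le h8 (fluidLag E α rate lam p₀ T t)
      have h10 := abs_lt.1 (h1 (w.ξ (y.pos s)))
      rw [cutPos_of_busy hb]
      rw [fluidLag] at h9
      have h11 : (y.front E (w.ξ (y.pos s)) : ℝ) / a k ≤ y.pos s / a k + ε₁ := by
        rw [div_le_iff₀ hk, add_mul, div_mul_cancel₀ _ hk.ne']; exact h7
      linarith
    · rw [cutPos_of_idle hb]
      linarith
  · have h7 : (y.cutPos s : ℝ) / a k - lam * t - ε / 2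
        ≤ lowest E s (fluidLag E α rate lam p₀ T t) := by
      refine le_lowest ?_ fun c hc => ?_
      · have h8 : (y.cutPos s : ℝ) / a k ≤ y.arrived / a k := by
          have : y.cutPos s ≤ y.arrived := min_le_right _ _
          gcongr
        linarith
      · have h8 : (y.cutPos s : ℝ) / a k ≤ y.front E c / a k := by
          have := cutPos_le_front hc y
          gcongr
        have h9 := abs_lt.1 (h1 c)
        rw [fluidLag]
        linarith
    linarith

lemma tendsto_pos (hw : Regular E α rate lam w) (h : FluidScaling E w p₀ a X T) (s : Fin J)
    {t : ℝ} (ht : 0 < t) :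
    Tendsto (fun k => ((stateAt w (X k) (a k * t)).pos s : ℝ) / a k) atTop
      (𝓝 (fluidPos E α rate lam p₀ T s t)) := by
  refine h.tendsto_of_estimate hw ht.le (f := fun k y => (y.pos s : ℝ))
    (L := fun k => ((stateAt w (X k) (a k * t)).cutPos s : ℝ) / a k)
    (h.tendsto_cutPos hw s ht) fun ε hε => ?_
  filter_upwards [hw.pos_estimate h.scaled t hε, h.scaled.eventually_pos]
    with k hk hak y hy hyt _ he
  obtain ⟨h1, h2⟩ := hk y hy hyt s
  rw [← he, div_mul_cancel₀ _ hak.ne', abs_le]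
  have : 0 < ε * a k := by positivity
  constructor <;> linarith

lemma mono (hw : Regular E α rate lam w) (h : FluidScaling E w p₀ a X T) (s : Fin J) (c : Fin I)
    {t t' : ℝ} (ht : 0 ≤ t) (htt' : t ≤ t') : T s c t ≤ T s c t' := by
  refine le_of_tendsto_of_tendsto' (h.work s c t ht) (h.work s c t' (ht.trans htt')) fun k => ?_
  have := h.nonneg k
  have := (h.path_le hw k ht htt').below.work s c
  gcongr

lemma total (hw : Regular E α rate lam w) (h : FluidScaling E w p₀ a X T) (s : Fin J)
    {t t' : ℝ} (ht : 0 ≤ t) (htt' : t ≤ t') :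
    ∑ c, T s c t' - ∑ c, T s c t ≤ t' - t := by
  have ht' := ht.trans htt'
  refine le_of_tendsto ((tendsto_finsetSum _ fun c _ => h.work s c t' ht').sub
    (tendsto_finsetSum _ fun c _ => h.work s c t ht)) ?_
  filter_upwards [h.scaled.eventually_pos] with k hk
  have h1 := (h.path_le hw k ht htt').below.work_total s
  rw [(h.path hw k ht).2, (h.path hw k ht').2] at h1
  rw [← Finset.sum_div, ← Finset.sum_div, ← sub_div, div_le_iff₀ hk]
  linarith

lemma continuousOn (hw : Regular E α rate lam w) (h : FluidScaling E w p₀ a X T) (s : Fin J)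
    (c : Fin I) : ContinuousOn (T s c) (Ici 0) :=
  continuousOn_of_total (fun s c _ _ => h.mono hw s c) (fun s _ _ => h.total hw s) s c

lemma continuousOn_front (hw : Regular E α rate lam w) (h : FluidScaling E w p₀ a X T)
    (c : Fin I) : ContinuousOn (fun t => fluidFront E α rate p₀ T t c) (Ici 0) :=
  continuousOn_const.add ((continuousOn_finsetSum _ fun s _ =>
    continuousOn_const.mul (h.continuousOn hw s c)).div_const _)

/-- A level `b` separates the two fronts on a whole interval around `τ`. A server busy with `c`
there would be close to front `c`, above `b`, although it cannot be ahead of front `c'`, which is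
below `b`. Monotonicity of the fronts reduces both comparisons to the ends of the interval. -/
lemma focus (hw : Regular E α rate lam w) (h : FluidScaling E w p₀ a X T) {τ : ℝ} {s : Fin J}
    {c c' : Fin I} (hτ : 0 < τ) (hE : E s c')
    (hlt : fluidFront E α rate p₀ T τ c' < fluidFront E α rate p₀ T τ c) :
    ∀ᶠ σ in 𝓝 τ, T s c σ = T s c τ := by
  have hnhds : Ici (0:ℝ) ∈ 𝓝 τ := Ici_mem_nhds hτ
  obtain ⟨b, hb1, hb2⟩ := exists_between hlt
  have h1 : ∀ᶠ σ in 𝓝 τ, fluidFront E α rate p₀ T σ c' < b :=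
    ((h.continuousOn_front hw c').continuousAt hnhds).eventually_lt_const hb1
  have h2 : ∀ᶠ σ in 𝓝 τ, b < fluidFront E α rate p₀ T σ c :=
    ((h.continuousOn_front hw c).continuousAt hnhds).eventually_const_lt hb2
  obtain ⟨δ, hδ, hball⟩ := Metric.eventually_nhds_iff_ball.1 (h1.and (h2.and (Ioi_mem_nhds hτ)))
  set t₁ := τ - δ / 2 with ht₁
  set t₂ := τ + δ / 2 with ht₂
  have hm₁ : t₁ ∈ Metric.ball τ δ := by
    rw [Metric.mem_ball, Real.dist_eq, abs_lt]; constructor <;> linarith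
  have hm₂ : t₂ ∈ Metric.ball τ δ := by
    rw [Metric.mem_ball, Real.dist_eq, abs_lt]; constructor <;> linarith
  have hq₂ := (hball _ hm₂).1
  have hq₁ := (hball _ hm₁).2.1
  have ht₁0 : 0 < t₁ := (hball _ hm₁).2.2
  have ht₂0 : 0 < t₂ := (hball _ hm₂).2.2
  have ht₁₂ : t₁ ≤ t₂ := by linarith
  have hconst : T s c t₂ = T s c t₁ := by
    refine tendsto_nhds_unique_of_eventuallyEq (h.work s c t₂ ht₂0.le) (h.work s c t₁ ht₁0.le) ?_
    set ε := min ((fluidFront E α rate p₀ T t₁ c - b) / 2) t₁ with hεdef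
    have hε : 0 < ε := lt_min (by linarith) ht₁0
    have hε1 : ε ≤ (fluidFront E α rate p₀ T t₁ c - b) / 2 := min_le_left _ _
    have hε2 : ε ≤ t₁ := min_le_right _ _
    filter_upwards [(h.tendsto_front hw c' ht₂0.le).eventually_lt_const hq₂,
      (h.tendsto_front hw c ht₁0.le).eventually_const_lt
        (show fluidFront E α rate p₀ T t₁ c - ε < _ by linarith),
      hw.busy_estimate h.scaled t₂ hε, h.scaled.eventually_pos] with k k1 k2 k3 hk
    rcases (h.path_le hw k ht₁0.le ht₁₂).exists_serving s c with h5 | ⟨z, h5, h6, h7, h8⟩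
    · rw [h5]
    exfalso
    have hz1 := h5.below.time
    have hz2 := h6.below.time
    rw [(h.path hw k ht₁0.le).2] at hz1
    rw [(h.path hw k ht₂0.le).2] at hz2
    have h9 := k3 z ((h.path hw k ht₁0.le).1.trans h5) hz2
      (le_trans (by rw [mul_comm]; exact mul_le_mul_of_nonneg_left hε2 hk.le) hz1) s h7
    rw [h8] at h9
    have h10 : (z.pos s : ℝ) ≤ z.front E c' := by
      have := cutPos_le_front hE z
      rw [cutPos_of_busy h7] at this
      exact_mod_cast this
    have h11 : (z.front E c' : ℝ) ≤ (stateAt w (X k) (a k * t₂)).front E c' := by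
      exact_mod_cast front_mono (hw.server c') h6.below.cutPos
    have h12 : ((stateAt w (X k) (a k * t₁)).front E c : ℝ) ≤ z.front E c := by
      exact_mod_cast front_mono (hw.server c) h5.below.cutPos
    rw [div_lt_iff₀ hk] at k1
    rw [lt_div_iff₀ hk] at k2
    nlinarith
  -- Equal values of a nondecreasing function at `t₁` and `t₂` leave it constant between them, hence
  -- on both sides of `τ`.
  filter_upwards [Icc_mem_nhds (show t₁ < τ by linarith) (show τ < t₂ by linarith)] with σ hσ
  have e1 := h.mono hw s c ht₁0.le hσ.1
  have e2 := h.mono hw s c (ht₁0.le.trans hσ.1) hσ.2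
  have e3 := h.mono hw s c ht₁0.le (show t₁ ≤ τ by linarith)
  have e4 := h.mono hw s c hτ.le (show τ ≤ t₂ by linarith)
  linarith

/-- An idle server compatible with `c` would put front `c` at the last arrival, but near `τ` a level
`b` lies strictly between them. Full work over the whole interval forces full work over its parts,
as no part can exceed its length. -/
lemma busy (hw : Regular E α rate lam w) (h : FluidScaling E w p₀ a X T) {τ : ℝ} {s : Fin J}
    {c : Fin I} (hτ : 0 < τ) (hE : E s c)
    (hlt : fluidFront E α rate p₀ T τ c < lam * τ) :
    ∀ᶠ σ in 𝓝 τ, ∑ c, T s c σ - ∑ c, T s c τ = σ - τ := by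
  have hnhds : Ici (0:ℝ) ∈ 𝓝 τ := Ici_mem_nhds hτ
  obtain ⟨b, hb1, hb2⟩ := exists_between hlt
  have h1 : ∀ᶠ σ in 𝓝 τ, fluidFront E α rate p₀ T σ c < b :=
    ((h.continuousOn_front hw c).continuousAt hnhds).eventually_lt_const hb1
  have h2 : ∀ᶠ σ in 𝓝 τ, b < lam * σ :=
    (continuous_const.mul continuous_id).continuousAt.eventually_const_lt hb2
  obtain ⟨δ, hδ, hball⟩ := Metric.eventually_nhds_iff_ball.1 (h1.and (h2.and (Ioi_mem_nhds hτ)))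
  set t₁ := τ - δ / 2 with ht₁
  set t₂ := τ + δ / 2 with ht₂
  have hm₁ : t₁ ∈ Metric.ball τ δ := by
    rw [Metric.mem_ball, Real.dist_eq, abs_lt]; constructor <;> linarith
  have hm₂ : t₂ ∈ Metric.ball τ δ := by
    rw [Metric.mem_ball, Real.dist_eq, abs_lt]; constructor <;> linarith
  have hq₂ := (hball _ hm₂).1
  have hq₁ := (hball _ hm₁).2.1
  have ht₁0 : 0 < t₁ := (hball _ hm₁).2.2
  have ht₂0 : 0 < t₂ := (hball _ hm₂).2.2
  have ht₁₂ : t₁ ≤ t₂ := by linarith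
  have hfull : ∑ c, T s c t₂ - ∑ c, T s c t₁ = t₂ - t₁ := by
    refine tendsto_nhds_unique_of_eventuallyEq
      ((tendsto_finsetSum _ fun c _ => h.work s c t₂ ht₂0.le).sub
        (tendsto_finsetSum _ fun c _ => h.work s c t₁ ht₁0.le)) tendsto_const_nhds ?_
    filter_upwards [(h.tendsto_front hw c ht₂0.le).eventually_lt_const hq₂,
      (h.tendsto_arrived hw ht₁0.le).eventually_const_lt hq₁, h.scaled.eventually_pos]
      with k k1 k2 hk
    rw [← Finset.sum_div, ← Finset.sum_div, ← sub_div, div_eq_iff hk.ne']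
    rcases (h.path_le hw k ht₁0.le ht₁₂).exists_idle s with h5 | ⟨z, h5, h6, h7⟩
    · rw [h5, (h.path hw k ht₁0.le).2, (h.path hw k ht₂0.le).2]; ring
    exfalso
    have h10 : (z.arrived : ℝ) ≤ z.front E c := by
      have := cutPos_le_front hE z
      rw [cutPos_of_idle h7] at this
      exact_mod_cast this
    have h11 : (z.front E c : ℝ) ≤ (stateAt w (X k) (a k * t₂)).front E c := by
      exact_mod_cast front_mono (hw.server c) h6.below.cutPos
    have h12 : ((stateAt w (X k) (a k * t₁)).arrived : ℝ) ≤ z.arrived := by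
      exact_mod_cast h5.below.arrived
    rw [div_lt_iff₀ hk] at k1
    rw [lt_div_iff₀ hk] at k2
    linarith
  filter_upwards [Icc_mem_nhds (show t₁ < τ by linarith) (show τ < t₂ by linarith)] with σ hσ
  have e1 := h.total hw s ht₁0.le hσ.1
  have e2 := h.total hw s (ht₁0.le.trans hσ.1) hσ.2
  have e3 := h.total hw s ht₁0.le (show t₁ ≤ τ by linarith)
  have e4 := h.total hw s hτ.le (show τ ≤ t₂ by linarith)
  linarith

lemma fluidPath (hw : Regular E α rate lam w) (h : FluidScaling E w p₀ a X T) :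
    FluidPath E α rate lam p₀ T where
  zero s c := by
    refine tendsto_nhds_unique (h.work s c 0 le_rfl) ?_
    have : ∀ k, (stateAt w (X k) (a k * 0)).work s c / a k = 0 := by
      intro k
      obtain ⟨h1, h2⟩ := h.path hw k le_rfl
      have h3 := h.scaled.work_bounds h1 s c
      rw [h2, mul_zero] at h3
      rw [mul_zero]
      rw [le_antisymm h3.2 h3.1, zero_div]
    simp only [this, tendsto_const_nhds_iff]
  supp s c t ht hE := by
    refine tendsto_nhds_unique (h.work s c t ht) ?_
    have : ∀ k, (stateAt w (X k) (a k * t)).work s c / a k = 0 := by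
      intro k
      rw [((hw.toAdmissible.ledger (h.scaled.initial k) (h.path hw k ht).1).off s c hE).2, zero_div]
    simp only [this, tendsto_const_nhds_iff]
  mono s c t t' ht htt' := h.mono hw s c ht htt'
  total s t t' ht htt' := h.total hw s ht htt'
  front_le t c ht := h.front_le hw c ht
  greatest t c ht := by
    have hfin : ((fun s => fluidPos E α rate lam p₀ T s t) '' {s | E s c}).Finite := Set.toFinite _
    have hne : ((fun s => fluidPos E α rate lam p₀ T s t) '' {s | E s c}).Nonempty := by
      obtain ⟨s, hs⟩ := hw.server c; exact ⟨_, s, hs, rfl⟩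
    have hgr : IsGreatest ((fun s => fluidPos E α rate lam p₀ T s t) '' {s | E s c})
        (sSup ((fun s => fluidPos E α rate lam p₀ T s t) '' {s | E s c})) :=
      ⟨hne.csSup_mem hfin, fun x hx => le_csSup hfin.bddAbove hx⟩
    have heq := tendsto_nhds_unique (h.tendsto_front hw c ht.le)
      (tendsto_isGreatest (S := {s | E s c})
        (f := fun k s => ((stateAt w (X k) (a k * t)).cutPos s : ℝ) / a k)
        (fun s _ => h.tendsto_cutPos hw s ht) (by
          filter_upwards [h.scaled.eventually_pos] with k hk
          constructor
          · obtain ⟨s, hs, hsf⟩ := exists_cutPos_eq_front (hw.server c)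
              (stateAt w (X k) (a k * t))
            refine ⟨s, hs, ?_⟩
            simp only
            rw [← hsf]
          · rintro _ ⟨s, hs, rfl⟩
            have h2 := cutPos_le_front hs (stateAt w (X k) (a k * t))
            simp only
            gcongr) hgr)
    rw [heq]
    exact hgr
  focus τ s c c' hτ hE hlt := h.focus hw hτ hE hlt
  busy τ s c hτ hE hlt := h.busy hw hτ hE hlt

end FluidScaling

end Fluid

/-! ### Properties of fluid limits -/

section FluidPath

variable {J I : ℕ}

open State

variable {E : Fin J → Fin I → Prop} {α : Fin I → ℝ} {rate : Fin J → Fin I → ℝ} {lam : ℝ}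
  {w : Sample J I} {p₀ : Fin J → ℝ} {a : ℕ → ℝ} {X : ℕ → ℕ → State J I}
  {T T' : Fin J → Fin I → ℝ → ℝ}

namespace FluidPath

lemma continuousOn (h : FluidPath E α rate lam p₀ T) (s : Fin J) (c : Fin I) :
    ContinuousOn (T s c) (Ici 0) :=
  continuousOn_of_total h.mono h.total s c

lemma continuousOn_front (h : FluidPath E α rate lam p₀ T) (c : Fin I) :
    ContinuousOn (fun t => fluidFront E α rate p₀ T t c) (Ici 0) :=
  continuousOn_const.add
    ((continuousOn_finsetSum _ fun s _ => continuousOn_const.mul (h.continuousOn s c)).div_const _)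

lemma continuousOn_lag (h : FluidPath E α rate lam p₀ T) :
    ContinuousOn (fluidLag E α rate lam p₀ T) (Ici 0) :=
  continuousOn_pi.2 fun c =>
    (h.continuousOn_front c).sub (continuousOn_const.mul continuousOn_id)

lemma continuousOn_pos (h : FluidPath E α rate lam p₀ T) (s : Fin J) :
    ContinuousOn (fluidPos E α rate lam p₀ T s) (Ici 0) :=
  (continuousOn_const.mul continuousOn_id).add
    ((continuous_lowest E s).comp_continuousOn h.continuousOn_lag)

lemma lag_nonpos (h : FluidPath E α rate lam p₀ T) {t : ℝ} (ht : 0 ≤ t) (c : Fin I) :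
    fluidLag E α rate lam p₀ T t c ≤ 0 :=
  sub_nonpos.2 (h.front_le t c ht)

lemma lag_zero (h : FluidPath E α rate lam p₀ T) (c : Fin I) :
    fluidLag E α rate lam p₀ T 0 c = initialFront E p₀ c := by
  simp [fluidLag, fluidFront, h.zero]

lemma front_sub (h : FluidPath E α rate lam p₀ T) {b : Fin J → ℝ} {k : Fin I → ℝ}
    (hW : Weights E α rate b k) {τ σ : ℝ} (hτ : 0 ≤ τ) (hσ : 0 ≤ σ) (c : Fin I) :
    fluidFront E α rate p₀ T σ c - fluidFront E α rate p₀ T τ c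
      = (∑ s, b s * (T s c σ - T s c τ)) / k c := by
  have hα := hW.α_pos c
  have hk := hW.w_pos c
  rw [fluidFront, fluidFront, add_sub_add_left_eq_sub, ← sub_div, ← Finset.sum_sub_distrib,
    div_eq_div_iff hα.ne' hk.ne', Finset.sum_mul, Finset.sum_mul]
  refine Finset.sum_congr rfl fun s _ => ?_
  by_cases hE : E s c
  · have := hW.factor s c hE
    linear_combination (T s c σ - T s c τ) * this
  · rw [h.supp s c σ hσ hE, h.supp s c τ hτ hE]; ring

/-- The increments of the processing times after `τ` form an allocation at the lags of time `τ`,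
because `focus` and `busy` hold on a whole neighbourhood. Working with increments avoids
differentiability of `T`. -/
lemma flow (h : FluidPath E α rate lam p₀ T) {b : Fin J → ℝ} {k : Fin I → ℝ}
    (hW : Weights E α rate b k) (t₂ : ℝ) :
    Flow E b k lam (fluidLag E α rate lam p₀ T) 0 t₂ where
  cont := h.continuousOn_lag.mono Icc_subset_Ici_self
  rule τ hτ := by
    have hτ0 := hτ.1
    have hfocus : ∀ᶠ σ in 𝓝 τ, ∀ s c c', E s c' →
        fluidFront E α rate p₀ T τ c' < fluidFront E α rate p₀ T τ c → T s c σ = T s c τ := by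
      simp only [eventually_all]
      intro s c c' hE hlt
      exact h.focus τ s c c' hτ0 hE hlt
    have hbusy : ∀ᶠ σ in 𝓝 τ, ∀ s c, E s c → fluidFront E α rate p₀ T τ c < lam * τ →
        ∑ c, T s c σ - ∑ c, T s c τ = σ - τ := by
      simp only [eventually_all]
      intro s c hE hlt
      exact h.busy τ s c hτ0 hE hlt
    filter_upwards [nhdsWithin_le_nhds hfocus, nhdsWithin_le_nhds hbusy, self_mem_nhdsWithin]
      with σ h1 h2 hσ
    have hσ : τ < σ := hσ
    have hσ0 : 0 ≤ σ := hτ0.le.trans hσ.le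
    refine ⟨fun s c => T s c σ - T s c τ,
      { nonneg := fun s c => sub_nonneg.2 (h.mono s c τ σ hτ0.le hσ.le)
        supp := fun s c hE => by rw [h.supp s c σ hσ0 hE, h.supp s c τ hτ0.le hE, sub_zero]
        total := fun s => by
          rw [Finset.sum_sub_distrib]; exact h.total s τ σ hτ0.le hσ.le
        first := fun s c c' hE hlt => by
          refine sub_eq_zero.2 (h1 s c c' hE ?_)
          simp only [fluidLag] at hlt
          linarith
        nonpos := fun s c hpos => absurd hpos (not_lt.2 (h.lag_nonpos hτ0.le c))
        busy := fun s c hE hlt => by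
          rw [Finset.sum_sub_distrib]
          refine h2 s c hE ?_
          simp only [fluidLag] at hlt
          linarith }, fun c => ?_⟩
    rw [← h.front_sub hW hτ0.le hσ0 c, fluidLag, fluidLag]
    ring

lemma lag_unique (h : FluidPath E α rate lam p₀ T) (h' : FluidPath E α rate lam p₀ T')
    {b : Fin J → ℝ} {k : Fin I → ℝ} (hW : Weights E α rate b k) {t : ℝ} (ht : 0 ≤ t) :
    fluidLag E α rate lam p₀ T t = fluidLag E α rate lam p₀ T' t :=
  (h.flow hW t).unique hW.a_pos hW.w_pos (h'.flow hW t)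
    (funext fun c => by rw [h.lag_zero, h'.lag_zero]) t ⟨ht, le_rfl⟩

lemma pos_unique (h : FluidPath E α rate lam p₀ T) (h' : FluidPath E α rate lam p₀ T')
    {b : Fin J → ℝ} {k : Fin I → ℝ} (hW : Weights E α rate b k) (s : Fin J) {t : ℝ} (ht : 0 ≤ t) :
    fluidPos E α rate lam p₀ T s t = fluidPos E α rate lam p₀ T' s t := by
  rw [fluidPos, fluidPos, h.lag_unique h' hW ht]

/-- The positions are piecewise linear. -/
lemma piecewiseLinear_pos (h : FluidPath E α rate lam p₀ T) {b : Fin J → ℝ} {k : Fin I → ℝ}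
    (hW : Weights E α rate b k) (s : Fin J) :
    PiecewiseLinear (fluidPos E α rate lam p₀ T s) := by
  -- At each time the server follows the front of one of its types or the last arrival. The latter
  -- is represented by the additional pair `(0, lam)`.
  obtain ⟨A, hA, hsel⟩ := Flow.exists_finite_affine hW.a_pos hW.w_pos (h.flow hW)
  refine piecewiseLinear_of_finite_affine
    (A := insert (0, lam) (⋃ c, (fun p : (Fin I → ℝ) × (Fin I → ℝ) => (p.1 c, p.2 c + lam)) '' A))
    ((h.continuousOn_pos s).mono Ioi_subset_Ici_self) ?_ fun t ht => ?_
  · exact (Set.finite_iUnion fun c => hA.image _).insert _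
  · obtain ⟨p, hp, hpt⟩ := hsel t (le_of_lt ht)
    by_cases hex : ∃ c, E s c ∧ fluidLag E α rate lam p₀ T t c
        ≤ lowest E s (fluidLag E α rate lam p₀ T t)
    · obtain ⟨c, hc, hle⟩ := hex
      have heq := le_antisymm (lowest_le hc _) hle
      refine ⟨_, Set.mem_insert_of_mem _ (Set.mem_iUnion.2 ⟨c, p, hp, rfl⟩), ?_⟩
      rw [fluidPos, heq, hpt]
      simp; ring
    · push Not at hex
      refine ⟨_, Set.mem_insert _ _, ?_⟩
      have hle : lowest E s (fluidLag E α rate lam p₀ T t) ≤ 0 := lowest_nonpos _ _ _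
      have : lowest E s (fluidLag E α rate lam p₀ T t) = 0 := by
        by_contra hne
        have hlt : lowest E s (fluidLag E α rate lam p₀ T t) < 0 := lt_of_le_of_ne hle hne
        classical
        obtain ⟨m, hm1, hm2, hm3⟩ : ∃ m, lowest E s (fluidLag E α rate lam p₀ T t) < m ∧ m ≤ 0 ∧
            ∀ c, E s c → m ≤ fluidLag E α rate lam p₀ T t c := by
          have hev : ∀ᶠ m in 𝓝[>] (lowest E s (fluidLag E α rate lam p₀ T t)),
              ∀ c, E s c → m ≤ fluidLag E α rate lam p₀ T t c := by
            simp only [eventually_all]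
            exact fun c hc => nhdsWithin_le_nhds (Iic_mem_nhds (hex c hc))
          have hev' : ∀ᶠ m in 𝓝[>] (lowest E s (fluidLag E α rate lam p₀ T t)), m ≤ 0 :=
            nhdsWithin_le_nhds (Iic_mem_nhds hlt)
          obtain ⟨m, k1, k2, k3⟩ := (hev.and (hev'.and self_mem_nhdsWithin)).exists
          exact ⟨m, k3, k2, k1⟩
        linarith [le_lowest hm2 hm3]
      rw [fluidPos, this]; ring

lemma pos_le (h : E s c) (t : ℝ) :
    fluidPos E α rate lam p₀ T s t ≤ fluidFront E α rate p₀ T t c := by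
  have := lowest_le h (fluidLag E α rate lam p₀ T t)
  rw [fluidPos]
  simp only [fluidLag] at this ⊢
  linarith

lemma le_pos (h : FluidPath E α rate lam p₀ T) {s : Fin J} (hs : ∃ c, E s c) {t m : ℝ}
    (ht : 0 ≤ t) (hm : ∀ c, E s c → m ≤ fluidFront E α rate p₀ T t c) :
    m ≤ fluidPos E α rate lam p₀ T s t := by
  obtain ⟨c, hc⟩ := hs
  have : m - lam * t ≤ lowest E s (fluidLag E α rate lam p₀ T t) := by
    refine le_lowest ?_ fun c hc => ?_
    · linarith [hm c hc, h.front_le t c ht]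
    · rw [fluidLag]; linarith [hm c hc]
  rw [fluidPos]; linarith

/-- Since the fronts never pass the last arrival, the cap at zero in `lowest` is immaterial for a
server with a compatible type. -/
lemma exists_pos_eq (h : FluidPath E α rate lam p₀ T) {s : Fin J} (hs : ∃ c, E s c) {t : ℝ}
    (ht : 0 ≤ t) : ∃ c, E s c ∧ fluidPos E α rate lam p₀ T s t = fluidFront E α rate p₀ T t c := by
  have hfin : (fluidFront E α rate p₀ T t '' {c | E s c}).Finite := Set.toFinite _
  have hne : (fluidFront E α rate p₀ T t '' {c | E s c}).Nonempty := by
    obtain ⟨c, hc⟩ := hs; exact ⟨_, c, hc, rfl⟩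
  obtain ⟨c, hc, hceq⟩ := hne.csInf_mem hfin
  refine ⟨c, hc, le_antisymm (pos_le hc t) (h.le_pos hs ht fun c' hc' => ?_)⟩
  rw [hceq]
  exact csInf_le hfin.bddBelow ⟨c', hc', rfl⟩

end FluidPath

lemma UnifOnCompacts.tendsto {f : ℕ → ℝ → ℝ} {g : ℝ → ℝ} {A : Set ℝ} (h : UnifOnCompacts f g A)
    {t : ℝ} (ht : t ∈ A) : Tendsto (fun k => f k t) atTop (𝓝 (g t)) :=
  (h {t} (Set.singleton_subset_iff.2 ht) isCompact_singleton).tendsto_at rfl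

/-- A pointwise limit of monotone functions is locally uniform if it is continuous. -/
lemma unifOnCompacts_of_monotoneOn {f : ℕ → ℝ → ℝ} {g : ℝ → ℝ} {A : Set ℝ} (hA : A.OrdConnected)
    (hf : ∀ k, MonotoneOn (f k) A) (hg : ContinuousOn g A)
    (h : ∀ t ∈ A, Tendsto (fun k => f k t) atTop (𝓝 (g t))) : UnifOnCompacts f g A := by
  intro K hKA hK
  rcases K.eq_empty_or_nonempty with rfl | hne
  · exact tendstoUniformlyOn_empty
  obtain ⟨m, hm, hmK⟩ := hK.exists_isLeast hne
  obtain ⟨M, hM, hMK⟩ := hK.exists_isGreatest hne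
  have hsub : Icc m M ⊆ A := hA.out (hKA hm) (hKA hM)
  refine TendstoUniformlyOn.mono (s := Icc m M) ?_ fun x hx => ⟨hmK hx, hMK hx⟩
  rw [← tendstoLocallyUniformlyOn_iff_tendstoUniformlyOn_of_compact isCompact_Icc,
    Metric.tendstoLocallyUniformlyOn_iff]
  intro ε hε x hx
  have hcont := Metric.continuousOn_iff.1 (hg.mono hsub) x hx (ε / 4) (by positivity)
  obtain ⟨δ, hδ, hball⟩ := hcont
  -- On `[l, r]` the limit varies by less than `ε / 4` from its value at `x`; monotonicity squeezes
  -- `f k` between its values at `l` and `r`, where it converges.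
  set l := max m (x - δ / 2) with hl
  set r := min M (x + δ / 2) with hr
  have hlx : l ≤ x := max_le hx.1 (by linarith)
  have hxr : x ≤ r := le_min hx.2 (by linarith)
  have hlm : l ∈ Icc m M := ⟨le_max_left _ _, hlx.trans hx.2⟩
  have hrm : r ∈ Icc m M := ⟨hx.1.trans hxr, min_le_left _ _⟩
  have hclose : ∀ y ∈ Icc l r, |g y - g x| < ε / 4 := by
    intro y hy
    have h1 : x - δ / 2 ≤ y := (le_max_right _ _).trans hy.1
    have h2 : y ≤ x + δ / 2 := hy.2.trans (min_le_right _ _)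
    have := hball y ⟨hlm.1.trans hy.1, hy.2.trans hrm.2⟩ (by
      rw [Real.dist_eq, abs_lt]; constructor <;> linarith)
    rwa [Real.dist_eq] at this
  refine ⟨Icc l r, ?_, ?_⟩
  · filter_upwards [self_mem_nhdsWithin,
      nhdsWithin_le_nhds (Icc_mem_nhds (show x - δ / 2 < x by linarith)
        (show x < x + δ / 2 by linarith))] with y hy1 hy2
    exact ⟨max_le hy1.1 hy2.1, le_min hy1.2 hy2.2⟩
  · have k1 := (Metric.tendsto_nhds.1 (h l (hsub hlm))) (ε / 4) (by positivity)
    have k2 := (Metric.tendsto_nhds.1 (h r (hsub hrm))) (ε / 4) (by positivity)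
    simp only [Real.dist_eq] at k1 k2
    filter_upwards [k1, k2] with k k1 k2 y hy
    have hyA : y ∈ A := hsub ⟨hlm.1.trans hy.1, hy.2.trans hrm.2⟩
    have e1 := hf k (hsub hlm) hyA hy.1
    have e2 := hf k hyA (hsub hrm) hy.2
    have e3 := abs_lt.1 (hclose y hy)
    have e4 := abs_lt.1 (hclose l ⟨le_rfl, hlx.trans hxr⟩)
    have e5 := abs_lt.1 (hclose r ⟨hlx.trans hxr, le_rfl⟩)
    have e6 := abs_lt.1 k1
    have e7 := abs_lt.1 k2
    rw [Real.dist_eq, abs_lt]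
    constructor <;> linarith

/-- Fluid limits are limits of fluid scalings. -/
lemma IsFluidLimit.exists_scaling (hw : Regular E α rate lam w) {P : Fin J → ℝ → ℝ}
    {D : Fin J → Fin I → ℝ → ℝ} (h : IsFluidLimit E w p₀ P T D) :
    FluidPath E α rate lam p₀ T ∧
      (∀ s t, 0 < t → P s t = fluidPos E α rate lam p₀ T s t) ∧
      ∀ s c t, 0 ≤ t → D s c t = rate s c * T s c t := by
  obtain ⟨-, X, hrun, hpos, hna, hres, r, hr, hP, hT, hD⟩ := h
  have hsc : FluidScaling E w p₀ (fun k => (r k : ℝ)) (fun k => X (r k)) T :=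
    { run := fun k => hrun _
      nonneg := fun k => Nat.cast_nonneg _
      scaled :=
        { scale := tendsto_natCast_atTop_atTop.comp hr.tendsto_atTop
          initial := fun k => (hrun _).initial
          pos := fun s => (hpos s).comp hr.tendsto_atTop
          nextArrival := hna.comp hr.tendsto_atTop
          residual := fun s => (hres s).comp hr.tendsto_atTop }
      work := fun s c t ht => (hT s c).tendsto ht }
  exact ⟨hsc.fluidPath hw,
    fun s t ht => tendsto_nhds_unique ((hP s).tendsto ht) (hsc.tendsto_pos hw s ht),
    fun s c t ht => tendsto_nhds_unique ((hD s c).tendsto ht) (hsc.tendsto_done hw s c ht)⟩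

end FluidPath

/-! ### Existence of fluid limits -/

section Existence

variable {J I : ℕ}

open State

variable {E : Fin J → Fin I → Prop} {α : Fin I → ℝ} {rate : Fin J → Fin I → ℝ} {lam : ℝ}
  {w : Sample J I} {p₀ : Fin J → ℝ} {a : ℕ → ℝ} {X : ℕ → ℕ → State J I}
  {T : Fin J → Fin I → ℝ → ℝ}

namespace FluidScaling

lemma unif_work (hw : Regular E α rate lam w) (h : FluidScaling E w p₀ a X T) (s : Fin J)
    (c : Fin I) :
    UnifOnCompacts (fun k t => (stateAt w (X k) (a k * t)).work s c / a k) (T s c) (Ici 0) :=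
  unifOnCompacts_of_monotoneOn ordConnected_Ici
    (fun k t ht t' _ htt' => by
      have := h.nonneg k
      have := (h.path_le hw k ht htt').below.work s c
      gcongr)
    (h.continuousOn hw s c) fun t ht => h.work s c t ht

lemma unif_done (hw : Regular E α rate lam w) (h : FluidScaling E w p₀ a X T) (s : Fin J)
    (c : Fin I) :
    UnifOnCompacts (fun k t => ((stateAt w (X k) (a k * t)).done s c : ℝ) / a k)
      (fun t => rate s c * T s c t) (Ici 0) :=
  unifOnCompacts_of_monotoneOn ordConnected_Ici
    (fun k t ht t' _ htt' => by
      have := h.nonneg k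
      have := (h.path_le hw k ht htt').below.done s c
      gcongr)
    (continuousOn_const.mul (h.continuousOn hw s c)) fun t ht => h.tendsto_done hw s c ht

/-- Positions need not be monotone in time, so uniformity is first obtained for the cut positions
and then transferred by `pos_estimate`. -/
lemma unif_pos (hw : Regular E α rate lam w) (h : FluidScaling E w p₀ a X T) (s : Fin J) :
    UnifOnCompacts (fun k t => ((stateAt w (X k) (a k * t)).pos s : ℝ) / a k)
      (fluidPos E α rate lam p₀ T s) (Ioi 0) := by
  have hcut : UnifOnCompacts (fun k t => ((stateAt w (X k) (a k * t)).cutPos s : ℝ) / a k)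
      (fluidPos E α rate lam p₀ T s) (Ioi 0) :=
    unifOnCompacts_of_monotoneOn ordConnected_Ioi
      (fun k t ht t' _ htt' => by
        have := h.nonneg k
        have := (h.path_le hw k (le_of_lt ht) htt').below.cutPos s
        gcongr)
      (((h.fluidPath hw).continuousOn_pos s).mono Ioi_subset_Ici_self)
      fun t ht => h.tendsto_cutPos hw s ht
  intro K hKA hK
  have h1 := hcut K hKA hK
  rw [Metric.tendstoUniformlyOn_iff] at h1 ⊢
  intro ε hε
  obtain ⟨B, hB⟩ := hK.bddAbove
  filter_upwards [h1 (ε / 2) (by positivity),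
    hw.pos_estimate h.scaled B (show 0 < ε / 4 by positivity), h.scaled.eventually_pos]
    with k h2 h3 hk t ht
  have ht0 : 0 < t := hKA ht
  obtain ⟨h4, h5⟩ := h.path hw k ht0.le
  obtain ⟨h6, h7⟩ := h3 _ h4 (by rw [h5]; exact mul_le_mul_of_nonneg_left (hB ht) hk.le) s
  have h8 := h2 t ht
  rw [Real.dist_eq, abs_lt] at h8 ⊢
  have h9 : ((stateAt w (X k) (a k * t)).cutPos s : ℝ) / a k
      ≤ ((stateAt w (X k) (a k * t)).pos s : ℝ) / a k := by gcongr
  have h10 : ((stateAt w (X k) (a k * t)).pos s : ℝ) / a k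
      ≤ ((stateAt w (X k) (a k * t)).cutPos s : ℝ) / a k + ε / 4 := by
    rw [div_le_iff₀ hk, add_mul, div_mul_cancel₀ _ hk.ne']; exact h7
  constructor <;> linarith

end FluidScaling

/-- Fluid scalings converge along a subsequence. -/
lemma exists_fluidScaling (hw : Regular E α rate lam w) (hrun : ∀ k, IsRun E w (X k))
    (ha : ∀ k, 0 ≤ a k) (hsc : Scaled E w p₀ a fun k => X k 0) :
    ∃ φ : ℕ → ℕ, StrictMono φ ∧ ∃ T, FluidScaling E w p₀ (a ∘ φ) (X ∘ φ) T := by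
  have hpath : ∀ k t, 0 ≤ t → Path E w (X k 0) (stateAt w (X k) (a k * t)) ∧
      (stateAt w (X k) (a k * t)).time = a k * t := fun k t ht =>
    (hrun k).path_stateAt hw.toAdmissible (hw.unbounded (hrun k)) (mul_nonneg (ha k) ht)
  -- Compactness of a countable product gives convergence at all non-negative rational times along
  -- one subsequence; negative rationals are truncated to zero. As the scaled work grows at rate at
  -- most one, it is then Cauchy at every real time.
  set f : ℕ → (Fin J × Fin I × ℚ) → ℝ := fun k e =>
    (stateAt w (X k) (a k * max (e.2.2 : ℝ) 0)).work e.1 e.2.1 / a k with hf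
  have hmem : ∀ k, f k ∈ Set.pi Set.univ fun e : Fin J × Fin I × ℚ =>
      Icc (0:ℝ) (max (e.2.2 : ℝ) 0) := by
    intro k e _
    obtain ⟨h1, h2⟩ := hpath k _ (le_max_right (e.2.2 : ℝ) 0)
    obtain ⟨h3, h4⟩ := hsc.work_bounds h1 e.1 e.2.1
    rw [h2] at h4
    refine ⟨div_nonneg h3 (ha k), div_le_of_le_mul₀ (ha k) (le_max_right _ _) ?_⟩
    exact h4.trans_eq (mul_comm _ _)
  obtain ⟨L, -, φ, hφ, hL⟩ :=
    (isCompact_univ_pi fun e : Fin J × Fin I × ℚ => isCompact_Icc).tendsto_subseq hmem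
  rw [tendsto_pi_nhds] at hL
  have hlim : ∀ s c t, 0 ≤ t → ∃ l, Tendsto (fun k =>
      (stateAt w (X (φ k)) (a (φ k) * t)).work s c / a (φ k)) atTop (𝓝 l) := by
    intro s c t ht
    refine cauchySeq_tendsto_of_complete (Metric.cauchySeq_iff'.2 fun ε hε => ?_)
    obtain ⟨q, hq1, hq2⟩ := exists_rat_btwn (show t < t + ε / 8 by linarith)
    have hq0 : (0:ℝ) ≤ q := ht.trans hq1.le
    have h1 : ∀ᶠ k in atTop, |(stateAt w (X (φ k)) (a (φ k) * q)).work s c / a (φ k)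
        - L (s, c, q)| < ε / 8 := by
      have := (Metric.tendsto_nhds.1 (hL (s, c, q))) (ε / 8) (by positivity)
      simp only [hf, Function.comp_apply, max_eq_left hq0, Real.dist_eq] at this
      exact this
    have h2 : ∀ᶠ k in atTop, 0 < a (φ k) := hφ.tendsto_atTop.eventually hsc.eventually_pos
    have h3 : ∀ᶠ k in atTop, |(stateAt w (X (φ k)) (a (φ k) * t)).work s c / a (φ k)
        - L (s, c, q)| < ε / 4 := by
      filter_upwards [h1, h2] with k h1 h2
      have hbel := ((hrun (φ k)).path_stateAt_of_le hw.toAdmissible (hw.unbounded (hrun (φ k)))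
        (mul_nonneg (ha (φ k)) ht) (mul_le_mul_of_nonneg_left hq1.le (ha (φ k)))).below
      have h4 := hbel.work s c
      have h5 := hbel.work_le s c
      rw [(hpath (φ k) q hq0).2, (hpath (φ k) t ht).2] at h5
      have h6 : (stateAt w (X (φ k)) (a (φ k) * t)).work s c / a (φ k)
          ≤ (stateAt w (X (φ k)) (a (φ k) * q)).work s c / a (φ k) := by gcongr
      have h7 : (stateAt w (X (φ k)) (a (φ k) * q)).work s c / a (φ k)
          - (stateAt w (X (φ k)) (a (φ k) * t)).work s c / a (φ k) ≤ q - t := by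
        rw [← sub_div, div_le_iff₀ h2]; linarith
      rw [abs_lt] at h1 ⊢
      constructor <;> linarith
    obtain ⟨N, hN⟩ := eventually_atTop.1 h3
    refine ⟨N, fun n hn => ?_⟩
    have h4 := abs_lt.1 (hN n hn)
    have h5 := abs_lt.1 (hN N le_rfl)
    rw [Real.dist_eq, abs_lt]
    constructor <;> linarith
  choose l hl using hlim
  classical
  refine ⟨φ, hφ, fun s c t => if ht : 0 ≤ t then l s c t ht else 0,
    { run := fun k => hrun _
      nonneg := fun k => ha _
      scaled :=
        { scale := hsc.scale.comp hφ.tendsto_atTop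
          initial := fun k => hsc.initial _
          pos := fun s => (hsc.pos s).comp hφ.tendsto_atTop
          nextArrival := hsc.nextArrival.comp hφ.tendsto_atTop
          residual := fun s => (hsc.residual s).comp hφ.tendsto_atTop }
      work := fun s c t ht => ?_ }⟩
  rw [dif_pos ht]
  exact hl s c t ht

/-- In a long enough window behind `q` there are at least `N` customers of type `c`. -/
lemma Regular.exists_window (hw : Regular E α rate lam w) (c : Fin I) (N : ℕ) {δ : ℝ}
    (hδ : 0 < δ) : ∃ M, ∀ q h : ℤ, 0 ≤ h → δ * |(q:ℝ)| + M ≤ h → N ≤ count w c (q - h) q := by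
  have hα := hw.α_pos c
  set ε := min (α c / 2) (α c * δ / 4) with hε
  have hεpos : 0 < ε := lt_min (by positivity) (by positivity)
  have h1 : ε ≤ α c / 2 := min_le_left _ _
  have h2 : ε ≤ α c * δ / 4 := min_le_right _ _
  obtain ⟨M, hM, hbd⟩ := hw.exists_count_bound c hεpos
  refine ⟨2 * (M + N) / α c, fun q h hh hle => ?_⟩
  have h3 := (abs_le.1 (hbd (q - h) q (by omega))).1
  have hh' : (0:ℝ) ≤ h := by exact_mod_cast hh
  have h4 : |((q - h : ℤ) : ℝ)| ≤ |(q:ℝ)| + h := by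
    push_cast
    refine (abs_sub _ _).trans ?_
    rw [abs_of_nonneg hh']
  push_cast at h3 h4
  have h5 : α c * (δ * |(q:ℝ)| + 2 * (M + N) / α c) ≤ α c * h :=
    mul_le_mul_of_nonneg_left hle hα.le
  have h6 : α c * (2 * (M + N) / α c) = 2 * (M + N) := by field_simp
  have hq := abs_nonneg (q:ℝ)
  have h7 : ε * (2 * |(q:ℝ)| + h) ≤ α c * δ / 4 * (2 * |(q:ℝ)|) + α c / 2 * h := by nlinarith
  have h8 : ε * (|(q:ℝ) - h| + |(q:ℝ)|) ≤ ε * (2 * |(q:ℝ)| + h) :=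
    mul_le_mul_of_nonneg_left (by linarith) hεpos.le
  have : (N:ℝ) ≤ count w c (q - h) q := by nlinarith
  exact_mod_cast this

/-- Hall's condition is immediate: any non-empty set of servers has at least `J` candidate
customers, already from the window of one of its members. -/
lemma exists_initial {c : Fin J → Fin I} (hc : ∀ s, E s (c s)) {q : Fin J → ℤ}
    (hq : ∀ s, q s ≤ 0) {h : ℤ} (hcount : ∀ s, J ≤ count w (c s) (q s - h) (q s)) :
    ∃ x : State J I, x.IsInitial E w ∧ x.nextArrival = 0 ∧ (∀ s, x.residual s = 0) ∧
      ∀ s, q s - h < x.pos s ∧ x.pos s ≤ q s := by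
  classical
  obtain ⟨f, hf, hmem⟩ := (Finset.all_card_le_biUnion_card_iff_exists_injective
    fun s => (Finset.Ioc (q s - h) (q s)).filter fun k => w.ξ k = c s).1 (by
      intro A
      rcases A.eq_empty_or_nonempty with rfl | ⟨s, hs⟩
      · simp
      · calc A.card ≤ J := by simpa using A.card_le_univ
          _ ≤ _ := hcount s
          _ ≤ _ := Finset.card_le_card (Finset.subset_biUnion_of_mem
            (fun s => (Finset.Ioc (q s - h) (q s)).filter fun k => w.ξ k = c s) hs))
  simp only [Finset.mem_filter, Finset.mem_Ioc] at hmem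
  exact ⟨{ time := 0, arrived := 0, pos := f, residual := 0, nextArrival := 0, started := 0,
           work := 0, done := 0 },
    { time_eq := rfl
      arrived_eq := rfl
      pos_nonpos := fun s => (hmem s).1.2.trans (hq s)
      pos_injective := hf
      compat := fun s => by
        have := (hmem s).2
        simp only [this]
        exact hc s
      residual_nonneg := fun s => le_rfl
      nextArrival_nonneg := le_rfl
      started_eq := fun s c => rfl
      work_eq := fun s c => rfl
      done_eq := fun s c => rfl }, rfl, fun s => rfl, fun s => (hmem s).1⟩

/-- Every vector of fluid positions is approximated by initial states. -/
lemma Regular.exists_scaled (hw : Regular E α rate lam w) (hE : ∀ s, ∃ c, E s c)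
    (hp₀ : ∀ s, p₀ s ≤ 0) :
    ∃ x₀ : ℕ → State J I, Scaled E w p₀ (fun n => (n : ℝ)) x₀ := by
  choose c hc using hE
  -- `h` is the admissible deviation from the target positions at scale `n`. For every `δ`, windows
  -- of length `δ * n + M` suffice with some `M` depending on `δ`; taking the least good `h` for
  -- each `n` makes the deviation `o(n)` without choosing `δ` in advance.
  set Good : ℕ → ℕ → Prop := fun n h => ∃ x : State J I, x.IsInitial E w ∧ x.nextArrival = 0 ∧
    (∀ s, x.residual s = 0) ∧ ∀ s, ⌊(n:ℝ) * p₀ s⌋ - h < x.pos s ∧ x.pos s ≤ ⌊(n:ℝ) * p₀ s⌋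
  have hq : ∀ (n : ℕ) s, ⌊(n:ℝ) * p₀ s⌋ ≤ 0 := fun n s => by
    have : (n:ℝ) * p₀ s ≤ 0 := mul_nonpos_of_nonneg_of_nonpos (Nat.cast_nonneg n) (hp₀ s)
    have h2 := (Int.floor_le ((n:ℝ) * p₀ s)).trans this
    exact_mod_cast h2
  have hgood : ∀ δ : ℝ, 0 < δ → ∃ M : ℝ, 0 ≤ M ∧ ∀ n h : ℕ, δ * n + M ≤ h → Good n h := by
    intro δ hδ
    set K : ℝ := ∑ s, |p₀ s| + 1 with hK
    have hKs : ∀ s, |p₀ s| ≤ K := fun s => by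
      have := Finset.single_le_sum (f := fun s => |p₀ s|) (fun _ _ => abs_nonneg _)
        (Finset.mem_univ s)
      linarith
    have hK0 : 0 < K := by
      have : 0 ≤ ∑ s, |p₀ s| := Finset.sum_nonneg fun _ _ => abs_nonneg _
      positivity
    choose M hM using fun s => hw.exists_window (c s) J (show 0 < δ / K by positivity)
    refine ⟨δ / K + ∑ s, |M s|, add_nonneg (by positivity)
      (Finset.sum_nonneg fun _ _ => abs_nonneg _), fun n h hle =>
      exists_initial hc (hq n) (h := h) fun s => hM s _ _ (Int.natCast_nonneg h) ?_⟩
    have h1 : M s ≤ ∑ s, |M s| := (le_abs_self _).trans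
      (Finset.single_le_sum (f := fun s => |M s|) (fun _ _ => abs_nonneg _) (Finset.mem_univ s))
    have h2 : |((⌊(n:ℝ) * p₀ s⌋ : ℤ) : ℝ)| ≤ n * K + 1 := by
      have e1 := Int.lt_floor_add_one ((n:ℝ) * p₀ s)
      have e2 : ((⌊(n:ℝ) * p₀ s⌋ : ℤ) : ℝ) ≤ 0 := by exact_mod_cast hq n s
      have e3 : (n:ℝ) * |p₀ s| ≤ n * K := mul_le_mul_of_nonneg_left (hKs s) (Nat.cast_nonneg n)
      rw [abs_of_nonpos (hp₀ s)] at e3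
      rw [abs_of_nonpos e2]
      linarith
    have h3 : δ / K * |((⌊(n:ℝ) * p₀ s⌋ : ℤ) : ℝ)| ≤ δ / K * (n * K + 1) :=
      mul_le_mul_of_nonneg_left h2 (by positivity)
    have h4 : δ / K * (n * K + 1) = δ * n + δ / K := by field_simp
    rw [Int.cast_natCast]
    linarith
  have hex : ∀ n, ∃ h, Good n h := by
    intro n
    obtain ⟨M, hM0, hM⟩ := hgood 1 one_pos
    obtain ⟨h, hh⟩ := exists_nat_ge (1 * (n:ℝ) + M)
    exact ⟨h, hM n h hh⟩
  classical
  have hsmall : Tendsto (fun n : ℕ => ((Nat.find (hex n) : ℕ) : ℝ) / n) atTop (𝓝 0) := by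
    rw [Metric.tendsto_nhds]
    intro ε hε
    obtain ⟨M, hM0, hM⟩ := hgood (ε / 2) (by positivity)
    have h1 : ∀ᶠ n : ℕ in atTop, M + 1 ≤ ε / 4 * n :=
      (tendsto_natCast_atTop_atTop.const_mul_atTop (by positivity)).eventually_ge_atTop _
    filter_upwards [h1, eventually_gt_atTop 0] with n hn hn0
    have hn0' : (0:ℝ) < n := by exact_mod_cast hn0
    have h2 : Nat.find (hex n) ≤ ⌈ε / 2 * n + M⌉₊ := Nat.find_min' _ (hM n _ (Nat.le_ceil _))
    have h3 : ((Nat.find (hex n) : ℕ) : ℝ) ≤ ⌈ε / 2 * n + M⌉₊ := by exact_mod_cast h2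
    have h4 := Nat.ceil_lt_add_one (show 0 ≤ ε / 2 * n + M by positivity)
    rw [Real.dist_eq, sub_zero, abs_of_nonneg (by positivity), div_lt_iff₀ hn0']
    nlinarith
  choose x hx using fun n => Nat.find_spec (hex n)
  refine ⟨x, tendsto_natCast_atTop_atTop, fun n => (hx n).1, fun s => ?_, ?_, fun s => ?_⟩
  · have hlow : Tendsto (fun n : ℕ => p₀ s - 1 / (n:ℝ) - ((Nat.find (hex n) : ℕ) : ℝ) / n) atTop
        (𝓝 (p₀ s)) := by
      have := (tendsto_const_nhds (x := p₀ s)).sub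
        (tendsto_const_nhds (x := (1:ℝ)).div_atTop tendsto_natCast_atTop_atTop) |>.sub hsmall
      simpa using this
    refine tendsto_of_tendsto_of_tendsto_of_le_of_le' hlow tendsto_const_nhds ?_ ?_
    · filter_upwards [eventually_gt_atTop 0] with n hn
      have hn0' : (0:ℝ) < n := by exact_mod_cast hn
      rw [le_div_iff₀ hn0', sub_mul, sub_mul, div_mul_cancel₀ _ hn0'.ne',
        div_mul_cancel₀ _ hn0'.ne']
      have h1 : ((⌊(n:ℝ) * p₀ s⌋ : ℤ) : ℝ) - (Nat.find (hex n) : ℕ) < (x n).pos s := by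
        exact_mod_cast ((hx n).2.2.2 s).1
      have h2 := Int.lt_floor_add_one ((n:ℝ) * p₀ s)
      linarith
    · filter_upwards [eventually_gt_atTop 0] with n hn
      have hn0' : (0:ℝ) < n := by exact_mod_cast hn
      rw [div_le_iff₀ hn0']
      have h1 : ((x n).pos s : ℝ) ≤ ((⌊(n:ℝ) * p₀ s⌋ : ℤ) : ℝ) := by
        exact_mod_cast ((hx n).2.2.2 s).2
      have h2 := Int.floor_le ((n:ℝ) * p₀ s)
      linarith
  · simp only [(hx _).2.1, zero_div, tendsto_const_nhds_iff]
  · simp only [(hx _).2.2.1 s, zero_div, tendsto_const_nhds_iff]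

/-- Fluid limits exist. -/
lemma Regular.exists_isFluidLimit (hw : Regular E α rate lam w) (hE : ∀ s, ∃ c, E s c)
    (hp₀ : ∀ s, p₀ s ≤ 0) : ∃ P T D, IsFluidLimit E w p₀ P T D := by
  obtain ⟨x₀, hx₀⟩ := hw.exists_scaled hE hp₀
  choose X hX hX0 using fun n => exists_run hw.toAdmissible (hx₀.initial n)
  have hsc : Scaled E w p₀ (fun n : ℕ => (n:ℝ)) fun n => X n 0 := by
    simpa only [hX0] using hx₀
  obtain ⟨φ, hφ, T, hT⟩ := exists_fluidScaling hw hX (fun n => Nat.cast_nonneg n) hsc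
  classical
  refine ⟨fun s t => if t = 0 then p₀ s else fluidPos E α rate lam p₀ T s t, T,
    fun s c t => rate s c * T s c t, fun s => if_pos rfl, X, hX, hsc.pos, hsc.nextArrival,
    hsc.residual, φ, hφ, fun s K hK hKc => ?_, fun s c => hT.unif_work hw s c,
    fun s c => hT.unif_done hw s c⟩
  refine (hT.unif_pos hw s K hK hKc).congr_right fun t ht => ?_
  have : (0:ℝ) < t := hK ht
  simp only [this.ne', if_false]

end Existence

/-! ### Almost sure regularity of the primitives -/

section Primitives

variable {J I : ℕ}

open State

lemma count_sub_one (w : Sample J I) (c : Fin I) (q : ℤ) :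
    count w c (q - 1) q = open Classical in if w.ξ q = c then 1 else 0 := by
  split_ifs with h
  · exact count_eq_one (by omega) h fun k h1 h2 => by omega
  · refine count_eq_zero fun k h1 h2 => ?_
    obtain rfl : k = q := by omega
    exact h

lemma count_forward (w : Sample J I) (c : Fin I) (n : ℕ) :
    count w c 0 n
      = ∑ i ∈ Finset.range n, open Classical in if w.ξ ((i : ℤ) + 1) = c then 1 else 0 := by
  induction n with
  | zero => simp [count]
  | succ n ih =>
    have h := count_sub_one w c ((n : ℤ) + 1)
    rw [add_sub_cancel_right] at h
    rw [Finset.sum_range_succ, ← ih, ← h, Nat.cast_succ,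
      count_add (Int.natCast_nonneg n) (by omega)]

lemma count_backward (w : Sample J I) (c : Fin I) (n : ℕ) :
    count w c (-n) 0
      = ∑ i ∈ Finset.range n, open Classical in if w.ξ (-(i : ℤ)) = c then 1 else 0 := by
  induction n with
  | zero => simp [count]
  | succ n ih =>
    have h := count_sub_one w c (-(n : ℤ))
    have h' := count_add (w := w) (c := c) (show -(n : ℤ) - 1 ≤ -n by omega)
      (show -(n : ℤ) ≤ 0 by omega)
    rw [Finset.sum_range_succ, ← ih, ← h, Nat.add_comm (count w c (-n) 0), h']
    congr 1
    push_cast; ring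

variable {Ω : Type*} [MeasurableSpace Ω] {Pr : Measure Ω}
  {E : Fin J → Fin I → Prop} {α : Fin I → ℝ} {rate : Fin J → Fin I → ℝ}
  {u : ℝ → ℤ → Ω → ℝ} {ξ : ℤ → Ω → Fin I} {v : Fin J → Fin I → ℕ → Ω → ℝ}

namespace IsPrimitives

lemma ae_u_lln (h : IsPrimitives Pr E α rate u ξ v) {lam : ℝ} (hlam : 0 < lam) :
    ∀ᵐ ω ∂Pr, Tendsto (fun n : ℕ => (∑ i ∈ Finset.range n, u lam (i + 2) ω) / n) atTop
      (𝓝 (1 / lam)) := by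
  have hid := h.u_ident lam hlam
  have := strong_law_ae_real (μ := Pr) (fun i : ℕ => u lam (i + 2))
    ((hid _).integrable_iff.2 (h.u_integrable lam hlam)) (fun i j hij => by
      have := (h.indep lam hlam).indep (i := Sum.inl ((i : ℤ) + 2)) (j := Sum.inl ((j : ℤ) + 2))
        (by simpa using hij)
      exact (IndepFun_iff_Indep _ _ _).2 this)
    (fun i => (hid _).trans (hid _).symm)
  have hmean : ∫ ω, u lam (((0 : ℕ) : ℤ) + 2) ω ∂Pr = 1 / lam :=
    (hid _).integral_eq.trans (h.u_mean lam hlam)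
  rw [hmean] at this
  exact this

lemma ae_v_lln (h : IsPrimitives Pr E α rate u ξ v) {s : Fin J} {c : Fin I} (hE : E s c) :
    ∀ᵐ ω ∂Pr, Tendsto (fun n : ℕ => (∑ k ∈ Finset.range n, v s c k ω) / n) atTop
      (𝓝 (1 / rate s c)) := by
  have := strong_law_ae_real (μ := Pr) (fun k : ℕ => v s c k) (h.v_integrable s c hE)
    (fun i j hij => by
      have := (h.indep 1 one_pos).indep (i := Sum.inr (Sum.inr (⟨(s, c), hE⟩, i)))
        (j := Sum.inr (Sum.inr (⟨(s, c), hE⟩, j))) (by simpa using hij)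
      exact (IndepFun_iff_Indep _ _ _).2 this)
    (fun k => h.v_ident s c hE k)
  rw [h.v_mean s c hE] at this
  exact this

variable [IsProbabilityMeasure Pr]

lemma ξ_ident (h : IsPrimitives Pr E α rate u ξ v) (k l : ℤ) :
    IdentDistrib (ξ k) (ξ l) Pr Pr := by
  refine ⟨(h.measurable_ξ k).aemeasurable, (h.measurable_ξ l).aemeasurable, ?_⟩
  refine Measure.ext_of_singleton fun c => ?_
  rw [Measure.map_apply (h.measurable_ξ k) (measurableSet_singleton c),
    Measure.map_apply (h.measurable_ξ l) (measurableSet_singleton c)]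
  have h1 := h.ξ_law k c
  rw [← h.ξ_law l c] at h1
  exact (measureReal_eq_measureReal_iff).1 h1

/-- The injection `g` serves both directions of time: the later arrivals, and the customers present
at time zero, counted backwards. -/
lemma ae_ξ_lln (h : IsPrimitives Pr E α rate u ξ v) (c : Fin I) {g : ℕ → ℤ}
    (hg : Function.Injective g) :
    ∀ᵐ ω ∂Pr, Tendsto (fun n : ℕ => ((∑ i ∈ Finset.range n,
      (open Classical in if ξ (g i) ω = c then 1 else 0) : ℕ) : ℝ) / n) atTop (𝓝 (α c)) := by
  classical
  set φ : Fin I → ℝ := fun c' => if c' = c then 1 else 0 with hφ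
  have hφm : Measurable φ := measurable_of_countable φ
  have hmeas : ∀ k, Measurable (φ ∘ ξ k) := fun k => hφm.comp (h.measurable_ξ k)
  have hint : Integrable (φ ∘ ξ (g 0)) Pr := by
    refine Integrable.of_bound (hmeas _).aestronglyMeasurable 1 (Eventually.of_forall fun ω => ?_)
    simp only [hφ, Function.comp_apply]
    split_ifs <;> simp
  have := strong_law_ae_real (μ := Pr) (fun i : ℕ => φ ∘ ξ (g i)) hint
    (fun i j hij => by
      have := (h.indep 1 one_pos).indep (i := Sum.inr (Sum.inl (g i)))
        (j := Sum.inr (Sum.inl (g j))) (by simpa using hg.ne hij)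
      exact ((IndepFun_iff_Indep _ _ _).2 this).comp hφm hφm)
    (fun i => (h.ξ_ident _ _).comp hφm)
  have hmean : ∫ ω, (φ ∘ ξ (g 0)) ω ∂Pr = α c := by
    have hset : MeasurableSet {ω | ξ (g 0) ω = c} :=
      h.measurable_ξ (g 0) (measurableSet_singleton c)
    rw [← h.ξ_law (g 0) c, ← integral_indicator_one hset]
    refine integral_congr_ae (Eventually.of_forall fun ω => ?_)
    simp [hφ, Set.indicator_apply]
  rw [hmean] at this
  filter_upwards [this] with ω hω
  refine hω.congr fun n => ?_
  push_cast
  rfl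

lemma ae_regular (h : IsPrimitives Pr E α rate u ξ v) (hS : ∀ c, ∃ s, E s c) {lam : ℝ}
    (hlam : 0 < lam) : ∀ᵐ ω ∂Pr, Regular E α rate lam (sample u ξ v lam ω) := by
  have hu : ∀ᵐ ω ∂Pr, ∀ ℓ, 0 ≤ u lam ℓ ω := ae_all_iff.2 fun ℓ => h.u_nonneg lam hlam ℓ
  have hv : ∀ᵐ ω ∂Pr, ∀ s c, E s c → ∀ k, 0 ≤ v s c k ω := by
    simp only [ae_all_iff]
    intro s c hE k
    exact h.v_nonneg s c hE k
  have hvl : ∀ᵐ ω ∂Pr, ∀ s c, E s c →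
      Tendsto (fun n : ℕ => (∑ k ∈ Finset.range n, v s c k ω) / n) atTop (𝓝 (1 / rate s c)) := by
    simp only [ae_all_iff]
    intro s c hE
    exact h.ae_v_lln hE
  have hf : ∀ᵐ ω ∂Pr, ∀ c, _ := ae_all_iff.2 fun c =>
    h.ae_ξ_lln c (g := fun i => (i : ℤ) + 1) fun i j hij => by simpa using hij
  have hb : ∀ᵐ ω ∂Pr, ∀ c, _ := ae_all_iff.2 fun c =>
    h.ae_ξ_lln c (g := fun i => -(i : ℤ)) fun i j hij => by simpa using hij
  filter_upwards [hu, hv, hvl, h.ae_u_lln hlam, hf, hb] with ω h1 h2 h3 h4 h5 h6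
  exact
    { server := hS
      u_nonneg := h1
      v_nonneg := h2
      lam_pos := hlam
      α_pos := h.α_pos
      rate_pos := h.rate_pos
      u_lln := h4
      v_lln := h3
      ξ_pos := fun c => by simp only [count_forward]; exact h5 c
      ξ_neg := fun c => by simp only [count_backward]; exact h6 c }

end IsPrimitives

end Primitives

/-! ### The fluid equations of a block -/

section Blocks

variable {J I L : ℕ} {E : Fin J → Fin I → Prop} {α : Fin I → ℝ} {rate : Fin J → Fin I → ℝ}
  {lam : ℝ} {p₀ : Fin J → ℝ} {T : Fin J → Fin I → ℝ → ℝ} {t₁ t₂ : ℝ} {b : Fin J → Fin L}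

lemma hasDerivAt_of_eventually_linear {f : ℝ → ℝ} {y τ : ℝ}
    (h : ∀ᶠ σ in 𝓝 τ, f σ - f τ = (σ - τ) * y) : HasDerivAt f y τ := by
  have h1 : HasDerivAt (fun σ => f τ + (σ - τ) * y) y τ := by
    simpa using (((hasDerivAt_id τ).sub_const τ).mul_const y).const_add (f τ)
  refine h1.congr_of_eventuallyEq ?_
  filter_upwards [h] with σ hσ
  linarith

lemma ValidPartition.congr {P P' : Fin J → ℝ → ℝ} (h : ValidPartition E P t₁ t₂ b)
    (heq : ∀ s, ∀ τ ∈ Ioo t₁ t₂, P s τ = P' s τ) : ValidPartition E P' t₁ t₂ b where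
  surjective := h.surjective
  connected := h.connected
  together τ hτ s s' hs := by
    rw [← heq s τ hτ, ← heq s' τ hτ]; exact h.together τ hτ s s' hs
  ordered τ hτ s s' hs := by
    rw [← heq s τ hτ, ← heq s' τ hτ]; exact h.ordered τ hτ s s' hs

lemma exists_mem_blockTypes {c : Fin I} (b : Fin J → Fin L) (hS : ∃ s, E s c) :
    ∃ s, E s c ∧ c ∈ blockTypes E b (b s) ∧ ∀ s', E s' c → b s' ≤ b s := by
  classical
  obtain ⟨s₀, hs₀⟩ := hS
  obtain ⟨s, hs, hmax⟩ := (Finset.univ.filter fun s => E s c).exists_max_image b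
    ⟨s₀, by simpa using hs₀⟩
  simp only [Finset.mem_filter, Finset.mem_univ, true_and] at hs hmax
  exact ⟨s, hs, ⟨⟨s, rfl, hs⟩, fun s' hlt hE => not_lt.2 (hmax s' hE) hlt⟩, hmax⟩

namespace FluidPath

/-- The servers outside the block of a type that can serve it are behind that type. -/
lemma lt_of_ne_block (hV : ValidPartition E (fluidPos E α rate lam p₀ T) t₁ t₂ b)
    {τ : ℝ} (hτ : τ ∈ Ioo t₁ t₂) {s s' : Fin J} {c : Fin I} (hc : c ∈ blockTypes E b (b s))
    (hE : E s' c) (hne : b s' ≠ b s) :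
    fluidPos E α rate lam p₀ T s' τ < fluidPos E α rate lam p₀ T s τ := by
  have hlt : b s' < b s := lt_of_le_of_ne (not_lt.1 fun h => hc.2 s' h hE) hne
  rcases hV.ordered τ hτ s' s hlt with h1 | ⟨-, h1⟩
  · exact h1
  · exact absurd (compatGraph_adj.2 hE) (h1 _ (Or.inl ⟨s', rfl, rfl⟩) _ (Or.inr ⟨c, hc, rfl⟩))

/-- The front is the largest position of a compatible server. Those in the block of the type share
one position, and all the others are strictly behind. -/
lemma front_eq_of_block (h : FluidPath E α rate lam p₀ T)
    (hV : ValidPartition E (fluidPos E α rate lam p₀ T) t₁ t₂ b) (ht₁ : 0 ≤ t₁)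
    {τ : ℝ} (hτ : τ ∈ Ioo t₁ t₂) {s : Fin J} {c : Fin I} (hc : c ∈ blockTypes E b (b s)) :
    fluidFront E α rate p₀ T τ c = fluidPos E α rate lam p₀ T s τ := by
  obtain ⟨⟨s', hs', hE'⟩, -⟩ := id hc
  obtain ⟨⟨s₁, hs₁, hs₁eq⟩, hub⟩ := h.greatest τ c (ht₁.trans_lt hτ.1)
  simp only at hs₁eq
  have h1 : fluidPos E α rate lam p₀ T s' τ ≤ fluidFront E α rate p₀ T τ c := hub ⟨s', hE', rfl⟩
  rw [hV.together τ hτ s' s hs'] at h1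
  refine le_antisymm ?_ h1
  rw [← hs₁eq]
  by_cases hb : b s₁ = b s
  · exact (hV.together τ hτ s₁ s hb).le
  · exact (lt_of_ne_block hV hτ hc hs₁ hb).le

/-- A server of the block is at the front of one of its types. If that type belonged to another
block, the server would be strictly behind this front. -/
lemma blockTypes_nonempty (h : FluidPath E α rate lam p₀ T) (hE : ∀ s, ∃ c, E s c)
    (hV : ValidPartition E (fluidPos E α rate lam p₀ T) t₁ t₂ b) (ht₁ : 0 ≤ t₁) (ht : t₁ < t₂)
    (ℓ : Fin L) : (blockTypes E b ℓ).Nonempty := by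
  obtain ⟨s, rfl⟩ := hV.surjective ℓ
  have hτ : (t₁ + t₂) / 2 ∈ Ioo t₁ t₂ := ⟨by linarith, by linarith⟩
  obtain ⟨c, hc, heq⟩ := h.exists_pos_eq (hE s) (ht₁.trans hτ.1.le)
  obtain ⟨s', -, hmem, -⟩ := exists_mem_blockTypes b ⟨s, hc⟩
  by_cases hb : b s = b s'
  · exact ⟨c, hb ▸ hmem⟩
  · have h1 := lt_of_ne_block hV hτ hmem hc hb
    rw [heq, h.front_eq_of_block hV ht₁ hτ hmem] at h1
    exact absurd h1 (lt_irrefl _)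

/-- No work is spent across blocks. -/
lemma work_eventually_const (h : FluidPath E α rate lam p₀ T) (hE : ∀ s, ∃ c, E s c)
    (hV : ValidPartition E (fluidPos E α rate lam p₀ T) t₁ t₂ b) (ht₁ : 0 ≤ t₁)
    {τ : ℝ} (hτ : τ ∈ Ioo t₁ t₂) {s : Fin J} {c : Fin I} (hsc : E s c)
    (hc : c ∉ blockTypes E b (b s)) : ∀ᶠ σ in 𝓝 τ, T s c σ = T s c τ := by
  have hτ0 : 0 < τ := ht₁.trans_lt hτ.1
  obtain ⟨s', -, hmem, -⟩ := exists_mem_blockTypes b ⟨s, hsc⟩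
  have hb : b s ≠ b s' := fun heq => hc (heq ▸ hmem)
  have h1 := lt_of_ne_block hV hτ hmem hsc hb
  rw [← h.front_eq_of_block hV ht₁ hτ hmem] at h1
  obtain ⟨c', hc', heq⟩ := h.exists_pos_eq (hE s) hτ0.le
  exact h.focus τ s c c' hτ0 hc' (heq ▸ h1)

/-- The fluid equations of a block determine the derivatives. -/
theorem hasDerivAt_block (h : FluidPath E α rate lam p₀ T) {a : Fin J → ℝ} {k : Fin I → ℝ}
    (hW : Weights E α rate a k) (hG : (compatGraph E).IsAcyclic) (hE : ∀ s, ∃ c, E s c)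
    (hV : ValidPartition E (fluidPos E α rate lam p₀ T) t₁ t₂ b) (ht₁ : 0 ≤ t₁)
    {ℓ : Fin L} {η : Fin J → Fin I → ℝ} {y : ℝ} (hη : BlockEquations E α rate b ℓ η y)
    {τ : ℝ} (hτ : τ ∈ Ioo t₁ t₂)
    (hlow : ∀ s, b s = ℓ → fluidPos E α rate lam p₀ T s τ < lam * τ) {s : Fin J} (hs : b s = ℓ) :
    HasDerivAt (fluidPos E α rate lam p₀ T s) y τ ∧ ∀ c, HasDerivAt (T s c) (η s c) τ := by
  classical
  have hτ0 : 0 < τ := ht₁.trans_lt hτ.1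
  have hne := h.blockTypes_nonempty hE hV ht₁ (hτ.1.trans hτ.2) ℓ
  have hoff : ∀ᶠ σ in 𝓝 τ, ∀ s c, E s c → c ∉ blockTypes E b (b s) → T s c σ = T s c τ := by
    simp only [eventually_all]
    intro s c hsc hc
    exact h.work_eventually_const hE hV ht₁ hτ hsc hc
  have hbusy : ∀ᶠ σ in 𝓝 τ, ∀ s, b s = ℓ → ∑ c, T s c σ - ∑ c, T s c τ = σ - τ := by
    simp only [eventually_all]
    intro s hs
    obtain ⟨c, hc, heq⟩ := h.exists_pos_eq (hE s) hτ0.le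
    exact h.busy τ s c hτ0 hc (heq ▸ hlow s hs)
  have hlin : ∀ᶠ σ in 𝓝 τ, ∀ s, b s = ℓ →
      fluidPos E α rate lam p₀ T s σ - fluidPos E α rate lam p₀ T s τ = (σ - τ) * y ∧
      ∀ c, T s c σ - T s c τ = (σ - τ) * η s c := by
    filter_upwards [hoff, hbusy, Ioo_mem_nhds hτ.1 hτ.2] with σ h1 h2 hσ s hs
    rcases eq_or_ne σ τ with rfl | hστ
    · simp
    have hσ0 : 0 < σ := ht₁.trans_lt hσ.1
    have hd : σ - τ ≠ 0 := sub_ne_zero.2 hστ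
    -- The difference quotients over the interval between `τ` and `σ`, restricted to the block. The
    -- restriction loses nothing in the rows and columns of the block, since no work crosses blocks;
    -- hence `η'` solves the block equations exactly, not only in the limit.
    set η' : Fin J → Fin I → ℝ := fun s c =>
      if b s = ℓ ∧ c ∈ blockTypes E b ℓ then (T s c σ - T s c τ) / (σ - τ) else 0 with hη'
    have hval : ∀ s c, b s = ℓ ∨ c ∈ blockTypes E b ℓ →
        η' s c = (T s c σ - T s c τ) / (σ - τ) := by
      intro s c hor
      simp only [hη']
      split_ifs with hcond
      · rfl
      · by_cases hsc : E s c
        · rw [h1 s c hsc ?_, sub_self, zero_div]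
          intro hc
          rcases hor with hor | hor
          · exact hcond ⟨hor, hor ▸ hc⟩
          · refine hcond ⟨?_, hor⟩
            obtain ⟨⟨s₂, hs₂, hE₂⟩, hlast⟩ := hor
            refine le_antisymm (not_lt.1 fun hlt => hlast s hlt hsc) ?_
            rw [← hs₂]
            exact not_lt.1 fun hlt => hc.2 s₂ hlt hE₂
        · rw [h.supp s c σ hσ0.le hsc, h.supp s c τ hτ0.le hsc, sub_self, zero_div]
    have heqs : BlockEquations E α rate b ℓ η'
        ((fluidPos E α rate lam p₀ T s σ - fluidPos E α rate lam p₀ T s τ) / (σ - τ)) := by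
      rw [blockEquations_iff hW]
      refine ⟨fun s' c hn => ?_, fun s' hs' => ?_, fun c hc => ?_⟩
      · simp only [hη']
        split_ifs with hcond
        · have hsc : ¬ E s' c := fun hsc => hn ⟨hsc, hcond⟩
          rw [h.supp s' c σ hσ0.le hsc, h.supp s' c τ hτ0.le hsc, sub_self, zero_div]
        · rfl
      · rw [Finset.sum_congr rfl fun c _ => hval s' c (Or.inl hs'), ← Finset.sum_div,
          Finset.sum_sub_distrib, h2 s' hs', div_self hd]
      · rw [Finset.sum_congr rfl fun s' _ => by rw [hval s' c (Or.inr hc)]]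
        have h3 := h.front_sub hW hτ0.le hσ0.le c
        rw [h.front_eq_of_block hV ht₁ hσ (hs.symm ▸ hc : c ∈ blockTypes E b (b s)),
          h.front_eq_of_block hV ht₁ hτ (hs.symm ▸ hc : c ∈ blockTypes E b (b s)),
          eq_div_iff (hW.w_pos c).ne'] at h3
        rw [mul_div_assoc', mul_comm (k c), h3, Finset.sum_div]
        exact Finset.sum_congr rfl fun s' _ => by rw [mul_div_assoc']
    obtain ⟨e1, e2⟩ := blockEquations_unique hG hW hne hη heqs
    rw [div_eq_iff hd] at e2
    refine ⟨by rw [e2, mul_comm], fun c => ?_⟩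
    rw [← e1, hval s c (Or.inl hs)]
    field_simp
  exact ⟨hasDerivAt_of_eventually_linear (hlin.mono fun σ hσ => (hσ s hs).1),
    fun c => hasDerivAt_of_eventually_linear (hlin.mono fun σ hσ => (hσ s hs).2 c)⟩

end FluidPath

end Blocks

/-! ### Levels -/

section Levels

variable {J : ℕ} {P : Fin J → ℝ → ℝ}

lemma level_eq_of_forall_eq {t p : ℝ} (h : ∀ s, P s t = p) (j : Fin J) : level P j t = p := h _

lemma exists_eq_level (P : Fin J → ℝ → ℝ) (s : Fin J) (t : ℝ) : ∃ j, P s t = level P j t :=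
  ⟨(Tuple.sort fun s => P s t).symm s, by simp [level]⟩

lemma monotone_level (P : Fin J → ℝ → ℝ) (t : ℝ) : Monotone fun j => level P j t :=
  Tuple.monotone_sort fun s => P s t

lemma le_topLevel [NeZero J] (P : Fin J → ℝ → ℝ) (s : Fin J) (t : ℝ) : P s t ≤ topLevel P t := by
  obtain ⟨j, hj⟩ := exists_eq_level P s t
  rw [hj]
  refine monotone_level P t ?_
  rw [Fin.le_rev_iff]
  exact Fin.zero_le _

lemma bottomLevel_le [NeZero J] (P : Fin J → ℝ → ℝ) (s : Fin J) (t : ℝ) :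
    bottomLevel P t ≤ P s t := by
  obtain ⟨j, hj⟩ := exists_eq_level P s t
  rw [hj]
  exact monotone_level P t (Fin.zero_le _)

/-- The permutation that sorts the positions at `t'` also sorts those at `t`; any two sorting
permutations give the same sorted values. -/
lemma level_shift {t t' κ : ℝ} (h : ∀ s, P s t = P s t' + κ) (j : Fin J) :
    level P j t = level P j t' + κ := by
  have h1 : Monotone ((fun s => P s t) ∘ Tuple.sort fun s => P s t') := by
    have h2 := Tuple.monotone_sort fun s => P s t'
    intro i i' hii'
    have := h2 hii'
    simp only [Function.comp_apply, h] at this ⊢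
    linarith
  have h2 := congrFun (Tuple.comp_sort_eq_comp_iff_monotone.2 h1) j
  simp only [Function.comp_apply] at h2
  rw [level, level, ← h2, h]

end Levels

/-! ### Pooling -/

section Pooling

variable {J I : ℕ} {E : Fin J → Fin I → Prop} {α : Fin I → ℝ} {rate : Fin J → Fin I → ℝ}
  {lam : ℝ} {p₀ : Fin J → ℝ} {T : Fin J → Fin I → ℝ → ℝ} {a : Fin J → ℝ} {k : Fin I → ℝ}
  {η : Fin J → Fin I → ℝ} {m : ℝ}

lemma PoolingEquations.pooled (h : PoolingEquations E α rate η m) (hW : Weights E α rate a k) :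
    Pooled E a k η m := by
  obtain ⟨h1, h2, h3⟩ := (poolingEquations_iff hW).1 h
  exact ⟨hW.a_pos, hW.w_pos, h1, h2, h3⟩

lemma initialFront_mem (hS : ∀ c, ∃ s, E s c) {d : ℝ} (hp₀ : InitialPositions d p₀) (c : Fin I) :
    -d ≤ initialFront E p₀ c ∧ initialFront E p₀ c ≤ 0 := by
  obtain ⟨⟨s, -, hs⟩, -⟩ := isGreatest_initialFront (hS c) p₀
  rw [← hs]
  refine ⟨?_, hp₀.1 s⟩
  have h1 := Finset.single_le_sum (f := fun s => -p₀ s) (fun s _ => neg_nonneg.2 (hp₀.1 s))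
    (Finset.mem_univ s)
  rw [Finset.sum_neg_distrib, hp₀.2] at h1
  linarith

namespace FluidPath

lemma exists_settling_time (hW : Weights E α rate a k) (hS : ∀ c, ∃ s, E s c)
    (h : Pooled E a k η m) (hm : 0 < m)
    (hlam : 0 < lam) (hη : ∀ s c, E s c → 0 ≤ η s c) (d : ℝ) :
    ∃ t₀ > 0, ∀ p₀, InitialPositions d p₀ → ∀ T, FluidPath E α rate lam p₀ T → ∀ t ≥ t₀,
      fluidLag E α rate lam p₀ T t = fluidLag E α rate lam p₀ T t₀
        + (t - t₀) • terminalVel I m lam := by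
  obtain ⟨t₀, ht₀, hset⟩ := SkillBased.exists_settling_time h hm hlam hη d
  refine ⟨t₀, ht₀, fun p₀ hp₀ T hT => hset _ (hT.flow hW) (fun c => ?_) fun c => ?_⟩
  · rw [hT.lag_zero]; exact (initialFront_mem hS hp₀ c).2
  · rw [hT.lag_zero]; exact (initialFront_mem hS hp₀ c).1

/-- All the fronts coincide if all the positions do. -/
lemma front_eq_of_pos_eq (h : FluidPath E α rate lam p₀ T) {t : ℝ} (ht : 0 < t)
    (heq : ∀ s s', fluidPos E α rate lam p₀ T s t = fluidPos E α rate lam p₀ T s' t)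
    (s : Fin J) (c : Fin I) :
    fluidFront E α rate p₀ T t c = fluidPos E α rate lam p₀ T s t := by
  obtain ⟨⟨s', -, hs'⟩, -⟩ := h.greatest t c ht
  rw [← hs']
  exact heq s' s

/-- With a positive solution of the pooling equations, all the positions eventually coincide. -/
lemma pos_eq_of_pooled (hW : Weights E α rate a k) (hG : (compatGraph E).Connected)
    (hS : ∀ c, ∃ s, E s c) (hE : ∀ s, ∃ c, E s c) (h : Pooled E a k η m) (hm : 0 < m)
    (hlam : 0 < lam) (hη : ∀ s c, E s c → 0 < η s c) (d : ℝ) :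
    ∃ t₀ > 0, ∀ p₀, InitialPositions d p₀ → ∀ T, FluidPath E α rate lam p₀ T → ∀ t > t₀,
      ∀ s s', fluidPos E α rate lam p₀ T s t = fluidPos E α rate lam p₀ T s' t := by
  obtain ⟨t₀, ht₀, hset⟩ := exists_settling_time hW hS h hm hlam (fun s c hE => (hη s c hE).le) d
  refine ⟨t₀, ht₀, fun p₀ hp₀ T hT t ht s s' => ?_⟩
  have h1 := Flow.pooled_of_terminal h hm hlam hη (t₁ := t₀) (t := t) (t₂ := t) ht le_rfl
    ((hT.flow hW t).mono ht₀.le le_rfl) fun τ hτ => hset p₀ hp₀ T hT τ hτ.1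
  obtain ⟨c, hc⟩ := hE s
  obtain ⟨c', hc'⟩ := hE s'
  rw [fluidPos, fluidPos, ← h1 s c hc, ← h1 s' c' hc', eq_of_connected hG h1 c c']

/-- With a non-negative solution of the pooling equations, all the positions eventually move at the
same speed. -/
lemma pos_linear_of_pooled (hW : Weights E α rate a k)
    (hS : ∀ c, ∃ s, E s c) (hE : ∀ s, ∃ c, E s c) (h : Pooled E a k η m) (hm : 0 < m)
    (hlam : 0 < lam) (hη : ∀ s c, E s c → 0 ≤ η s c) (d : ℝ) :
    ∃ t₀ > 0, ∀ p₀, InitialPositions d p₀ → ∀ T, FluidPath E α rate lam p₀ T → ∀ t ≥ t₀, ∀ s,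
      fluidPos E α rate lam p₀ T s t
        = fluidPos E α rate lam p₀ T s t₀ + (t - t₀) * (lam + min (m - lam) 0) := by
  obtain ⟨t₀, ht₀, hset⟩ := exists_settling_time hW hS h hm hlam hη d
  refine ⟨t₀, ht₀, fun p₀ hp₀ T hT t ht s => ?_⟩
  have hfront : ∀ c, fluidFront E α rate p₀ T t c
      = fluidFront E α rate p₀ T t₀ c + (t - t₀) * (lam + min (m - lam) 0) := by
    intro c
    have h1 := congrFun (hset p₀ hp₀ T hT t ht) c
    simp only [fluidLag, terminalVel, Pi.add_apply, Pi.smul_apply, smul_eq_mul] at h1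
    linarith
  obtain ⟨c, hc, heq⟩ := hT.exists_pos_eq (hE s) (t := t₀) ht₀.le
  refine le_antisymm ?_ (hT.le_pos (hE s) (ht₀.le.trans ht) fun c' hc' => ?_)
  · rw [heq, ← hfront c]; exact pos_le hc t
  · rw [hfront c']
    have := pos_le (α := α) (rate := rate) (lam := lam) (p₀ := p₀) (T := T) hc' t₀
    linarith

/-- While all the positions coincide and are behind the last arrival, the pooling equations give
the derivatives. -/
lemma hasDerivAt_pooled [NeZero J] (h : FluidPath E α rate lam p₀ T) (hW : Weights E α rate a k)
    (hG : (compatGraph E).IsTree) (hS : ∀ c, ∃ s, E s c) (hE : ∀ s, ∃ c, E s c)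
    (hη : PoolingEquations E α rate η m) {t₁ t₂ : ℝ} (ht₁ : 0 ≤ t₁)
    (heq : ∀ τ ∈ Ioo t₁ t₂, ∀ s s',
      fluidPos E α rate lam p₀ T s τ = fluidPos E α rate lam p₀ T s' τ)
    {τ : ℝ} (hτ : τ ∈ Ioo t₁ t₂) (hlow : ∀ s, fluidPos E α rate lam p₀ T s τ < lam * τ)
    (s : Fin J) :
    HasDerivAt (fluidPos E α rate lam p₀ T s) m τ ∧ ∀ c, HasDerivAt (T s c) (η s c) τ := by
  -- Coinciding positions make the whole system a single block, whose subgraph is the tree itself.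
  have hV : ValidPartition E (fluidPos E α rate lam p₀ T) t₁ t₂ fun _ : Fin J => (0 : Fin 1) :=
    { surjective := fun ℓ => ⟨0, (Subsingleton.elim _ _)⟩
      connected := fun ℓ => by
        obtain rfl : ℓ = 0 := Subsingleton.elim _ _
        rw [blockNodes_trivial hS]
        exact (SimpleGraph.Iso.connected_iff (SimpleGraph.induceUnivIso (compatGraph E))).2 hG.1
      together := fun τ hτ s s' _ => heq τ hτ s s'
      ordered := fun τ _ s s' hlt => absurd hlt (lt_irrefl _) }
  exact h.hasDerivAt_block hW hG.2 hE hV ht₁ ((poolingEquations_iff_blockEquations hW hS).1 hη) hτ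
    (fun s _ => hlow s) rfl

/-- Starting from an empty queue, if all the positions coincide at time `t` they are at most
`m t`. -/
lemma pos_le_of_pos_eq [NeZero J] (h : FluidPath E α rate lam 0 T) (hW : Weights E α rate a k)
    (hS : ∀ c, ∃ s, E s c) (hp : Pooled E a k η m) (c₀ : Fin I) {t : ℝ} (ht : 0 < t)
    (heq : ∀ s s', fluidPos E α rate lam 0 T s t = fluidPos E α rate lam 0 T s' t) (s : Fin J) :
    fluidPos E α rate lam 0 T s t ≤ m * t := by
  have hk : 0 < ∑ c, k c := Finset.sum_pos (fun c _ => hp.w_pos c) ⟨c₀, Finset.mem_univ _⟩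
  have h0 : ∀ c, fluidFront E α rate 0 T 0 c = 0 := by
    intro c
    obtain ⟨⟨s, -, hs⟩, -⟩ := isGreatest_initialFront (hS c) (0 : Fin J → ℝ)
    simp [fluidFront, h.zero, ← hs]
  have h1 : ∀ c, k c * fluidPos E α rate lam 0 T s t = ∑ s', a s' * T s' c t := by
    intro c
    have h2 := h.front_sub hW le_rfl ht.le c
    rw [h0, sub_zero, h.front_eq_of_pos_eq ht heq s c, eq_div_iff (hp.w_pos c).ne'] at h2
    rw [mul_comm, h2]
    exact Finset.sum_congr rfl fun s' _ => by rw [h.zero, sub_zero]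
  -- Summed over the types with the weights `k`, the common position measures the total weighted
  -- work, which is at most `(∑ s, a s) * t`, that is `m * t` times the total weight of the types.
  have h3 : (∑ c, k c) * fluidPos E α rate lam 0 T s t ≤ (∑ c, k c) * (m * t) := by
    calc (∑ c, k c) * fluidPos E α rate lam 0 T s t = ∑ s', a s' * ∑ c, T s' c t := by
          rw [Finset.sum_mul, Finset.sum_congr rfl fun c _ => h1 c, Finset.sum_comm]
          exact Finset.sum_congr rfl fun s' _ => by rw [Finset.mul_sum]
      _ ≤ ∑ s', a s' * t := by
          refine Finset.sum_le_sum fun s' _ => mul_le_mul_of_nonneg_left ?_ (hp.a_pos s').le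
          have := h.total s' 0 t le_rfl ht.le
          simpa [h.zero] using this
      _ = (∑ c, k c) * (m * t) := by
          rw [← Finset.sum_mul, hp.sum_a]; ring
  exact le_of_mul_le_mul_left h3 hk

/-- If all the positions coincide after some time, when starting from an empty queue with arrival
rate larger than `m`, the solution of the pooling equations is non-negative. -/
lemma nonneg_of_pos_eq [NeZero J] (h : FluidPath E α rate lam 0 T) (hW : Weights E α rate a k)
    (hG : (compatGraph E).IsTree) (hS : ∀ c, ∃ s, E s c) (hE : ∀ s, ∃ c, E s c)
    (hη : PoolingEquations E α rate η m) (hm : m < lam) {t₀ : ℝ} (ht₀ : 0 ≤ t₀)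
    (heq : ∀ t > t₀, ∀ s s', fluidPos E α rate lam 0 T s t = fluidPos E α rate lam 0 T s' t)
    (s : Fin J) (c : Fin I) : 0 ≤ η s c := by
  have hτ : t₀ + 1 ∈ Ioo t₀ (t₀ + 2) := ⟨by linarith, by linarith⟩
  have hτ0 : 0 < t₀ + 1 := by linarith
  have hd := (h.hasDerivAt_pooled hW hG hS hE hη ht₀ (fun τ hτ => heq τ hτ.1) hτ (fun s =>
    (h.pos_le_of_pos_eq hW hS (hη.pooled hW) c hτ0 (heq _ hτ.1) s).trans_lt
      (mul_lt_mul_of_pos_right hm hτ0)) s).2 c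
  have hmono : MonotoneOn (T s c) (Ioi 0) :=
    fun t ht t' _ htt' => h.mono s c t t' (le_of_lt ht) htt'
  have h1 := hmono.derivWithin_nonneg (x := t₀ + 1)
  rwa [hd.hasDerivWithinAt.derivWithin (isOpen_Ioi.uniqueDiffWithinAt hτ0)] at h1

/-- The pooled solution started from fronts `r`. -/
lemma front_eq_of_flow_pooled (h : FluidPath E α rate lam p₀ T) (hW : Weights E α rate a k)
    (hS : ∀ c, ∃ s, E s c) (hp₀ : ∀ s, p₀ s ≤ 0)
    (hp : Pooled E a k η m) (hη : ∀ s c, 0 ≤ η s c) (hm : m < lam)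
    (hfirst : ∀ s c c', E s c' → initialFront E p₀ c' < initialFront E p₀ c → η s c = 0)
    {t : ℝ} (ht : 0 ≤ t) (c : Fin I) :
    fluidFront E α rate p₀ T t c = initialFront E p₀ c + m * t := by
  have h1 := flow_pooled hp hη (r := initialFront E p₀)
    (fun c => (initialFront_mem hS ⟨hp₀, rfl⟩ c).2) hfirst hm t
  have h2 := congrFun ((h.flow hW t).unique hW.a_pos hW.w_pos h1
    (funext fun c => by simp [h.lag_zero]) t ⟨ht, le_rfl⟩) c
  simp only [fluidLag] at h2
  linarith

end FluidPath

/-- If an edge carries no flow in the non-negative solution of the pooling equations, there are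
initial positions from which the positions never coincide. -/
lemma exists_never_pooled (hW : Weights E α rate a k)
    (hG : (compatGraph E).IsAcyclic) (hS : ∀ c, ∃ s, E s c)
    (hp : Pooled E a k η m) (hη : ∀ s c, 0 ≤ η s c) (hm0 : 0 < m) (hm : m < lam)
    {s₀ : Fin J} {c₀ : Fin I} (h₀ : E s₀ c₀) (hzero : η s₀ c₀ = 0) :
    ∃ p₀ : Fin J → ℝ, (∀ s, p₀ s ≤ 0) ∧ ∀ T, FluidPath E α rate lam p₀ T → ∀ t > 0,
      ¬ ∀ s s', fluidPos E α rate lam p₀ T s t = fluidPos E α rate lam p₀ T s' t := by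
  classical
  obtain ⟨KS, KC, hs₀, hc₀, hcut⟩ := exists_cut hG h₀
  have hedge : ∀ s c, η s c ≠ 0 → E s c ∧ (s ∈ KS ↔ c ∈ KC) := by
    intro s c hne
    have hE : E s c := by
      by_contra hE
      exact hne (hp.supp s c hE)
    exact ⟨hE, hcut s c hE fun ⟨h1, h2⟩ => hne (h1 ▸ h2 ▸ hzero)⟩
  -- One side of the cut starts one unit behind the other. Types of `KC` are compatible with servers
  -- of `KS` only, and every other type has a server outside `KS` with positive flow, so the initial
  -- fronts reproduce the cut. Since `η` uses no edge across it, both sides follow `η` at speed `m`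
  -- and keep their distance.
  set p₀ : Fin J → ℝ := fun s => if s ∈ KS then -1 else 0 with hp₀def
  have hp₀ : ∀ s, p₀ s ≤ 0 := fun s => by
    simp only [hp₀def]; split_ifs <;> norm_num
  have hfront : ∀ c, initialFront E p₀ c = if c ∈ KC then -1 else 0 := by
    intro c
    obtain ⟨⟨s, hs, heq⟩, hub⟩ := isGreatest_initialFront (hS c) p₀
    split_ifs with hc
    · have : s ∈ KS := (hcut s c hs fun h => hc₀ (h.2 ▸ hc)).2 hc
      rw [← heq]
      simp [hp₀def, this]
    · obtain ⟨s', hs'⟩ : ∃ s', η s' c ≠ 0 := by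
        by_contra hcon
        push Not at hcon
        have := hp.customer c
        simp only [hcon, mul_zero, Finset.sum_const_zero] at this
        exact absurd this (mul_pos (hp.w_pos c) hm0).ne
      obtain ⟨hE', hiff⟩ := hedge s' c hs'
      have h1 : p₀ s' ≤ initialFront E p₀ c := hub ⟨s', hE', rfl⟩
      have h2 : p₀ s' = 0 := by simp [hp₀def, mt hiff.1 hc]
      have h3 := hp₀ s
      rw [heq] at h3
      linarith
  refine ⟨p₀, hp₀, fun T hT t ht heq => ?_⟩
  have hfirst : ∀ s c c', E s c' → initialFront E p₀ c' < initialFront E p₀ c → η s c = 0 := by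
    intro s c c' hE hlt
    by_contra hne
    rw [hfront, hfront] at hlt
    have hc' : c' ∈ KC := by
      by_contra hc'
      rw [if_neg hc'] at hlt
      split_ifs at hlt <;> linarith
    have hc : c ∉ KC := by
      intro hc
      rw [if_pos hc', if_pos hc] at hlt
      exact lt_irrefl _ hlt
    have hs : s ∈ KS := (hcut s c' hE fun h => hc₀ (h.2 ▸ hc')).2 hc'
    exact hc ((hedge s c hne).2.1 hs)
  obtain ⟨c₁, hc₁⟩ : ∃ c, η s₀ c ≠ 0 := by
    by_contra hcon
    push Not at hcon
    have := hp.server s₀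
    simp [hcon] at this
  have hc₁K := (hedge s₀ c₁ hc₁).2.1 hs₀
  have h1 := hT.front_eq_of_flow_pooled hW hS hp₀ hp hη hm hfirst ht.le c₀
  have h2 := hT.front_eq_of_flow_pooled hW hS hp₀ hp hη hm hfirst ht.le c₁
  rw [hfront, if_neg hc₀, hT.front_eq_of_pos_eq ht heq s₀] at h1
  rw [hfront, if_pos hc₁K, hT.front_eq_of_pos_eq ht heq s₀] at h2
  linarith

end Pooling

/-! ### Total service rate of a solution of the pooling equations -/

section Primitives

variable {J I : ℕ} {Ω : Type*} [MeasurableSpace Ω] {Pr : Measure Ω}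
  [IsProbabilityMeasure Pr] {E : Fin J → Fin I → Prop} {α : Fin I → ℝ} {rate : Fin J → Fin I → ℝ}
  {u : ℝ → ℤ → Ω → ℝ} {ξ : ℤ → Ω → Fin I} {v : Fin J → Fin I → ℕ → Ω → ℝ}
  {η : Fin J → Fin I → ℝ} {m : ℝ}

lemma IsPrimitives.sum_α (h : IsPrimitives Pr E α rate u ξ v) : ∑ c, α c = 1 := by
  have h1 := sum_measureReal_preimage_singleton (μ := Pr) (Finset.univ : Finset (Fin I))
    (f := ξ 0) (fun c _ => h.measurable_ξ 0 (measurableSet_singleton c))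
  rw [Finset.coe_univ, Set.preimage_univ, probReal_univ] at h1
  rw [← h1]
  exact Finset.sum_congr rfl fun c _ => (h.ξ_law 0 c).symm

/-- The services of type `c` have total rate `α c * m`, and the type probabilities add up to one. -/
lemma PoolingEquations.sum_rate (hη : PoolingEquations E α rate η m) (hα : ∀ c, 0 < α c)
    (hsum : ∑ c, α c = 1) : ∑ s, ∑ c, rate s c * η s c = m := by
  classical
  rw [Finset.sum_comm]
  have h1 : ∀ c, ∑ s, rate s c * η s c = α c * m := by
    intro c
    rw [← hη.customer c, Finset.mul_sum, Finset.sum_filter]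
    refine Finset.sum_congr rfl fun s _ => ?_
    have := (hα c).ne'
    split_ifs with hE
    · field_simp
    · rw [hη.support s c hE, mul_zero]
  rw [Finset.sum_congr rfl fun c _ => h1 c, ← Finset.sum_mul, hsum, one_mul]

end Primitives

/-! ### Criteria for pooling and the matching rates -/

section Main

variable {J I : ℕ} [NeZero J] {Ω : Type*} [MeasurableSpace Ω] {Pr : Measure Ω}
  [IsProbabilityMeasure Pr] {E : Fin J → Fin I → Prop} {α : Fin I → ℝ} {rate : Fin J → Fin I → ℝ}
  {u : ℝ → ℤ → Ω → ℝ} {ξ : ℤ → Ω → Fin I} {v : Fin J → Fin I → ℕ → Ω → ℝ}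
  {η : Fin J → Fin I → ℝ} {m : ℝ} {a : Fin J → ℝ} {k : Fin I → ℝ}

/-- With a positive solution of the pooling equations, all the positions of almost every fluid limit
eventually coincide. -/
lemma IsPrimitives.ae_pos_eq (h : IsPrimitives Pr E α rate u ξ v)
    (hG : (compatGraph E).Connected) (hW : Weights E α rate a k) (hS : ∀ c, ∃ s, E s c)
    (hE : ∀ s, ∃ c, E s c)
    (hη : PoolingEquations E α rate η m) (hpos : ∀ s c, E s c → 0 < η s c) {lam : ℝ}
    (hlam : 0 < lam) (d : ℝ) : ∃ t₀ > 0, ∀ᵐ ω ∂Pr, Regular E α rate lam (sample u ξ v lam ω) ∧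
      ∀ p₀, InitialPositions d p₀ →
      ∀ P T D, IsFluidLimit E (sample u ξ v lam ω) p₀ P T D →
        ∀ t, t₀ < t → ∀ s s', P s t = P s' t := by
  have hp := hη.pooled hW
  obtain ⟨t₀, ht₀, hset⟩ := FluidPath.pos_eq_of_pooled hW hG hS hE hp hp.rate_pos hlam hpos d
  refine ⟨t₀, ht₀, ?_⟩
  filter_upwards [h.ae_regular hS hlam] with ω hω
  refine ⟨hω, fun p₀ hp₀ P T D hPTD t ht s s' => ?_⟩
  obtain ⟨hT, hP, -⟩ := hPTD.exists_scaling hω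
  rw [hP s t (ht₀.trans ht), hP s' t (ht₀.trans ht)]
  exact hset p₀ hp₀ T hT t ht s s'

lemma CompleteResourcePooling.of_pos (h : IsPrimitives Pr E α rate u ξ v)
    (hG : (compatGraph E).Connected) (hW : Weights E α rate a k) (hS : ∀ c, ∃ s, E s c)
    (hE : ∀ s, ∃ c, E s c)
    (hη : PoolingEquations E α rate η m) (hpos : ∀ s c, E s c → 0 < η s c) :
    CompleteResourcePooling Pr E u ξ v := by
  intro lam hlam d
  obtain ⟨t₀, -, hae⟩ := h.ae_pos_eq hG hW hS hE hη hpos hlam d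
  refine ⟨t₀, hae.mono fun ω hω p₀ hp₀ P T D hPTD t ht => sub_eq_zero.2 ?_⟩
  exact hω.2 p₀ hp₀ P T D hPTD t ht _ _

/-- A single realisation in the almost sure event supplies a deterministic fluid path that pools,
which is all that the necessity arguments use. -/
lemma CompleteResourcePooling.exists_fluidPath (hcrp : CompleteResourcePooling Pr E u ξ v)
    (h : IsPrimitives Pr E α rate u ξ v) (hS : ∀ c, ∃ s, E s c) (hE : ∀ s, ∃ c, E s c) {lam : ℝ}
    (hlam : 0 < lam) {p₀ : Fin J → ℝ} (hp₀ : ∀ s, p₀ s ≤ 0) :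
    ∃ T, FluidPath E α rate lam p₀ T ∧ ∃ t₀ ≥ 0, ∀ t > t₀, ∀ s s',
      fluidPos E α rate lam p₀ T s t = fluidPos E α rate lam p₀ T s' t := by
  obtain ⟨t₀, hae⟩ := hcrp lam hlam (-∑ s, p₀ s)
  obtain ⟨ω, hω, hreg⟩ := (hae.and (h.ae_regular hS hlam)).exists
  obtain ⟨P, T, D, hPTD⟩ := hreg.exists_isFluidLimit hE hp₀
  obtain ⟨hT, hP, -⟩ := hPTD.exists_scaling hreg
  refine ⟨T, hT, max t₀ 0, le_max_right _ _, fun t ht s s' => ?_⟩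
  have h1 := hω p₀ ⟨hp₀, rfl⟩ P T D hPTD t ((le_max_left _ _).trans_lt ht)
  have ht0 : 0 < t := (le_max_right _ _).trans_lt ht
  rw [← hP s t ht0, ← hP s' t ht0]
  have h2 := le_topLevel P s t
  have h3 := le_topLevel P s' t
  have h4 := bottomLevel_le P s t
  have h5 := bottomLevel_le P s' t
  linarith

/-- Pooling is tested at the overloaded arrival rate `m + 1`. Starting from an empty queue it gives
`η` non-negative; a vanishing `η s c` is then refuted by the initial positions of
`exists_never_pooled`. -/
lemma CompleteResourcePooling.pos (hcrp : CompleteResourcePooling Pr E u ξ v)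
    (h : IsPrimitives Pr E α rate u ξ v) (hG : (compatGraph E).IsTree)
    (hW : Weights E α rate a k) (hS : ∀ c, ∃ s, E s c) (hE : ∀ s, ∃ c, E s c)
    (hη : PoolingEquations E α rate η m) :
    ∀ s c, E s c → 0 < η s c := by
  have hp := hη.pooled hW
  have hm := hp.rate_pos
  have hlam : 0 < m + 1 := by linarith
  have hnonneg : ∀ s c, 0 ≤ η s c := by
    obtain ⟨T, hT, t₀, ht₀, heq⟩ := hcrp.exists_fluidPath h hS hE hlam (p₀ := 0) fun _ => le_rfl
    exact hT.nonneg_of_pos_eq hW hG hS hE hη (by linarith) ht₀ heq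
  intro s c hsc
  refine lt_of_le_of_ne (hnonneg s c) fun hzero => ?_
  obtain ⟨p₀, hp₀, hnever⟩ := exists_never_pooled hW hG.2 hS hp hnonneg hm
    (show m < m + 1 by linarith) hsc hzero.symm
  obtain ⟨T, hT, t₀, ht₀, heq⟩ := hcrp.exists_fluidPath h hS hE hlam hp₀
  exact hnever T hT (t₀ + 1) (by linarith) (heq _ (by linarith))

lemma CompleteWeakResourcePooling.of_nonneg (h : IsPrimitives Pr E α rate u ξ v)
    (hW : Weights E α rate a k) (hS : ∀ c, ∃ s, E s c) (hE : ∀ s, ∃ c, E s c)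
    (hη : PoolingEquations E α rate η m) (hnonneg : ∀ s c, E s c → 0 ≤ η s c) :
    CompleteWeakResourcePooling Pr E u ξ v := by
  intro lam hlam d
  have hp := hη.pooled hW
  obtain ⟨t₀, ht₀, hset⟩ :=
    FluidPath.pos_linear_of_pooled hW hS hE hp hp.rate_pos hlam hnonneg d
  refine ⟨t₀, ?_⟩
  filter_upwards [h.ae_regular hS hlam] with ω hω p₀ hp₀ P T D hPTD t ht
  obtain ⟨hT, hP, -⟩ := hPTD.exists_scaling hω
  refine ⟨lam + min (m - lam) 0, fun j => hasDerivAt_of_eventually_linear ?_⟩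
  filter_upwards [Ioi_mem_nhds ht] with σ hσ
  have h1 := level_shift (P := P) (t := σ) (t' := t) (κ := (σ - t) * (lam + min (m - lam) 0))
    (fun s => by
      rw [hP s σ (ht₀.trans hσ), hP s t (ht₀.trans ht), hset p₀ hp₀ T hT σ (le_of_lt hσ),
        hset p₀ hp₀ T hT t ht.le]
      ring) j
  rw [h1]; ring

/-- The pooled rate and the matching rates of the fluid model. -/
lemma IsPrimitives.fluid_matching_rates (h : IsPrimitives Pr E α rate u ξ v)
    (hG : (compatGraph E).IsTree) (hW : Weights E α rate a k) (hS : ∀ c, ∃ s, E s c)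
    (hE : ∀ s, ∃ c, E s c)
    (hη : PoolingEquations E α rate η m) (hpos : ∀ s c, E s c → 0 < η s c) {lam : ℝ}
    (hlam : 0 < lam) (d : ℝ) :
    ∃ t₀ : ℝ, ∀ᵐ ω ∂Pr, ∀ p₀, InitialPositions d p₀ →
      ∀ P T D, IsFluidLimit E (sample u ξ v lam ω) p₀ P T D →
      ∀ t, t₀ < t → topLevel P t < lam * t →
        (∀ j, HasDerivAt (level P j) m t) ∧
        ∃ δ : Fin J → Fin I → ℝ, (∀ s c, HasDerivAt (D s c) (δ s c) t) ∧
          ∑ s, ∑ c, δ s c = m ∧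
          ∀ s c, δ s c / ∑ s', ∑ c', δ s' c' = rate s c * η s c / m := by
  obtain ⟨t₀, ht₀, hae⟩ := h.ae_pos_eq hG.1 hW hS hE hη hpos hlam d
  refine ⟨t₀, hae.mono ?_⟩
  rintro ω ⟨hω, hω'⟩ p₀ hp₀ P T D hPTD t ht htop
  have heq := hω' p₀ hp₀ P T D hPTD
  obtain ⟨hT, hP, hD⟩ := hPTD.exists_scaling hω
  have ht0 := ht₀.trans ht
  have hderiv := fun s => hT.hasDerivAt_pooled hW hG hS hE hη ht₀.le (t₂ := t + 1)
    (fun τ hτ s s' => by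
      rw [← hP s τ (ht₀.trans hτ.1), ← hP s' τ (ht₀.trans hτ.1)]; exact heq τ hτ.1 s s')
    ⟨ht, by linarith⟩ (fun s => by rw [← hP s t ht0]; exact (le_topLevel P s t).trans_lt htop) s
  have hsum := hη.sum_rate h.α_pos h.sum_α
  refine ⟨fun j => (hderiv 0).1.congr_of_eventuallyEq ?_, fun s c => rate s c * η s c,
    fun s c => (((hderiv s).2 c).const_mul (rate s c)).congr_of_eventuallyEq ?_, hsum,
    fun s c => by rw [hsum]⟩
  · filter_upwards [Ioi_mem_nhds ht] with σ hσ
    rw [← hP 0 σ (ht₀.trans hσ)]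
    exact level_eq_of_forall_eq (fun s => heq σ hσ s 0) j
  · filter_upwards [Ioi_mem_nhds ht0] with σ hσ
    exact hD s c σ (le_of_lt hσ)

/-- The matching rates of an overloaded system. -/
lemma Regular.tendsto_done (hG : (compatGraph E).IsTree) (hW : Weights E α rate a k)
    (hS : ∀ c, ∃ s, E s c) (hE : ∀ s, ∃ c, E s c)
    (hη : PoolingEquations E α rate η m) (hpos : ∀ s c, 0 ≤ η s c) {lam : ℝ} {w : Sample J I}
    (hlam : m < lam) (hw : Regular E α rate lam w) {x : ℕ → State J I} (hx : IsRun E w x)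
    (s : Fin J) (c : Fin I) :
    Tendsto (fun t : ℝ => ((stateAt w x t).done s c : ℝ) / t) atTop (𝓝 (rate s c * η s c)) := by
  have hp := hη.pooled hW
  refine tendsto_of_subseq_tendsto fun b hb => ?_
  -- The single run is viewed at the scales `b n`, truncated to be non-negative, so that real time
  -- `b n` is fluid time one. Its fixed initial state scales to zero positions.
  have hscale : Tendsto (fun n => max (b n) 0) atTop atTop :=
    tendsto_atTop_mono (fun n => le_max_left _ _) hb
  have hsc : Scaled E w 0 (fun n => max (b n) 0) fun _ => x 0 :=
    ⟨hscale, fun _ => hx.initial, fun s => tendsto_const_nhds.div_atTop hscale,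
      tendsto_const_nhds.div_atTop hscale, fun s => tendsto_const_nhds.div_atTop hscale⟩
  obtain ⟨φ, hφ, T, hT⟩ := exists_fluidScaling hw (X := fun _ => x) (fun _ => hx)
    (fun n => le_max_right _ _) hsc
  have hF := hT.fluidPath hw
  have h0 : ∀ c, initialFront E (0 : Fin J → ℝ) c = 0 := by
    intro c
    obtain ⟨⟨s, -, hs⟩, -⟩ := isGreatest_initialFront (hS c) (0 : Fin J → ℝ)
    rw [← hs]; rfl
  have hfront : ∀ t, 0 ≤ t → ∀ c, fluidFront E α rate 0 T t c = m * t := fun t ht c => by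
    have := hF.front_eq_of_flow_pooled hW hS (fun _ => le_rfl) hp hpos hlam
      (fun s c c' _ hlt => by rw [h0, h0] at hlt; exact absurd hlt (lt_irrefl _)) ht c
    rwa [h0, zero_add] at this
  have hposT : ∀ t, 0 ≤ t → ∀ s, fluidPos E α rate lam 0 T s t = m * t := fun t ht s => by
    obtain ⟨c, -, hc⟩ := hF.exists_pos_eq (hE s) ht
    rw [hc, hfront t ht c]
  have hderiv : ∀ τ ∈ Ioo (0:ℝ) 1, HasDerivAt (T s c) (η s c) τ := fun τ hτ =>
    (hF.hasDerivAt_pooled hW hG hS hE hη le_rfl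
      (fun σ hσ s s' => by rw [hposT σ hσ.1.le, hposT σ hσ.1.le]) hτ
      (fun s => by rw [hposT τ hτ.1.le]; exact mul_lt_mul_of_pos_right hlam hτ.1) s).2 c
  -- The pooled solution from zero has derivative `η s c` on all of `(0, 1)`, so the mean value
  -- theorem gives the value at time one. The limit does not depend on the subsequence.
  have hone : T s c 1 = η s c := by
    obtain ⟨-, -, hslope⟩ := exists_hasDerivAt_eq_slope (T s c) (fun _ => η s c) zero_lt_one
      ((hF.continuousOn s c).mono Icc_subset_Ici_self) hderiv
    rw [hF.zero] at hslope
    simpa using hslope.symm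
  refine ⟨φ, ?_⟩
  have h1 := hT.tendsto_done hw s c zero_le_one
  rw [hone] at h1
  refine h1.congr' ?_
  filter_upwards [hφ.tendsto_atTop.eventually (hb.eventually_ge_atTop 0)] with n hn
  simp only [Function.comp_apply, mul_one, max_eq_left hn]

end Main

end SkillBased

theorem mainTheorem2 {J I : ℕ} [NeZero J] {Ω : Type*} [MeasurableSpace Ω]
    (Pr : Measure Ω) [IsProbabilityMeasure Pr]
    (E : Fin J → Fin I → Prop) (α : Fin I → ℝ) (rate : Fin J → Fin I → ℝ)
    (u : ℝ → ℤ → Ω → ℝ) (ξ : ℤ → Ω → Fin I) (v : Fin J → Fin I → ℕ → Ω → ℝ)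
    (hprim : IsPrimitives Pr E α rate u ξ v)
    (htree : (compatGraph E).IsTree) :
    -- (i) the equations of each block are uniquely solvable and give constant derivatives
    (∀ lam : ℝ, 0 < lam → ∀ᵐ ω ∂Pr, ∀ p₀ : Fin J → ℝ, (∀ s, p₀ s ≤ 0) →
      ∀ P T D, IsFluidLimit E (sample u ξ v lam ω) p₀ P T D →
      ∀ (t₁ t₂ : ℝ), 0 ≤ t₁ → t₁ < t₂ → ∀ (L : ℕ) (b : Fin J → Fin L),
      ValidPartition E P t₁ t₂ b → ∀ ℓ : Fin L,
        ∃ (η : Fin J → Fin I → ℝ) (y : ℝ),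
          BlockEquations E α rate b ℓ η y ∧
          (∀ η' y', BlockEquations E α rate b ℓ η' y' → η' = η ∧ y' = y) ∧
          ((∀ s, b s = ℓ → ∀ τ ∈ Set.Ioo t₁ t₂, P s τ < lam * τ) →
            ∀ s, b s = ℓ → ∀ τ ∈ Set.Ioo t₁ t₂,
              HasDerivAt (P s) y τ ∧ ∀ c, HasDerivAt (T s c) (η s c) τ)) ∧
    -- (i) the fluid limit has unique continuous piecewise linear trajectories
    (∀ lam : ℝ, 0 < lam → ∀ p₀ : Fin J → ℝ, (∀ s, p₀ s ≤ 0) →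
      ∃ p : Fin J → ℝ → ℝ,
        (∀ s, ContinuousOn (p s) (Set.Ioi 0) ∧ PiecewiseLinear (p s)) ∧
        ∀ᵐ ω ∂Pr,
          (∃ P T D, IsFluidLimit E (sample u ξ v lam ω) p₀ P T D) ∧
          ∀ P T D, IsFluidLimit E (sample u ξ v lam ω) p₀ P T D →
            ∀ s, ∀ t, 0 < t → P s t = p s t) ∧
    -- (ii) pooling and the pooling equations
    (∃! q : (Fin J → Fin I → ℝ) × ℝ, PoolingEquations E α rate q.1 q.2) ∧
    (CompleteResourcePooling Pr E u ξ v ↔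
      ∃ η m, PoolingEquations E α rate η m ∧ (∀ s c, E s c → 0 < η s c) ∧ 0 < m) ∧
    ((∃ η m, PoolingEquations E α rate η m ∧ (∀ s c, E s c → 0 ≤ η s c) ∧ 0 ≤ m) →
      CompleteWeakResourcePooling Pr E u ξ v) ∧
    -- (iii) pooled service rate and matching rates
    (CompleteResourcePooling Pr E u ξ v → ∀ η m, PoolingEquations E α rate η m →
      -- in the fluid model, as long as not all the work has been drained
      (∀ lam : ℝ, 0 < lam → ∀ d : ℝ, ∃ t₀ : ℝ, ∀ᵐ ω ∂Pr, ∀ p₀, InitialPositions d p₀ →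
        ∀ P T D, IsFluidLimit E (sample u ξ v lam ω) p₀ P T D →
        ∀ t, t₀ < t → topLevel P t < lam * t →
          (∀ j, HasDerivAt (level P j) m t) ∧
          ∃ δ : Fin J → Fin I → ℝ, (∀ s c, HasDerivAt (D s c) (δ s c) t) ∧
            ∑ s, ∑ c, δ s c = m ∧
            ∀ s c, δ s c / ∑ s', ∑ c', δ s' c' = rate s c * η s c / m) ∧
      -- in the system itself, when the arrival rate exceeds the pooled rate
      (∀ lam : ℝ, m < lam → ∀ᵐ ω ∂Pr, ∀ x, IsRun E (sample u ξ v lam ω) x →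
        Filter.Tendsto
          (fun t : ℝ => ((stateAt (sample u ξ v lam ω) x t).totalDone : ℝ) / t)
          Filter.atTop (nhds m) ∧
        ∀ s c, Filter.Tendsto
          (fun t : ℝ => ((stateAt (sample u ξ v lam ω) x t).done s c : ℝ) /
            ((stateAt (sample u ξ v lam ω) x t).totalDone : ℝ))
          Filter.atTop (nhds (rate s c * η s c / m)))) := by
  -- A sample point provides a customer type, so the graph has both kinds of nodes and connectedness
  -- gives every node a neighbour.
  obtain ⟨ω₀⟩ := nonempty_of_isProbabilityMeasure Pr
  have hE := exists_compat_type htree.1 (ξ 0 ω₀)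
  have hS := exists_compat_server htree.1 (0 : Fin J)
  obtain ⟨a, k, hW⟩ := exists_weights htree.2 hprim.α_pos hprim.rate_pos
  have huniq := existsUnique_poolingEquations htree hW (ξ 0 ω₀)
  obtain ⟨⟨η₀, m₀⟩, hη₀, -⟩ := id huniq
  refine ⟨fun lam hlam => ?_, fun lam hlam p₀ hp₀ => ?_, huniq, ⟨fun hcrp => ?_, ?_⟩, ?_,
    fun hcrp η m hη => ?_⟩
  · filter_upwards [hprim.ae_regular hS hlam] with ω hω p₀ hp₀ P T D hPTD t₁ t₂ ht₁ ht L b hV ℓ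
    obtain ⟨hT, hP, -⟩ := hPTD.exists_scaling hω
    have hV' := hV.congr fun s τ hτ => hP s τ (ht₁.trans_lt hτ.1)
    have hne := hT.blockTypes_nonempty hE hV' ht₁ ht ℓ
    obtain ⟨η, y, hη⟩ := exists_blockEquations hW hne (hV.connected ℓ)
    refine ⟨η, y, hη, fun η' y' hη' => blockEquations_unique htree.2 hW hne hη hη',
      fun hlow s hs τ hτ => ?_⟩
    have hτ0 : 0 < τ := ht₁.trans_lt hτ.1
    obtain ⟨h1, h2⟩ := hT.hasDerivAt_block hW htree.2 hE hV' ht₁ hη hτ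
      (fun s hs => by rw [← hP s τ hτ0]; exact hlow s hs τ hτ) hs
    refine ⟨h1.congr_of_eventuallyEq ?_, h2⟩
    filter_upwards [Ioi_mem_nhds hτ0] with σ hσ
    exact hP s σ hσ
  -- The trajectory is read off from one regular realisation. Uniqueness of the lags, which involves
  -- only `p₀` and the constants of the model, makes it common to all regular realisations.
  · obtain ⟨ω, hω⟩ := (hprim.ae_regular hS hlam).exists
    obtain ⟨P, T, D, hPTD⟩ := hω.exists_isFluidLimit hE hp₀
    obtain ⟨hT, -, -⟩ := hPTD.exists_scaling hω
    refine ⟨fluidPos E α rate lam p₀ T, fun s =>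
      ⟨(hT.continuousOn_pos s).mono Ioi_subset_Ici_self, hT.piecewiseLinear_pos hW s⟩, ?_⟩
    filter_upwards [hprim.ae_regular hS hlam] with ω' hω'
    refine ⟨hω'.exists_isFluidLimit hE hp₀, fun P' T' D' hPTD' s t ht => ?_⟩
    obtain ⟨hT', hP', -⟩ := hPTD'.exists_scaling hω'
    rw [hP' s t ht]
    exact hT'.pos_unique hT hW s ht.le
  · exact ⟨η₀, m₀, hη₀, hcrp.pos hprim htree hW hS hE hη₀, (hη₀.pooled hW).rate_pos⟩
  · rintro ⟨η, m, hη, hpos, -⟩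
    exact CompleteResourcePooling.of_pos hprim htree.1 hW hS hE hη hpos
  · rintro ⟨η, m, hη, hnonneg, -⟩
    exact CompleteWeakResourcePooling.of_nonneg hprim hW hS hE hη hnonneg
  · have hpos := hcrp.pos hprim htree hW hS hE hη
    have hm := (hη.pooled hW).rate_pos
    have hnonneg : ∀ s c, 0 ≤ η s c := fun s c => by
      by_cases hsc : E s c
      · exact (hpos s c hsc).le
      · exact (hη.support s c hsc).ge
    refine ⟨fun lam hlam d => hprim.fluid_matching_rates htree hW hS hE hη hpos hlam d,
      fun lam hlam => ?_⟩
    filter_upwards [hprim.ae_regular hS (hm.trans hlam)] with ω hω x hx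
    have hdone := fun s c => hω.tendsto_done htree hW hS hE hη hnonneg hlam hx s c
    have htotal : Tendsto (fun t : ℝ =>
        ((stateAt (sample u ξ v lam ω) x t).totalDone : ℝ) / t) atTop (𝓝 m) := by
      have h1 := tendsto_finsetSum Finset.univ fun s _ =>
        tendsto_finsetSum Finset.univ fun c _ => hdone s c
      rw [hη.sum_rate hprim.α_pos hprim.sum_α] at h1
      refine h1.congr fun t => ?_
      rw [State.totalDone]
      push_cast
      simp only [Finset.sum_div]
    refine ⟨htotal, fun s c => ((hdone s c).div htotal hm.ne').congr' ?_⟩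
    filter_upwards [eventually_ne_atTop 0] with t ht
    exact div_div_div_cancel_right₀ ht _ _
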